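/- Let $(\mathcal M,\mu)$ be a $\sigma$-finite measure space and let $\omega:\mathcal M\to[0,\infty)$ be measurable with $\omega>0$ $\mu$-almost everywhere. Let $\mathcal F=\bigoplus_{n\ge0}L^2_{\mathrm{sym}}(\mathcal M^n,\mu^{\otimes n})$ be the bosonic Fock space over $L^2(\mathcal M,\mu)$, with exponential vectors $\varepsilon(f)=\bigoplus_n (n!)^{-1/2}f^{\otimes n}$. Let $d\Gamma(\omega)$ be the second quantization of multiplication by $\omega$. The Weyl operators $W(f)$ are the unitary operators on $\mathcal F$ determined by $W(f)\varepsilon(g)=e^{-\|f\|^2/2-\langle f,g\rangle}\varepsilon(f+g)$ (inner products are linear in the second argument). Let $a(f)$ be the closure of the linear operator on $\operatorname{span}\{\varepsilon(g):g\in L^2(\mathcal M,\mu)\}$ with $a(f)\varepsilon(g)=\langle f,g\rangle\varepsilon(g)$, let $a^\dagger(f)=a(f)^*$, and let $\varphi(f)=\overline{a(f)+a^\dagger(f)}$. Put $$\mathfrak V_{\mathrm{reg}}=\{f\in L^2(\mathcal M,\mu): f/\sqrt\omega\in L^2(\mathcal M,\mu)\},\qquad \mathfrak V_{\mathrm{UV}}=\{f:\mathcal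 M\to\mathbb C \text{ measurable}: f/\omega\in L^2(\mathcal M,\mu)\}.$$ For $v=v_{\mathrm{reg}}+v_{\mathrm{UV}}$ with $v_{\mathrm{reg}}\in\mathfrak V_{\mathrm{reg}}$, $v_{\mathrm{UV}}\in\mathfrak V_{\mathrm{UV}}$ and $\langle v_{\mathrm{reg}},v_{\mathrm{UV}}/\omega\rangle=0$, and for $x=\pm1$, let $$h(v,x)=W(-x\,v_{\mathrm{UV}}/\omega)\big(d\Gamma(\omega)+x\varphi(v_{\mathrm{reg}})+\|\omega^{-1/2}v_{\mathrm{reg}}\|^2\big)W(x\,v_{\mathrm{UV}}/\omega)$$ on its natural domain. The renormalized spin boson Hamiltonian $H_{\mathrm{ren}}(v)$ on $L^2(\{\pm1\};\mathcal F)$ (counting measure on $\{\pm1\}$) is $$(H_{\mathrm{ren}}(v)\psi)(x)=\psi(x)-\psi(-x)+h(v,x)\psi(x),\qquad \mathcal D(H_{\mathrm{ren}}(v))=\{\psi:\psi(x)\in\mathcal D(h(v,x)),\ x=\pm1\}.$$ Let $\Omega_\downarrow\in L^2(\{\pm1\};\mathcal F)$ be the unit vector $\Omega_\downarrow(x)=\varepsilon(0)/\sqrt2$,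 $x=\pm1$. **Theorem.** Let $v\in\mathfrak V_{\mathrm{UV}}$, that is, $v$ is measurable and $v/\omega\in L^2(\mathcal M,\mu)$ (infrared regularity; $v\in L^2$, i.e. an ultraviolet cutoff, is not assumed). Then, for every decomposition of $v$ as above, $H_{\mathrm{ren}}(v)$ is selfadjoint, its spectrum is non-empty and bounded below, and with $E=\inf\sigma(H_{\mathrm{ren}}(v))$ it has a unique ground state: $$\dim\ker\big(H_{\mathrm{ren}}(v)-E\big)=1.$$ Moreover, the spectral projection of $H_{\mathrm{ren}}(v)$ onto $\{E\}$ (the orthogonal projection onto this kernel) satisfies $$\big\|\mathbf 1_{\{E\}}(H_{\mathrm{ren}}(v))\,\Omega_\downarrow\big\|^2\ \ge\ e^{-\|v/\omega\|^2}.$$ -/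

import Mathlib

open MeasureTheory
open scoped ENNReal InnerProductSpace

noncomputable section

namespace SpinBoson

/-! ### Generalities on unbounded operators -/

section Operators

variable {H : Type*} [NormedAddCommGroup H] [InnerProductSpace ℂ H]

/-- The composition `S T` of unbounded operators on its natural domain
`{ψ ∈ D(T) | T ψ ∈ D(S)}`. -/
def opComp (S T : H →ₗ.[ℂ] H) : H →ₗ.[ℂ] H where
  domain := (S.domain.comap T.toFun).map T.domain.subtype
  toFun :=
    { toFun := fun ψ => S ⟨T ⟨ψ, by
          obtain ⟨x, _, hx⟩ := ψ.2; exact hx ▸ x.2⟩, by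
          obtain ⟨x, hx, hx'⟩ := ψ.2
          have : (⟨ψ, by exact hx' ▸ x.2⟩ : T.domain) = x := Subtype.ext hx'.symm
          rw [this]; exact hx⟩
      map_add' := fun ψ φ => by
        rw [← LinearPMap.map_add]
        congr 1
        exact Subtype.ext (LinearPMap.map_add T ⟨ψ, _⟩ ⟨φ, _⟩)
      map_smul' := fun c ψ => by
        rw [RingHom.id_apply, ← LinearPMap.map_smul]
        congr 1
        exact Subtype.ext (LinearPMap.map_smul T c ⟨ψ, _⟩) }

/-- `z` is in the resolvent set of `T`: the operator `T - z : D(T) → H` is bijective with a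
bounded inverse `R`. -/
def IsResolventPoint (T : H →ₗ.[ℂ] H) (z : ℂ) : Prop :=
  ∃ R : H →L[ℂ] H,
    (∀ φ : H, ∃ h : R φ ∈ T.domain, T ⟨R φ, h⟩ - z • R φ = φ) ∧
    ∀ ψ : T.domain, R (T ψ - z • (ψ : H)) = ψ

/-- The spectrum `σ(T)` of an unbounded operator. -/
def opSpectrum (T : H →ₗ.[ℂ] H) : Set ℂ := {z | ¬ IsResolventPoint T z}

/-- The kernel `ker (T - z)`, as a subspace of `H`. -/
def eigenspace (T : H →ₗ.[ℂ] H) (z : ℂ) : Submodule ℂ H :=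
  (LinearMap.ker (T.toFun - z • T.domain.subtype)).map T.domain.subtype

/-- The spectral projection `1_{z}(T)` of a selfadjoint operator `T` at a point: the orthogonal
projection onto `ker (T - z)`. (The kernel is closed, since `T` is; taking the closure
is only needed to have the projection for arbitrary `T`.) -/
def pointProjection [CompleteSpace H] (T : H →ₗ.[ℂ] H) (z : ℂ) : H →L[ℂ] H :=
  (eigenspace T z).topologicalClosure.starProjection

/-- Given operators `h(x)` in `H`, `x = ±1`, the operator
`(T ψ)(x) = ψ(x) - ψ(-x) + h(x) ψ(x)` in `L²({±1}; H)` (with the counting measure on `{±1}`),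
with domain `{ψ | ψ(x) ∈ D(h(x)), x = ±1}`. -/
def spinOp (h : ℤˣ → H →ₗ.[ℂ] H) : (PiLp 2 fun _ : ℤˣ => H) →ₗ.[ℂ] (PiLp 2 fun _ : ℤˣ => H) where
  domain :=
    { carrier := {ψ | ∀ x, ψ x ∈ (h x).domain}
      zero_mem' := fun x => (h x).domain.zero_mem
      add_mem' := fun h1 h2 x => (h x).domain.add_mem (h1 x) (h2 x)
      smul_mem' := fun c _ h1 x => (h x).domain.smul_mem c (h1 x) }
  toFun :=
    { toFun := fun ψ => WithLp.toLp 2 fun x => ψ.1 x - ψ.1 (-x) + h x ⟨ψ.1 x, ψ.2 x⟩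
      map_add' := fun ψ φ => by
        ext1 x
        have e := (h x).map_add ⟨ψ.1 x, ψ.2 x⟩ ⟨φ.1 x, φ.2 x⟩
        change (ψ.1 x + φ.1 x) - (ψ.1 (-x) + φ.1 (-x)) +
          h x (⟨ψ.1 x, ψ.2 x⟩ + ⟨φ.1 x, φ.2 x⟩) =
          (ψ.1 x - ψ.1 (-x) + h x ⟨ψ.1 x, ψ.2 x⟩) + (φ.1 x - φ.1 (-x) + h x ⟨φ.1 x, φ.2 x⟩)
        rw [e]
        abel
      map_smul' := fun c ψ => by
        ext1 x
        have e := (h x).map_smul c ⟨ψ.1 x, ψ.2 x⟩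
        change c • ψ.1 x - c • ψ.1 (-x) + h x (c • ⟨ψ.1 x, ψ.2 x⟩) =
          c • (ψ.1 x - ψ.1 (-x) + h x ⟨ψ.1 x, ψ.2 x⟩)
        rw [e, smul_add, smul_sub] }

end Operators

/-! ### Bosonic Fock space -/

section Fock

variable {M : Type*} [MeasurableSpace M] (μ : Measure M) [SigmaFinite μ]

/-- The one-boson space `L²(M, μ)`. -/
abbrev OneBoson := Lp ℂ 2 μ

theorem measurePreserving_perm {n : ℕ} (σ : Equiv.Perm (Fin n)) :
    MeasurePreserving (fun (k : Fin n → M) i => k (σ i))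
      (Measure.pi fun _ : Fin n => μ) (Measure.pi fun _ : Fin n => μ) := by
  have h := measurePreserving_piCongrLeft (fun _ : Fin n => μ) σ.symm
  convert h using 1
  ext k i
  have := Equiv.piCongrLeft_apply (fun _ : Fin n => M) σ.symm k i
  simpa [MeasurableEquiv.coe_piCongrLeft] using this.symm

/-- The action `f ↦ f(k_{σ(1)}, …, k_{σ(n)})` of a permutation on `L²(Mⁿ, μⁿ)`. -/
def permL2 {n : ℕ} (σ : Equiv.Perm (Fin n)) :
    Lp ℂ 2 (Measure.pi fun _ : Fin n => μ) →ₗᵢ[ℂ] Lp ℂ 2 (Measure.pi fun _ : Fin n => μ) :=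
  Lp.compMeasurePreservingₗᵢ ℂ (fun k i => k (σ i)) (measurePreserving_perm μ σ)

/-- The `n`-boson space `L²_sym(Mⁿ, μⁿ)`. For `n = 0`, `M⁰` is a one-point space of
measure one, and the space is `ℂ`. -/
def symL2 (n : ℕ) : Submodule ℂ (Lp ℂ 2 (Measure.pi fun _ : Fin n => μ)) :=
  ⨅ σ : Equiv.Perm (Fin n), LinearMap.eqLocus (permL2 μ σ).toLinearMap LinearMap.id

theorem isClosed_symL2 (n : ℕ) :
    IsClosed (symL2 μ n : Set (Lp ℂ 2 (Measure.pi fun _ : Fin n => μ))) := by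
  rw [symL2, Submodule.coe_iInf]
  exact isClosed_iInter fun σ => isClosed_eq (permL2 μ σ).continuous continuous_id

instance (n : ℕ) : CompleteSpace (symL2 μ n) :=
  (isClosed_symL2 μ n).completeSpace_coe

/-- The bosonic Fock space: the Hilbert direct sum of the spaces `L²_sym(Mⁿ, μⁿ)`, `n ≥ 0`. -/
abbrev Fock := lp (fun n : ℕ => symL2 μ n) 2

variable {μ}

theorem memLp_tensorPow (n : ℕ) (f : OneBoson μ) :
    MemLp (fun k : Fin n → M => ∏ i, f (k i)) 2 (Measure.pi fun _ : Fin n => μ) := by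
  have hf : StronglyMeasurable (f : M → ℂ) := Lp.stronglyMeasurable f
  have hm : AEStronglyMeasurable (fun k : Fin n → M => ∏ i, f (k i))
      (Measure.pi fun _ : Fin n => μ) :=
    (Finset.stronglyMeasurable_fun_prod Finset.univ
      fun i _ => hf.comp_measurable (measurable_pi_apply i)).aestronglyMeasurable
  rw [memLp_two_iff_integrable_sq_norm hm]
  have h2 : Integrable (fun k => ‖f k‖ ^ 2) μ :=
    (memLp_two_iff_integrable_sq_norm hf.aestronglyMeasurable).1 (Lp.memLp f)
  simpa [norm_prod, Finset.prod_pow] using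
    Integrable.fintype_prod (ι := Fin n) (f := fun _ k => ‖f k‖ ^ 2) (μ := fun _ => μ)
      fun _ => h2

/-- The tensor power `f^{⊗n} : (k₁, …, kₙ) ↦ f(k₁) ⋯ f(kₙ)`. -/
def tensorPow (n : ℕ) (f : OneBoson μ) : symL2 μ n :=
  ⟨(memLp_tensorPow n f).toLp _, by
    rw [symL2, Submodule.mem_iInf]
    intro σ
    change Lp.compMeasurePreserving _ (measurePreserving_perm μ σ) _ = _
    rw [Lp.toLp_compMeasurePreserving]
    congr 1
    ext k
    exact Equiv.prod_comp σ fun i => f (k i)⟩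

theorem inner_tensorPow (n : ℕ) (f g : OneBoson μ) :
    ⟪tensorPow n f, tensorPow n g⟫_ℂ = ⟪f, g⟫_ℂ ^ n := by
  rw [Submodule.coe_inner, L2.inner_def, L2.inner_def]
  have h : ∀ᵐ k ∂(Measure.pi fun _ : Fin n => μ),
      ⟪((tensorPow n f : symL2 μ n) : Lp ℂ 2 (Measure.pi fun _ : Fin n => μ)) k,
        ((tensorPow n g : symL2 μ n) : Lp ℂ 2 (Measure.pi fun _ : Fin n => μ)) k⟫_ℂ
        = ∏ i, ⟪f (k i), g (k i)⟫_ℂ := by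
    filter_upwards [(memLp_tensorPow n f).coeFn_toLp, (memLp_tensorPow n g).coeFn_toLp]
      with k h1 h2
    change ⟪((memLp_tensorPow n f).toLp _ : Lp ℂ 2 _) k,
      ((memLp_tensorPow n g).toLp _ : Lp ℂ 2 _) k⟫_ℂ = _
    simp only [h1, h2, RCLike.inner_apply, map_prod, Finset.prod_mul_distrib]
  rw [integral_congr_ae h]
  simpa using integral_fintype_prod_eq_pow (ι := Fin n) (μ := μ) fun k => ⟪f k, g k⟫_ℂ

theorem norm_tensorPow (n : ℕ) (f : OneBoson μ) : ‖tensorPow n f‖ = ‖f‖ ^ n := by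
  have h : ‖tensorPow n f‖ ^ 2 = (‖f‖ ^ n) ^ 2 := by
    have := (inner_self_eq_norm_sq_to_K (𝕜 := ℂ) (tensorPow n f)).symm.trans (inner_tensorPow n f f)
    rw [inner_self_eq_norm_sq_to_K (𝕜 := ℂ)] at this
    rw [pow_right_comm]
    exact_mod_cast this
  exact (pow_left_inj₀ (norm_nonneg _) (by positivity) two_ne_zero).1 h

/-- The exponential vector `ε(f) = ⨁ₙ (n!)^{-1/2} f^{⊗n}`. -/
def expVec (f : OneBoson μ) : Fock μ :=
  ⟨fun n => ((1 / Real.sqrt n.factorial : ℝ) : ℂ) • tensorPow n f, by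
    refine memℓp_gen ?_
    have h := Real.summable_pow_div_factorial (‖f‖ ^ 2)
    convert h using 2 with n
    rw [norm_smul, norm_tensorPow]
    simp only [ENNReal.toReal_ofNat, Real.rpow_ofNat, Complex.norm_real, Real.norm_eq_abs,
      mul_pow, sq_abs, div_pow, one_pow]
    rw [Real.sq_sqrt (by positivity)]
    ring⟩

theorem inner_expVec (f g : OneBoson μ) :
    ⟪expVec f, expVec g⟫_ℂ = Complex.exp ⟪f, g⟫_ℂ := by
  rw [lp.inner_eq_tsum, Complex.exp_eq_exp_ℂ, NormedSpace.exp_eq_tsum_div]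
  refine tsum_congr fun n => ?_
  change ⟪((1 / Real.sqrt n.factorial : ℝ) : ℂ) • tensorPow n f,
    ((1 / Real.sqrt n.factorial : ℝ) : ℂ) • tensorPow n g⟫_ℂ = _
  refine (inner_smul_left (𝕜 := ℂ) (tensorPow n f) _ _).trans ?_
  refine (congrArg _ (inner_smul_right (𝕜 := ℂ) (tensorPow n f) (tensorPow n g) _)).trans ?_
  rw [inner_tensorPow, Complex.conj_ofReal, ← mul_assoc, ← Complex.ofReal_mul]
  have : (1 / Real.sqrt n.factorial) * (1 / Real.sqrt n.factorial) = 1 / (n.factorial : ℝ) := by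
    rw [div_mul_div_comm, one_mul, Real.mul_self_sqrt (by positivity)]
  rw [this]
  push_cast
  ring

/-- The graph of the linear operator with domain `span {ε(g) | g ∈ L²}` that acts as
`ε(g) ↦ c(g) ε(τ(g))`. -/
def expGraph (c : OneBoson μ → ℂ) (τ : OneBoson μ → OneBoson μ) :
    Submodule ℂ (Fock μ × Fock μ) :=
  Submodule.span ℂ (Set.range fun g => (expVec g, c g • expVec (τ g)))

/-- The operator `W(f) ε(g) = e^{-‖f‖²/2 - ⟨f, g⟩} ε(f + g)` on `span {ε(g) | g ∈ L²}`. -/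
def weylCore (f : OneBoson μ) : Fock μ →ₗ.[ℂ] Fock μ :=
  (expGraph (fun g => Complex.exp (-(‖f‖ ^ 2 / 2 : ℝ) - ⟪f, g⟫_ℂ)) fun g => f + g).toLinearPMap

/-- The Weyl operator `W(f)`: the continuous extension (that is, the closure) of the isometry
`weylCore f`. -/
def weyl (f : OneBoson μ) : Fock μ →ₗ.[ℂ] Fock μ := (weylCore f).closure

theorem inner_weyl_graph (f : OneBoson μ) :
    ∀ p ∈ expGraph (fun g => Complex.exp (-(‖f‖ ^ 2 / 2 : ℝ) - ⟪f, g⟫_ℂ)) fun g => f + g,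
    ∀ q ∈ expGraph (fun g => Complex.exp (-(‖f‖ ^ 2 / 2 : ℝ) - ⟪f, g⟫_ℂ)) fun g => f + g,
    ⟪p.2, q.2⟫_ℂ = ⟪p.1, q.1⟫_ℂ := by
  intro p hp
  induction hp using Submodule.span_induction with
  | zero => intro q hq; simp
  | add x y _ _ hx hy => intro q hq; simp [hx q hq, hy q hq]
  | smul c x _ hx => intro q hq; simp [hx q hq]
  | mem p hp =>
    obtain ⟨g, rfl⟩ := hp
    intro q hq
    induction hq using Submodule.span_induction with
    | zero => simp
    | add x y _ _ hx hy => simp at *; rw [hx, hy]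
    | smul c x _ hx => simp at *; left; rw [hx]
    | mem q hq =>
      obtain ⟨h, rfl⟩ := hq
      simp only [inner_smul_left, inner_smul_right, inner_expVec, ← Complex.exp_conj, ← Complex.exp_add]
      congr 1
      simp only [map_sub, map_neg, Complex.conj_ofReal, inner_conj_symm, inner_add_left, inner_add_right]
      have : ⟪f, f⟫_ℂ = ((‖f‖ ^ 2 : ℝ) : ℂ) := by rw [inner_self_eq_norm_sq_to_K]; push_cast; rfl
      rw [this]; push_cast; ring

/-- `weylCore f` is well defined: its graph is the given one. -/
theorem graph_weylCore (f : OneBoson μ) :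
   (weylCore f).graph
    = expGraph (fun g => Complex.exp (-(‖f‖ ^ 2 / 2 : ℝ) - ⟪f, g⟫_ℂ)) fun g => f + g := by
  apply Submodule.toLinearPMap_graph_eq
  intro x hx h0
  have := inner_weyl_graph f x hx x hx
  rw [h0, inner_zero_left] at this
  exact inner_self_eq_zero.1 this

/-- `weylCore f` is closable. -/
theorem isClosable_weylCore (f : OneBoson μ) :
   (weylCore f).IsClosable := by
  refine ⟨(_ : Submodule ℂ _).topologicalClosure.toLinearPMap, (Submodule.toLinearPMap_graph_eq _ ?_).symm⟩
  rintro x hx h0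
  have hcl : IsClosed {x : Fock μ × Fock μ | ‖x.2‖ = ‖x.1‖} :=
    isClosed_eq (by fun_prop) (by fun_prop)
  have : x ∈ {x : Fock μ × Fock μ | ‖x.2‖ = ‖x.1‖} := by
    refine closure_minimal ?_ hcl hx
    intro y hy
    rw [SetLike.mem_coe, graph_weylCore] at hy
    have := inner_weyl_graph f y hy y hy
    simp only [inner_self_eq_norm_sq_to_K] at this
    have h3 : ‖y.2‖^2 = ‖y.1‖^2 := by exact_mod_cast this
    exact (pow_left_inj₀ (norm_nonneg _) (norm_nonneg _) two_ne_zero).1 h3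
  simp [h0] at this
  exact this

/-- `W(f) ε(g) = e^{-‖f‖²/2 - ⟨f, g⟩} ε(f + g)`. -/
theorem weyl_expVec (f g : OneBoson μ) : (expVec g, Complex.exp (-(‖f‖ ^ 2 / 2 : ℝ) - ⟪f, g⟫_ℂ) • expVec (f + g)) ∈ (weyl f).graph := by
  rw [weyl, ← (isClosable_weylCore f).graph_closure_eq_closure_graph]
  apply Submodule.le_topologicalClosure
  rw [graph_weylCore]
  exact Submodule.subset_span ⟨g, rfl⟩

/-- The operator `a(f) ε(g) = ⟨f, g⟩ ε(g)` on `span {ε(g) | g ∈ L²}`. -/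
def annihilationCore (f : OneBoson μ) : Fock μ →ₗ.[ℂ] Fock μ :=
  (expGraph (fun g => ⟪f, g⟫_ℂ) fun g => g).toLinearPMap

/-- The annihilation operator: the closure of `annihilationCore f`. -/
def annihilation (f : OneBoson μ) : Fock μ →ₗ.[ℂ] Fock μ := (annihilationCore f).closure

theorem ann_bound (f h : OneBoson μ) (p : Fock μ × Fock μ) (hp : p ∈ expGraph (fun g => ⟪f, g⟫_ℂ) fun g => g) :
    ‖⟪expVec h, p.2⟫_ℂ‖ ≤ Real.exp ((‖h‖ + ‖f‖) ^ 2 / 2) * ‖p.1‖ := by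
  have hd : HasDerivAt (fun z : ℂ => ⟪expVec (h + (starRingEnd ℂ z) • f), p.1⟫_ℂ) ⟪expVec h, p.2⟫_ℂ 0 ∧
     Differentiable ℂ (fun z : ℂ => ⟪expVec (h + (starRingEnd ℂ z) • f), p.1⟫_ℂ) := by
    induction hp using Submodule.span_induction with
    | zero => simp [hasDerivAt_const]
    | add x y _ _ hx hy =>
      simp only [Prod.fst_add, Prod.snd_add, inner_add_right]
      exact ⟨hx.1.add hy.1, hx.2.add hy.2⟩
    | smul c x _ hx =>
      simp only [Prod.smul_fst, Prod.smul_snd, inner_smul_right]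
      exact ⟨hx.1.const_mul c, hx.2.const_mul c⟩
    | mem x hx =>
      obtain ⟨g, rfl⟩ := hx
      simp only [inner_expVec, inner_smul_right, inner_add_left, inner_smul_left, RCLike.conj_conj]
      constructor
      · have : HasDerivAt (fun z : ℂ => ⟪h, g⟫_ℂ + z * ⟪f, g⟫_ℂ) (1 * ⟪f, g⟫_ℂ) 0 :=
          ((hasDerivAt_id (0:ℂ)).mul_const _).const_add _
        have e := this.cexp
        rw [zero_mul, add_zero, one_mul, mul_comm] at e
        exact e
      · fun_prop
  rw [← hd.1.deriv]
  have := Complex.norm_deriv_le_of_forall_mem_sphere_norm_le (c := 0) (R := 1) one_pos (hd.2.diffContOnCl)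
    (C := Real.exp ((‖h‖ + ‖f‖) ^ 2 / 2) * ‖p.1‖) ?_
  · simpa using this
  intro z hz
  refine (norm_inner_le_norm _ _).trans ?_
  gcongr
  set u := h + (starRingEnd ℂ z) • f
  have h1 : ‖u‖ ≤ ‖h‖ + ‖f‖ := by
    refine (norm_add_le _ _).trans ?_
    rw [norm_smul, RCLike.norm_conj, mem_sphere_zero_iff_norm.1 hz, one_mul]
  have h2 : ‖expVec u‖ ^ 2 = Real.exp (‖u‖ ^ 2) := by
    have := inner_expVec u u
    rw [inner_self_eq_norm_sq_to_K, inner_self_eq_norm_sq_to_K] at this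
    apply Complex.ofReal_injective
    push_cast
    exact this
  have h3 : ‖expVec u‖ = Real.exp (‖u‖ ^ 2 / 2) := by
    refine (pow_left_inj₀ (norm_nonneg _) (Real.exp_pos _).le two_ne_zero).1 ?_
    rw [h2, ← Real.exp_nat_mul]; congr 1; push_cast; ring
  rw [h3]
  gcongr

set_option maxHeartbeats 1000000 in
theorem ann_single (f : OneBoson μ) (p : Fock μ × Fock μ)
    (hp : p ∈ (expGraph (fun g => ⟪f, g⟫_ℂ) fun g => g).topologicalClosure) (h0 : p.1 = 0) :
    p.2 = 0 := by
  have hb : ∀ h, ⟪expVec h, p.2⟫_ℂ = 0 := by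
    intro h
    have hcl : IsClosed {p : Fock μ × Fock μ | ‖⟪expVec h, p.2⟫_ℂ‖ ≤ Real.exp ((‖h‖ + ‖f‖) ^ 2 / 2) * ‖p.1‖} :=
      isClosed_le (by fun_prop) (by fun_prop)
    have : p ∈ {p : Fock μ × Fock μ | ‖⟪expVec h, p.2⟫_ℂ‖ ≤ Real.exp ((‖h‖ + ‖f‖) ^ 2 / 2) * ‖p.1‖} :=
      closure_minimal (fun q hq => ann_bound f h q hq) hcl hp
    simpa only [Set.mem_ofPred_eq, h0, norm_zero, mul_zero, norm_le_zero_iff] using this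
  set K := Submodule.span ℂ (Set.range (expVec (μ := μ)))
  have h2 : p.2 ∈ K.topologicalClosure := by
    have hcl : IsClosed {p : Fock μ × Fock μ | p.2 ∈ K.topologicalClosure} :=
      K.isClosed_topologicalClosure.preimage continuous_snd
    refine closure_minimal (t := {p : Fock μ × Fock μ | p.2 ∈ K.topologicalClosure})
      (fun q hq => K.le_topologicalClosure ?_) hcl hp
    have : (expGraph (fun g => ⟪f, g⟫_ℂ) fun g => g).map (LinearMap.snd ℂ _ _) ≤ K := by
      rw [expGraph, Submodule.map_span, Submodule.span_le]
      rintro _ ⟨_, ⟨g, rfl⟩, rfl⟩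
      exact K.smul_mem _ (Submodule.subset_span ⟨g, rfl⟩)
    exact this ⟨q, hq, rfl⟩
  have h3 : p.2 ∈ K.topologicalClosureᗮ := by
    rw [Submodule.orthogonal_closure, Submodule.mem_orthogonal]
    intro u hu
    induction hu using Submodule.span_induction with
    | zero => simp
    | add x y _ _ hx hy => rw [inner_add_left, hx, hy, add_zero]
    | smul c x _ hx => rw [inner_smul_left, hx, mul_zero]
    | mem x hx => obtain ⟨g, rfl⟩ := hx; exact hb g
  exact (Submodule.mem_bot ℂ).1 (K.topologicalClosure.inf_orthogonal_eq_bot ▸ ⟨h2, h3⟩)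

/-- `annihilationCore f` is well defined (its graph is the given one) and closable. -/
theorem ann_closable (f : OneBoson μ) :
    (annihilationCore f).IsClosable ∧ (annihilationCore f).graph = expGraph (fun g => ⟪f, g⟫_ℂ) fun g => g := by
  have h : (annihilationCore f).graph = expGraph (fun g => ⟪f, g⟫_ℂ) fun g => g :=
    Submodule.toLinearPMap_graph_eq _ fun x hx h0 => ann_single f x (Submodule.le_topologicalClosure _ hx) h0
  refine ⟨⟨(expGraph (fun g => ⟪f, g⟫_ℂ) fun g => g).topologicalClosure.toLinearPMap, ?_⟩, h⟩
  rw [h]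
  exact (Submodule.toLinearPMap_graph_eq _ fun x hx h0 => ann_single f x hx h0).symm

/-- The creation operator `a†(f) = a(f)*`. -/
def creation (f : OneBoson μ) : Fock μ →ₗ.[ℂ] Fock μ := (annihilation f).adjoint

/-- The field operator `φ(f)`, the closure of `a(f) + a†(f)`. -/
def field (f : OneBoson μ) : Fock μ →ₗ.[ℂ] Fock μ := (annihilation f + creation f).closure

variable (μ) in
/-- The graph of `dΓ(ω)`: multiplication by `ω(k₁) + ⋯ + ω(kₙ)` on each `n`-boson space, on its
maximal domain. -/
def dGammaGraph (ω : M → ℝ) : Submodule ℂ (Fock μ × Fock μ) where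
  carrier := {p | ∀ n : ℕ,
    (((p.2 : ∀ n, symL2 μ n) n : Lp ℂ 2 (Measure.pi fun _ : Fin n => μ)) : (Fin n → M) → ℂ)
      =ᵐ[Measure.pi fun _ : Fin n => μ] fun k => ((∑ i, ω (k i) : ℝ) : ℂ) *
        ((p.1 : ∀ n, symL2 μ n) n : Lp ℂ 2 (Measure.pi fun _ : Fin n => μ)) k}
  zero_mem' := fun n => by
    filter_upwards [Lp.coeFn_zero ℂ 2 (Measure.pi fun _ : Fin n => μ)] with k hk
    change (0 : Lp ℂ 2 (Measure.pi fun _ : Fin n => μ)) k =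
      _ * (0 : Lp ℂ 2 (Measure.pi fun _ : Fin n => μ)) k
    rw [hk, Pi.zero_apply, mul_zero]
  add_mem' := fun {p q} hp hq n => by
    filter_upwards [hp n, hq n,
      Lp.coeFn_add (p := 2) (((p.1 : ∀ n, symL2 μ n) n : Lp ℂ 2 (Measure.pi fun _ : Fin n => μ)))
        ((q.1 : ∀ n, symL2 μ n) n : Lp ℂ 2 (Measure.pi fun _ : Fin n => μ)),
      Lp.coeFn_add (p := 2) (((p.2 : ∀ n, symL2 μ n) n : Lp ℂ 2 (Measure.pi fun _ : Fin n => μ)))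
        ((q.2 : ∀ n, symL2 μ n) n : Lp ℂ 2 (Measure.pi fun _ : Fin n => μ))] with k h1 h2 h3 h4
    simp only [Prod.fst_add, Prod.snd_add, lp.coeFn_add, Pi.add_apply, Submodule.coe_add] at *
    rw [h3, h4, h1, h2]
    ring
  smul_mem' := fun c p hp n => by
    filter_upwards [hp n,
      Lp.coeFn_smul (p := 2) c ((p.1 : ∀ n, symL2 μ n) n : Lp ℂ 2 (Measure.pi fun _ : Fin n => μ)),
      Lp.coeFn_smul (p := 2) c ((p.2 : ∀ n, symL2 μ n) n : Lp ℂ 2 (Measure.pi fun _ : Fin n => μ))]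
      with k h1 h2 h3
    simp only [Prod.smul_fst, Prod.smul_snd, lp.coeFn_smul, Pi.smul_apply, Submodule.coe_smul,
      smul_eq_mul] at *
    rw [h2, h3, h1]
    ring

/-- `dΓ(ω)` is well defined: `dGammaGraph` is the graph of an operator. -/
theorem dGammaGraph_single (ω : M → ℝ) : ∀ p ∈ dGammaGraph μ ω, p.1 = 0 → p.2 = 0 := by
  intro p hp h0
  ext1
  funext n
  refine Subtype.ext (Lp.ext ?_)
  refine (hp n).trans ?_
  filter_upwards [Lp.coeFn_zero ℂ 2 (Measure.pi fun _ : Fin n => μ)] with k hk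
  rw [h0]
  change _ * (0 : Lp ℂ 2 (Measure.pi fun _ : Fin n => μ)) k = (0 : Lp ℂ 2 (Measure.pi fun _ : Fin n => μ)) k
  rw [hk, Pi.zero_apply, mul_zero]

variable (μ) in
/-- The second quantization `dΓ(ω)` of the multiplication operator `ω`. -/
def dGamma (ω : M → ℝ) : Fock μ →ₗ.[ℂ] Fock μ := (dGammaGraph μ ω).toLinearPMap

end Fock

/-! ### The renormalized spin boson Hamiltonian -/

section Hamiltonian

variable {M : Type*} [MeasurableSpace M] (μ : Measure M) (ω : M → ℝ)

/-- The space of regular form factors: `v ∈ L²` and `v / √ω ∈ L²`. -/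
def Vreg : Set (M → ℂ) :=
  {v | MemLp v 2 μ ∧ MemLp (fun k => v k / (Real.sqrt (ω k) : ℂ)) 2 μ}

/-- The space of infrared regular, possibly ultraviolet singular form factors: `v / ω ∈ L²`. -/
def Vuv : Set (M → ℂ) :=
  {v | AEStronglyMeasurable v μ ∧ MemLp (fun k => v k / (ω k : ℂ)) 2 μ}

/-- A decomposition `v = v_reg + v_UV` with `v_reg ∈ V_reg`, `v_UV ∈ V_UV` and
`⟨v_reg, v_UV / ω⟩ = 0`. -/
structure Decomposition (v : M → ℂ) where
  reg : M → ℂ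
  uv : M → ℂ
  reg_mem : reg ∈ Vreg μ ω
  uv_mem : uv ∈ Vuv μ ω
  sum_eq : v =ᵐ[μ] fun k => reg k + uv k
  orthogonal : ∫ k, (starRingEnd ℂ) (reg k) * (uv k / (ω k : ℂ)) ∂μ = 0

variable {μ ω} {v : M → ℂ}

/-- A form factor in `V_UV` has the trivial decomposition `v = 0 + v`. -/
def Decomposition.trivial (hv : v ∈ Vuv μ ω) : Decomposition μ ω v where
  reg := 0
  uv := v
  reg_mem := by simp [Vreg]
  uv_mem := hv
  sum_eq := by simp
  orthogonal := by simp

/-- `v_reg` as an element of `L²`. -/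
def Decomposition.regL2 (d : Decomposition μ ω v) : OneBoson μ := d.reg_mem.1.toLp _

/-- `v_UV / ω` as an element of `L²`. -/
def Decomposition.uvL2 (d : Decomposition μ ω v) : OneBoson μ := d.uv_mem.2.toLp _

variable [SigmaFinite μ]

/-- The renormalized van Hove Hamiltonian
`h(v, x) = W(-x v_UV/ω) (dΓ(ω) + x φ(v_reg) + ‖ω^{-1/2} v_reg‖²) W(x v_UV/ω)`, `x = ±1`. -/
def vanHove (d : Decomposition μ ω v) (x : ℤˣ) : Fock μ →ₗ.[ℂ] Fock μ :=
  opComp (weyl (-(((x : ℤ) : ℂ) • d.uvL2)))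
    (opComp
      (dGamma μ ω + ((x : ℤ) : ℂ) • field d.regL2 +
        (((∫ k, ‖d.reg k / (Real.sqrt (ω k) : ℂ)‖ ^ 2 ∂μ : ℝ) : ℂ) •
          (LinearMap.id : Fock μ →ₗ[ℂ] Fock μ)).toPMap ⊤)
      (weyl (((x : ℤ) : ℂ) • d.uvL2)))

variable (μ) in
/-- The Hilbert space `L²({±1}; 𝓕)` (with the counting measure on `{±1}`). -/
abbrev SpinFock := PiLp 2 fun _ : ℤˣ => Fock μ

/-- The self-energy renormalized spin boson Hamiltonian on `L²({±1}; 𝓕)`: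
`(H ψ)(x) = ψ(x) - ψ(-x) + h(v, x) ψ(x)` for all `ψ` with `ψ(x) ∈ D(h(v, x))`, `x = ±1`. -/
def Hren (d : Decomposition μ ω v) : SpinFock μ →ₗ.[ℂ] SpinFock μ := spinOp (vanHove d)

variable (μ) in
/-- The normalized ground state `Ω_↓` of the decoupled model: `Ω_↓(x) = ε(0) / √2`, `x = ±1`. -/
def vacuumDown : SpinFock μ :=
  WithLp.toLp 2 fun _ => ((1 / Real.sqrt 2 : ℝ) : ℂ) • expVec (0 : OneBoson μ)

end Hamiltonian

end SpinBoson

end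

open MeasureTheory
open scoped ENNReal InnerProductSpace

noncomputable section

namespace SpinBoson

open Filter Topology

/-! Put f = v/ω, which lies in L². Completing the square shows that every decomposition of v yields
the same operator, h(v,x) = W(-xf) dΓ(ω) W(xf) (`mem_vanHove_graph_iff`). With J the spin flip, H +
c = (h + c + 1) - J is inverted by a bounded symmetric operator A that solves A = R(1 + JA), R = (h
+ c + 1)⁻¹ (`IsPerturbed`, `hasRes_spinOp`). Selfadjointness follows, and the rest is read off from
A: ground states are the eigenvectors of A for the eigenvalue ‖A‖, and E = ‖A‖⁻¹ - c.

Positivity is carried by exponential vectors. The semigroup of h(v,x) sends ε(z) to a multiple of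
ε(e^{-tω}z - x(1 - e^{-tω})f). If z = rf with r real and |r| ≤ 1, the new multiplier is a convex
combination of r and -x, and the scalar factor is positive (`UnitMul.shift`,
`SpinSemigroup.T_unit`). The closed convex cone generated by these unit exponential vectors is thus
preserved by the semigroup and by J, hence by R (a Laplace transform) and by A (a Neumann series).

Existence and overlap come together. Let Ω = √2 Ω_↓ and m(n) = ⟨Ω, AⁿΩ⟩. On the flip-symmetric cone
⟨v,w⟩ ≤ ½e^{‖f‖²}⟨Ω,v⟩⟨Ω,w⟩, because ⟨y,z⟩ ≤ ‖f‖² for unit multiples y, z of f; hence m(2n) ≤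
½e^{‖f‖²}m(n)². Moreover ‖Aⁿφ‖ is at most a constant times m(n) for each φ in a total family.
Log-convexity of the powers of a symmetric operator removes that constant and gives ‖A‖ⁿ ≤
½e^{‖f‖²}m(n) (`norm_pow_le_of_total`). The mean ergodic theorem for A/‖A‖ then shows that the
projection ψ of Ω onto the eigenspace satisfies ‖ψ‖² ≥ 2e^{-‖f‖²} (`exists_eigenvector`).

Uniqueness rests on a Harnack inequality. Under the semigroup ε(h + y) relaxes to a multiple of the
evolution of ε(y), since e^{-tω}h tends to 0, and the accumulated factor is at most e^{∫|f||h|}. If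
h lives on {ω ≥ δ}, the remainder is governed by the inverse A' belonging to c + δ, and ‖A'‖ < ‖A‖;
since ω > 0 almost everywhere, truncation removes δ (`re_inner_le`). Consequently an eigenvector
that is nonnegative on unit vectors either vanishes on all of them or is bounded below there
(`Pos.dichotomy`), and one that vanishes on them is zero (`eq_zero_of_inner_unit`). Comparing an
arbitrary eigenvector χ with the extremal multiple tψ makes χ a multiple of ψ. -/

/-! ### Bounded multiplication operators -/

/-- Bounded measurable real functions. -/
def BddMeas {α : Type*} [MeasurableSpace α] (b : α → ℝ) : Prop :=
  Measurable b ∧ ∃ K, ∀ x, |b x| ≤ K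

section MulOp

variable {α : Type*} [MeasurableSpace α] {ν : Measure α}

theorem BddMeas.memLp {b : α → ℝ} (hb : BddMeas b) (f : Lp ℂ 2 ν) :
    MemLp (fun x => (b x : ℂ) * f x) 2 ν := by
  obtain ⟨hm, K, hK⟩ := hb
  refine (Lp.memLp f).of_le_mul (c := K)
    ((Complex.measurable_ofReal.comp hm).aestronglyMeasurable.mul
      (Lp.aestronglyMeasurable f)) (ae_of_all _ fun x => ?_)
  rw [norm_mul, Complex.norm_real, Real.norm_eq_abs]
  gcongr
  exact hK x

/-- Multiplication by a bounded measurable real function, as an operator on `L²`. -/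
def mulOp (b : α → ℝ) (hb : BddMeas b) : Lp ℂ 2 ν →L[ℂ] Lp ℂ 2 ν :=
  LinearMap.mkContinuous
    { toFun := fun f => (hb.memLp f).toLp _
      map_add' := fun f g => by
        refine Lp.ext ?_
        filter_upwards [(hb.memLp (f + g)).coeFn_toLp, (hb.memLp f).coeFn_toLp,
          (hb.memLp g).coeFn_toLp, Lp.coeFn_add f g,
          Lp.coeFn_add ((hb.memLp f).toLp _) ((hb.memLp g).toLp _)] with x h1 h2 h3 h4 h5
        rw [h1, h5, Pi.add_apply, h2, h3, h4, Pi.add_apply]; ring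
      map_smul' := fun c f => by
        refine Lp.ext ?_
        filter_upwards [(hb.memLp (c • f)).coeFn_toLp, (hb.memLp f).coeFn_toLp,
          Lp.coeFn_smul c f, Lp.coeFn_smul c ((hb.memLp f).toLp _)] with x h1 h2 h3 h4
        rw [h1, RingHom.id_apply, h4, Pi.smul_apply, h2, h3, Pi.smul_apply]
        simp only [smul_eq_mul]; ring } hb.2.choose fun f => by
      refine Lp.norm_le_mul_norm_of_ae_le_mul ?_
      filter_upwards [(hb.memLp f).coeFn_toLp] with x h1
      change ‖((hb.memLp f).toLp _ : Lp ℂ 2 ν) x‖ ≤ _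
      rw [h1, norm_mul, Complex.norm_real, Real.norm_eq_abs]
      gcongr
      exact hb.2.choose_spec x

theorem mulOp_ae {b : α → ℝ} (hb : BddMeas b) (f : Lp ℂ 2 ν) :
    mulOp b hb f =ᵐ[ν] fun x => (b x : ℂ) * f x :=
  (hb.memLp f).coeFn_toLp

theorem inner_mulOp_left {b : α → ℝ} (hb : BddMeas b) (f g : Lp ℂ 2 ν) :
    ⟪mulOp b hb f, g⟫_ℂ = ⟪f, mulOp b hb g⟫_ℂ := by
  rw [L2.inner_def, L2.inner_def]
  refine integral_congr_ae ?_
  filter_upwards [mulOp_ae hb f, mulOp_ae hb g] with x h1 h2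
  rw [h1, h2]
  simp only [RCLike.inner_apply, map_mul, Complex.conj_ofReal]
  ring

theorem norm_mulOp_le {b : α → ℝ} (hb : BddMeas b) {K : ℝ} (f : Lp ℂ 2 ν)
    (hK : ∀ᵐ x ∂ν, |b x| ≤ K ∨ f x = 0) : ‖mulOp b hb f‖ ≤ K * ‖f‖ := by
  refine Lp.norm_le_mul_norm_of_ae_le_mul ?_
  filter_upwards [mulOp_ae hb f, hK] with x h1 h2
  rw [h1, norm_mul, Complex.norm_real, Real.norm_eq_abs]
  rcases h2 with h2 | h2
  · gcongr
  · simp [h2]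

theorem norm_sq_eq_integral (f : Lp ℂ 2 ν) : ‖f‖ ^ 2 = ∫ x, ‖f x‖ ^ 2 ∂ν := by
  have h := @inner_self_eq_norm_sq_to_K ℂ _ _ _ _ f
  rw [L2.inner_def] at h
  have h2 : ∀ x, ⟪f x, f x⟫_ℂ = ((‖f x‖ ^ 2 : ℝ) : ℂ) := fun x => by
    rw [inner_self_eq_norm_sq_to_K]; push_cast; rfl
  simp only [h2] at h
  rw [integral_complex_ofReal] at h
  exact (Complex.ofReal_injective (h.trans (by push_cast; rfl))).symm

theorem integrable_norm_sq (f : Lp ℂ 2 ν) : Integrable (fun x => ‖f x‖ ^ 2) ν :=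
  (memLp_two_iff_integrable_sq_norm (Lp.aestronglyMeasurable f)).1 (Lp.memLp f)

/-- Dominated convergence in `L²`. -/
theorem tendsto_of_ae_le {F : ℕ → Lp ℂ 2 ν} {f g : Lp ℂ 2 ν}
    (hb : ∀ n, ∀ᵐ x ∂ν, ‖F n x‖ ≤ ‖g x‖)
    (hl : ∀ᵐ x ∂ν, Tendsto (fun n => F n x) atTop (𝓝 (f x))) :
    Tendsto F atTop (𝓝 f) := by
  rw [tendsto_iff_norm_sub_tendsto_zero]
  have h0 : Tendsto (fun n => ‖F n - f‖ ^ 2) atTop (𝓝 0) := by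
    simp only [norm_sq_eq_integral]
    have hfg : ∀ᵐ x ∂ν, ‖f x‖ ≤ ‖g x‖ := by
      filter_upwards [hl, ae_all_iff.2 hb] with x h1 h2
      exact le_of_tendsto h1.norm (Eventually.of_forall h2)
    have := tendsto_integral_of_dominated_convergence (μ := ν)
      (F := fun n x => ‖(F n - f : Lp ℂ 2 ν) x‖ ^ 2) (f := fun _ => (0 : ℝ))
      (fun x => 4 * ‖g x‖ ^ 2)
      (fun n => (Lp.aestronglyMeasurable (F n - f)).norm.pow 2)
      ((integrable_norm_sq g).const_mul 4) (fun n => ?_) ?_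
    · simpa using this
    · filter_upwards [hb n, hfg, Lp.coeFn_sub (F n) f] with x h1 h2 h3
      rw [h3, Real.norm_eq_abs, abs_of_nonneg (by positivity), Pi.sub_apply]
      have := norm_sub_le (F n x) (f x)
      calc ‖F n x - f x‖ ^ 2 ≤ (‖g x‖ + ‖g x‖) ^ 2 := by gcongr; linarith
        _ = 4 * ‖g x‖ ^ 2 := by ring
    · filter_upwards [hl, ae_all_iff.2 fun n => Lp.coeFn_sub (F n) f] with x h1 h2
      simp only [h2, Pi.sub_apply]
      have := ((h1.sub_const (f x)).norm).pow 2
      simpa using this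
  have := h0.sqrt
  simpa [Real.sqrt_sq (norm_nonneg _)] using this

theorem tendsto_mulOp {b : ℕ → α → ℝ} (hb : ∀ n, BddMeas (b n)) (h1 : ∀ n x, |b n x| ≤ 1)
    (f : Lp ℂ 2 ν) (hl : ∀ᵐ x ∂ν, Tendsto (fun n => b n x) atTop (𝓝 1)) :
    Tendsto (fun n => mulOp (b n) (hb n) f) atTop (𝓝 f) := by
  refine tendsto_of_ae_le (g := f) (fun n => ?_) ?_
  · filter_upwards [mulOp_ae (hb n) f] with x hx
    rw [hx, norm_mul, Complex.norm_real, Real.norm_eq_abs]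
    exact mul_le_of_le_one_left (norm_nonneg _) (h1 n x)
  · filter_upwards [hl, ae_all_iff.2 fun n => mulOp_ae (hb n) f] with x h1 h2
    simp only [h2]
    have := (Complex.continuous_ofReal.tendsto _).comp h1
    simpa using this.mul_const (f x)

end MulOp

/-! ### Functions of the second quantization -/

section FockCalc

variable {M : Type*} [MeasurableSpace M] {μ : Measure M} [SigmaFinite μ] {ω : M → ℝ}

theorem BddMeas.comp_sum (hω : Measurable ω) {φ : ℝ → ℝ} (hφ : BddMeas φ) (n : ℕ) :
    BddMeas fun k : Fin n → M => φ (∑ i, ω (k i)) :=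
  ⟨hφ.1.comp (Finset.measurable_fun_sum _ fun i _ => hω.comp (measurable_pi_apply i)),
    hφ.2.choose, fun _ => hφ.2.choose_spec _⟩

theorem mem_symL2_iff {n : ℕ} {f : Lp ℂ 2 (Measure.pi fun _ : Fin n => μ)} :
    f ∈ symL2 μ n ↔ ∀ σ : Equiv.Perm (Fin n), permL2 μ σ f = f := by
  simp [symL2, Submodule.mem_iInf]

theorem permL2_ae {n : ℕ} (σ : Equiv.Perm (Fin n))
    (f : Lp ℂ 2 (Measure.pi fun _ : Fin n => μ)) :
    permL2 μ σ f =ᵐ[Measure.pi fun _ : Fin n => μ] fun k => f fun i => k (σ i) :=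
  Lp.coeFn_compMeasurePreserving f (measurePreserving_perm μ σ)

theorem mulOp_mem_symL2 {n : ℕ} {b : (Fin n → M) → ℝ} (hb : BddMeas b)
    (hs : ∀ (σ : Equiv.Perm (Fin n)) k, b (fun i => k (σ i)) = b k) (f : symL2 μ n) :
    mulOp b hb (f : Lp ℂ 2 (Measure.pi fun _ : Fin n => μ)) ∈ symL2 μ n := by
  rw [mem_symL2_iff]
  intro σ
  have hf := mem_symL2_iff.1 f.2 σ
  refine Lp.ext ?_
  have h2 := (measurePreserving_perm μ σ).quasiMeasurePreserving.ae_eq_comp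
    (mulOp_ae hb (f : Lp ℂ 2 (Measure.pi fun _ : Fin n => μ)))
  have h3 := permL2_ae σ (f : Lp ℂ 2 (Measure.pi fun _ : Fin n => μ))
  rw [hf] at h3
  filter_upwards [permL2_ae σ (mulOp b hb (f : Lp ℂ 2 (Measure.pi fun _ : Fin n => μ))), h2, h3,
    mulOp_ae hb (f : Lp ℂ 2 (Measure.pi fun _ : Fin n => μ))] with k e1 e2 e3 e4
  simp only [Function.comp] at e2
  rw [e1, e2, hs, e4, ← e3]

theorem sum_perm {N : Type*} {ω : N → ℝ} (n : ℕ) (φ : ℝ → ℝ) (σ : Equiv.Perm (Fin n))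
    (k : Fin n → N) :
    φ (∑ i, ω (k (σ i))) = φ (∑ i, ω (k i)) := by
  rw [Equiv.sum_comp σ fun i => ω (k i)]

/-- The `n`-boson component of a Fock vector as an element of `L²(Mⁿ, μⁿ)`. -/
def comp (ψ : Fock μ) (n : ℕ) : Lp ℂ 2 (Measure.pi fun _ : Fin n => μ) :=
  ((ψ : ∀ n, symL2 μ n) n : Lp ℂ 2 (Measure.pi fun _ : Fin n => μ))

theorem Fock.ext_ae {ψ χ : Fock μ} (h : ∀ n, comp ψ n =ᵐ[Measure.pi fun _ : Fin n => μ] comp χ n) :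
    ψ = χ :=
  lp.ext (funext fun n => Subtype.ext (Lp.ext (h n)))

theorem comp_add (ψ χ : Fock μ) (n : ℕ) : comp (ψ + χ) n = comp ψ n + comp χ n := rfl

theorem comp_smul (c : ℂ) (ψ : Fock μ) (n : ℕ) : comp (c • ψ) n = c • comp ψ n := rfl

theorem Fock.norm_le {K : ℝ} (hK : 0 ≤ K) {ψ χ : Fock μ}
    (h : ∀ n, ∀ᵐ k ∂Measure.pi fun _ : Fin n => μ, ‖comp ψ n k‖ ≤ K * ‖comp χ n k‖) :
    ‖ψ‖ ≤ K * ‖χ‖ := by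
  have h2 : ∀ n, ‖(ψ : ∀ n, symL2 μ n) n‖ ≤ K * ‖(χ : ∀ n, symL2 μ n) n‖ := fun n =>
    Lp.norm_le_mul_norm_of_ae_le_mul (h n)
  have h3 : ‖ψ‖ ≤ ‖(K : ℂ) • χ‖ := lp.norm_mono two_ne_zero fun n => by
    refine (h2 n).trans (le_of_eq ?_)
    change _ = ‖(K : ℂ) • (χ : ∀ n, symL2 μ n) n‖
    rw [norm_smul, Complex.norm_real, Real.norm_eq_abs, abs_of_nonneg hK]
  rwa [norm_smul, Complex.norm_real, Real.norm_eq_abs, abs_of_nonneg hK] at h3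

theorem inner_eq_tsum_comp (ψ χ : Fock μ) : ⟪ψ, χ⟫_ℂ = ∑' n, ⟪comp ψ n, comp χ n⟫_ℂ :=
  lp.inner_eq_tsum ψ χ

theorem Fock.ext_comp {ψ χ : Fock μ} (h : ∀ n, comp ψ n = comp χ n) : ψ = χ :=
  lp.ext (funext fun n => Subtype.ext (h n))

theorem fc_memℓp (hω : Measurable ω) {φ : ℝ → ℝ} (hφ : BddMeas φ) (ψ : Fock μ) :
    Memℓp (fun n => (⟨mulOp _ (hφ.comp_sum hω n) (comp ψ n),
          mulOp_mem_symL2 (hφ.comp_sum hω n) (sum_perm n φ) _⟩ : symL2 μ n)) 2 := by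
  refine Memℓp.mono' (lp.memℓp (((hφ.2.choose : ℝ) : ℂ) • ψ)) fun n => ?_
  change _ ≤ ‖((hφ.2.choose : ℝ) : ℂ) • (ψ : ∀ n, symL2 μ n) n‖
  rw [norm_smul, Complex.norm_real, Real.norm_eq_abs]
  refine norm_mulOp_le (hφ.comp_sum hω n) _ (ae_of_all _ fun k => Or.inl ?_)
  exact (hφ.2.choose_spec _).trans (le_abs_self _)

/-- The action of `φ(dΓ(ω))` on vectors. -/
def fcFun (hω : Measurable ω) (φ : ℝ → ℝ) (hφ : BddMeas φ) (ψ : Fock μ) : Fock μ :=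
  ⟨_, fc_memℓp hω hφ ψ⟩

theorem comp_fcFun (hω : Measurable ω) {φ : ℝ → ℝ} (hφ : BddMeas φ) (ψ : Fock μ) (n : ℕ) :
    comp (fcFun hω φ hφ ψ) n = mulOp _ (hφ.comp_sum hω n) (comp ψ n) := rfl

/-- The bounded operator `φ(dΓ(ω))`. -/
def fc (hω : Measurable ω) (φ : ℝ → ℝ) (hφ : BddMeas φ) : Fock μ →L[ℂ] Fock μ :=
  LinearMap.mkContinuous
    { toFun := fcFun hω φ hφ
      map_add' := fun ψ χ => Fock.ext_comp fun n => by
        rw [comp_add, comp_fcFun, comp_fcFun, comp_fcFun, comp_add, map_add]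
      map_smul' := fun c ψ => Fock.ext_comp fun n => by
        rw [RingHom.id_apply, comp_smul, comp_fcFun, comp_fcFun, comp_smul, map_smul] }
    |hφ.2.choose| fun ψ => by
      refine Fock.norm_le (abs_nonneg _) fun n => ?_
      filter_upwards [mulOp_ae (hφ.comp_sum hω n) (comp ψ n)] with k hk
      refine (congrArg norm hk).le.trans ?_
      rw [norm_mul, Complex.norm_real, Real.norm_eq_abs]
      exact mul_le_mul_of_nonneg_right ((hφ.2.choose_spec _).trans (le_abs_self _)) (norm_nonneg _)

variable (hω : Measurable ω)

theorem fc_ae {φ : ℝ → ℝ} (hφ : BddMeas φ) (ψ : Fock μ) (n : ℕ) :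
    comp (fc hω φ hφ ψ) n =ᵐ[Measure.pi fun _ : Fin n => μ]
      fun k => (φ (∑ i, ω (k i)) : ℂ) * comp ψ n k :=
  mulOp_ae (hφ.comp_sum hω n) (comp ψ n)

theorem inner_fc_left {φ : ℝ → ℝ} (hφ : BddMeas φ) (ψ χ : Fock μ) :
    ⟪fc hω φ hφ ψ, χ⟫_ℂ = ⟪ψ, fc hω φ hφ χ⟫_ℂ := by
  rw [inner_eq_tsum_comp, inner_eq_tsum_comp]
  exact tsum_congr fun n => inner_mulOp_left (hφ.comp_sum hω n) _ _

theorem norm_fc_le (hω0 : ∀ k, 0 ≤ ω k) {φ : ℝ → ℝ} (hφ : BddMeas φ) {K : ℝ} (hK0 : 0 ≤ K)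
    (hK : ∀ s, 0 ≤ s → |φ s| ≤ K) (ψ : Fock μ) : ‖fc hω φ hφ ψ‖ ≤ K * ‖ψ‖ := by
  refine Fock.norm_le hK0 fun n => ?_
  filter_upwards [fc_ae hω hφ ψ n] with k hk
  rw [hk, norm_mul, Complex.norm_real, Real.norm_eq_abs]
  gcongr
  exact hK _ (Finset.sum_nonneg fun i _ => hω0 _)

/-- Operators `φ(dΓ(ω))` applied to vectors combine according to the scalar functions. -/
theorem fc_fc (hω0 : ∀ k, 0 ≤ ω k) {φ₁ φ₂ φ₃ : ℝ → ℝ} (h₁ : BddMeas φ₁) (h₂ : BddMeas φ₂)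
    (h₃ : BddMeas φ₃) (h : ∀ s, 0 ≤ s → φ₁ s * φ₂ s = φ₃ s) (ψ : Fock μ) :
    fc hω φ₁ h₁ (fc hω φ₂ h₂ ψ) = fc hω φ₃ h₃ ψ := by
  refine Fock.ext_ae fun n => ?_
  filter_upwards [fc_ae hω h₁ (fc hω φ₂ h₂ ψ) n, fc_ae hω h₂ ψ n, fc_ae hω h₃ ψ n]
    with k e1 e2 e3
  rw [e1, e2, e3, ← h _ (Finset.sum_nonneg fun i _ => hω0 _)]
  push_cast; ring

theorem norm_fc_sub_le (hω0 : ∀ k, 0 ≤ ω k) {φ₁ φ₂ : ℝ → ℝ} (h₁ : BddMeas φ₁)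
    (h₂ : BddMeas φ₂) {K : ℝ} (hK0 : 0 ≤ K) (hK : ∀ s, 0 ≤ s → |φ₁ s - φ₂ s| ≤ K) (ψ : Fock μ) :
    ‖fc hω φ₁ h₁ ψ - fc hω φ₂ h₂ ψ‖ ≤ K * ‖ψ‖ := by
  refine Fock.norm_le hK0 fun n => ?_
  filter_upwards [fc_ae hω h₁ ψ n, fc_ae hω h₂ ψ n,
    Lp.coeFn_sub (comp (fc hω φ₁ h₁ ψ) n) (comp (fc hω φ₂ h₂ ψ) n)] with k e1 e2 e3
  change ‖(comp (fc hω φ₁ h₁ ψ) n - comp (fc hω φ₂ h₂ ψ) n : Lp ℂ 2 _) k‖ ≤ _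
  rw [e3, Pi.sub_apply, e1, e2, ← sub_mul, norm_mul, ← Complex.ofReal_sub, Complex.norm_real,
    Real.norm_eq_abs]
  gcongr
  exact hK _ (Finset.sum_nonneg fun i _ => hω0 _)

theorem fc_add_eq (hω0 : ∀ k, 0 ≤ ω k) {φ₁ φ₂ φ₃ : ℝ → ℝ} (h₁ : BddMeas φ₁) (h₂ : BddMeas φ₂)
    (h₃ : BddMeas φ₃) (a b : ℝ) (h : ∀ s, 0 ≤ s → a * φ₁ s + b * φ₂ s = φ₃ s) (ψ : Fock μ) :
    (a : ℂ) • fc hω φ₁ h₁ ψ + (b : ℂ) • fc hω φ₂ h₂ ψ = fc hω φ₃ h₃ ψ := by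
  refine Fock.ext_ae fun n => ?_
  rw [comp_add, comp_smul, comp_smul]
  filter_upwards [fc_ae hω h₁ ψ n, fc_ae hω h₂ ψ n, fc_ae hω h₃ ψ n,
    Lp.coeFn_add ((a : ℂ) • comp (fc hω φ₁ h₁ ψ) n) ((b : ℂ) • comp (fc hω φ₂ h₂ ψ) n),
    Lp.coeFn_smul (a : ℂ) (comp (fc hω φ₁ h₁ ψ) n),
    Lp.coeFn_smul (b : ℂ) (comp (fc hω φ₂ h₂ ψ) n)] with k e1 e2 e3 e4 e5 e6
  rw [e4, Pi.add_apply, e5, e6, Pi.smul_apply, Pi.smul_apply, e1, e2, e3,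
    ← h _ (Finset.sum_nonneg fun i _ => hω0 _)]
  push_cast; simp only [smul_eq_mul]; ring

theorem fc_one (hω0 : ∀ k, 0 ≤ ω k) {φ : ℝ → ℝ} (hφ : BddMeas φ) (h : ∀ s, 0 ≤ s → φ s = 1)
    (ψ : Fock μ) : fc hω φ hφ ψ = ψ := by
  refine Fock.ext_ae fun n => ?_
  filter_upwards [fc_ae hω hφ ψ n] with k e1
  rw [e1, h _ (Finset.sum_nonneg fun i _ => hω0 _)]; simp

theorem fc_sum (hω0 : ∀ k, 0 ≤ ω k) {φ : ℕ → ℝ → ℝ} (h : ∀ j, BddMeas (φ j)) (a : ℕ → ℝ) (N : ℕ)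
    {φ' : ℝ → ℝ} (h' : BddMeas φ')
    (e : ∀ s, 0 ≤ s → φ' s = ∑ j ∈ Finset.range N, a j * φ j s) (ψ : Fock μ) :
    ∑ j ∈ Finset.range N, (a j : ℂ) • fc hω (φ j) (h j) ψ = fc hω φ' h' ψ := by
  induction N generalizing φ' with
  | zero =>
    refine Fock.ext_ae fun n => ?_
    filter_upwards [fc_ae hω h' ψ n, Lp.coeFn_zero ℂ 2 (Measure.pi fun _ : Fin n => μ)] with k e1 e2
    rw [e1, e _ (Finset.sum_nonneg fun i _ => hω0 _)]
    simp only [Finset.range_zero, Finset.sum_empty, Complex.ofReal_zero, zero_mul]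
    exact e2
  | succ N ih =>
    have hb : BddMeas fun s => ∑ j ∈ Finset.range N, a j * φ j s := by
      refine ⟨Finset.measurable_fun_sum _ fun j _ => (h j).1.const_mul _,
        ∑ j ∈ Finset.range N, |a j| * (h j).2.choose, fun s => ?_⟩
      refine (Finset.abs_sum_le_sum_abs _ _).trans (Finset.sum_le_sum fun j _ => ?_)
      rw [abs_mul]
      gcongr
      exact (h j).2.choose_spec s
    rw [Finset.sum_range_succ, ih hb fun s _ => rfl]
    have := fc_add_eq hω hω0 hb (h N) h' 1 (a N) (fun s hs => by
      rw [e s hs, Finset.sum_range_succ, one_mul]) ψ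
    simpa using this

end FockCalc

/-! ### The semigroup and the resolvent of the second quantization -/

/-- The function `s ↦ e^{-|t||s|}`. -/
def expF (t s : ℝ) : ℝ := Real.exp (-(|t| * |s|))

theorem expF_le_one (t s : ℝ) : expF t s ≤ 1 := by
  rw [expF, Real.exp_le_one_iff]
  have := mul_nonneg (abs_nonneg t) (abs_nonneg s)
  linarith

theorem expF_pos (t s : ℝ) : 0 < expF t s := Real.exp_pos _

/-- The absolute values in `expF`, like the maximum in `resF`, only serve to make the functions
bounded on the whole line; dΓ(ω) only sees s ≥ 0. -/
theorem expF_eq {t s : ℝ} (ht : 0 ≤ t) (hs : 0 ≤ s) : expF t s = Real.exp (-(t * s)) := by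
  rw [expF, abs_of_nonneg ht, abs_of_nonneg hs]

theorem measurable_expF (t : ℝ) : Measurable (expF t) := by
  unfold expF; fun_prop

theorem bddMeas_expF (t : ℝ) : BddMeas (expF t) :=
  ⟨measurable_expF t, 1, fun s => by rw [abs_of_pos (expF_pos t s)]; exact expF_le_one t s⟩

/-- The function `s ↦ (c + |s|)⁻¹`, for `c ≥ 1`. -/
def resF (c s : ℝ) : ℝ := (max c 1 + |s|)⁻¹

theorem resF_pos (c s : ℝ) : 0 < resF c s :=
  inv_pos.2 (by have := le_max_right c 1; have := abs_nonneg s; linarith)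

theorem resF_eq {c s : ℝ} (hc : 1 ≤ c) (hs : 0 ≤ s) : resF c s = (c + s)⁻¹ := by
  rw [resF, max_eq_left hc, abs_of_nonneg hs]

theorem resF_le {c : ℝ} (hc : 1 ≤ c) (s : ℝ) : resF c s ≤ c⁻¹ := by
  rw [resF, max_eq_left hc]
  exact inv_anti₀ (by linarith) (by have := abs_nonneg s; linarith)

theorem bddMeas_resF (c : ℝ) : BddMeas (resF c) := by
  refine ⟨by unfold resF; fun_prop, 1, fun s => ?_⟩
  rw [abs_of_pos (resF_pos c s)]
  refine inv_le_one_of_one_le₀ ?_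
  have := le_max_right c 1; have := abs_nonneg s; linarith

theorem BddMeas.comp {α β : Type*} [MeasurableSpace α] [MeasurableSpace β] {b : β → ℝ}
    (hb : BddMeas b) {w : α → β} (hw : Measurable w) : BddMeas fun k => b (w k) :=
  ⟨hb.1.comp hw, hb.2.choose, fun _ => hb.2.choose_spec _⟩

theorem BddMeas.mul {α : Type*} [MeasurableSpace α] {a b : α → ℝ} (ha : BddMeas a)
    (hb : BddMeas b) : BddMeas fun s => a s * b s :=
  ⟨ha.1.mul hb.1, ha.2.choose * hb.2.choose, fun s => by
    rw [abs_mul]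
    exact mul_le_mul (ha.2.choose_spec s) (hb.2.choose_spec s) (abs_nonneg _)
      ((abs_nonneg _).trans (ha.2.choose_spec s))⟩

theorem BddMeas.sub {α : Type*} [MeasurableSpace α] {a b : α → ℝ} (ha : BddMeas a)
    (hb : BddMeas b) : BddMeas fun s => a s - b s :=
  ⟨ha.1.sub hb.1, ha.2.choose + hb.2.choose, fun s =>
    (abs_sub _ _).trans (add_le_add (ha.2.choose_spec s) (hb.2.choose_spec s))⟩

theorem BddMeas.const_mul {α : Type*} [MeasurableSpace α] {b : α → ℝ} (r : ℝ)
    (hb : BddMeas b) : BddMeas fun s => r * b s :=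
  ⟨hb.1.const_mul r, |r| * hb.2.choose, fun s => by
    rw [abs_mul]; exact mul_le_mul_of_nonneg_left (hb.2.choose_spec s) (abs_nonneg _)⟩

theorem bddMeas_const {α : Type*} [MeasurableSpace α] (r : ℝ) : BddMeas fun _ : α => r :=
  ⟨measurable_const, |r|, fun _ => le_rfl⟩

section

variable {M : Type*} [MeasurableSpace M] {μ : Measure M} [SigmaFinite μ] {ω : M → ℝ}

/-- The semigroup `e^{-t dΓ(ω)}`. -/
def semi (hω : Measurable ω) (t : ℝ) : Fock μ →L[ℂ] Fock μ := fc hω (expF t) (bddMeas_expF t)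

/-- The resolvent `(dΓ(ω) + c)⁻¹`, for `c ≥ 1`. -/
def res (hω : Measurable ω) (c : ℝ) : Fock μ →L[ℂ] Fock μ := fc hω (resF c) (bddMeas_resF c)

/-- Multiplication by `e^{-tω}` on the one-boson space. -/
def decay (hω : Measurable ω) (t : ℝ) : OneBoson μ →L[ℂ] OneBoson μ :=
  mulOp (fun k => expF t (ω k)) ((bddMeas_expF t).comp hω)

theorem comp_expVec_ae (g : OneBoson μ) (n : ℕ) :
    comp (expVec g) n =ᵐ[Measure.pi fun _ : Fin n => μ]
      fun k => ((1 / Real.sqrt n.factorial : ℝ) : ℂ) * ∏ i, g (k i) := by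
  have e : comp (expVec g) n = ((1 / Real.sqrt n.factorial : ℝ) : ℂ) •
    (memLp_tensorPow n g).toLp _ := rfl
  rw [e]
  filter_upwards [(memLp_tensorPow n g).coeFn_toLp,
    Lp.coeFn_smul ((1 / Real.sqrt n.factorial : ℝ) : ℂ) ((memLp_tensorPow n g).toLp _)]
    with k h1 h2
  rw [h2, Pi.smul_apply, h1, smul_eq_mul]

theorem ae_pi_of_ae {n : ℕ} {p : M → Prop} (h : ∀ᵐ k ∂μ, p k) :
    ∀ᵐ k ∂(Measure.pi fun _ : Fin n => μ), ∀ i, p (k i) := by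
  rw [ae_all_iff]
  exact fun i => Measure.tendsto_eval_ae_ae (μ := fun _ : Fin n => μ) (i := i) h

/-- The exponential of the sum ω(k₁) + ⋯ + ω(kₙ) factorizes, so the semigroup acts on each factor of
a product function separately. -/
theorem semi_expVec (hω : Measurable ω) (hω0 : ∀ k, 0 ≤ ω k) (t : ℝ) (g : OneBoson μ) :
    semi hω t (expVec g) = expVec (decay hω t g) := by
  refine Fock.ext_ae fun n => ?_
  filter_upwards [fc_ae hω (bddMeas_expF t) (expVec g) n, comp_expVec_ae g n,
    comp_expVec_ae (decay hω t g) n,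
    ae_pi_of_ae (mulOp_ae ((bddMeas_expF t).comp hω) g)] with k e1 e2 e3 e4
  have e5 : ∏ i, decay hω t g (k i) = ∏ i, ((expF t (ω (k i)) : ℂ) * g (k i)) :=
    Finset.prod_congr rfl fun i _ => e4 i
  rw [semi, e1, e2, e3, e5, Finset.prod_mul_distrib, ← Complex.ofReal_prod]
  have : ∏ i, expF t (ω (k i)) = expF t (∑ i, ω (k i)) := by
    simp only [expF]
    rw [← Real.exp_sum, abs_of_nonneg (Finset.sum_nonneg fun i _ => hω0 (k i)), Finset.mul_sum,
      Finset.sum_neg_distrib]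
    simp only [abs_of_nonneg (hω0 _)]
  rw [this]; ring

theorem norm_res_le (hω : Measurable ω) (hω0 : ∀ k, 0 ≤ ω k) {c : ℝ} (hc : 1 ≤ c) (ψ : Fock μ) :
    ‖res hω c ψ‖ ≤ c⁻¹ * ‖ψ‖ :=
  norm_fc_le hω hω0 (bddMeas_resF c) (by positivity) (fun s _ => by
    rw [abs_of_pos (resF_pos c s)]; exact resF_le hc s) ψ

theorem inner_res_left (hω : Measurable ω) (c : ℝ) (ψ χ : Fock μ) :
    ⟪res hω c ψ, χ⟫_ℂ = ⟪ψ, res hω c χ⟫_ℂ := inner_fc_left hω _ ψ χ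

/-- `dΓ(ω)` is the operator `A⁻¹ - c`, where `A` is the resolvent. -/
theorem mem_dGamma_graph_iff (hω : Measurable ω) (hω0 : ∀ k, 0 ≤ ω k) {c : ℝ} (hc : 1 ≤ c)
    (p : Fock μ × Fock μ) :
    p ∈ (dGamma μ ω).graph ↔ res hω c (p.2 + (c : ℂ) • p.1) = p.1 := by
  have hg : (dGamma μ ω).graph = dGammaGraph μ ω :=
    Submodule.toLinearPMap_graph_eq _ (dGammaGraph_single ω)
  have h1 : p ∈ (dGamma μ ω).graph ↔ ∀ n, comp p.2 n =ᵐ[Measure.pi fun _ : Fin n => μ]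
      fun k => ((∑ i, ω (k i) : ℝ) : ℂ) * comp p.1 n k := by rw [hg]; rfl
  have h2 : ∀ n, comp (res hω c (p.2 + (c : ℂ) • p.1)) n =ᵐ[Measure.pi fun _ : Fin n => μ]
      fun k => (((c + ∑ i, ω (k i))⁻¹ : ℝ) : ℂ) * (comp p.2 n k + c * comp p.1 n k) := fun n => by
    filter_upwards [fc_ae hω (bddMeas_resF c) (p.2 + (c : ℂ) • p.1) n,
      Lp.coeFn_add (comp p.2 n) ((c : ℂ) • comp p.1 n),
      Lp.coeFn_smul (c : ℂ) (comp p.1 n)] with k e1 e2 e3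
    rw [res, e1, comp_add, comp_smul, e2, Pi.add_apply, e3, Pi.smul_apply,
      resF_eq hc (Finset.sum_nonneg fun i _ => hω0 _), smul_eq_mul]
  have h0 : ∀ (n : ℕ) (k : Fin n → M), ((c + ∑ i, ω (k i) : ℝ) : ℂ) ≠ 0 := fun n k => by
    have : 0 ≤ ∑ i, ω (k i) := Finset.sum_nonneg fun i _ => hω0 _
    exact Complex.ofReal_ne_zero.2 (by linarith)
  rw [h1]
  constructor
  · intro h
    refine Fock.ext_ae fun n => ?_
    filter_upwards [h2 n, h n] with k e1 e2
    rw [e1, e2, Complex.ofReal_inv, inv_mul_eq_iff_eq_mul₀ (h0 n k)]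
    push_cast; ring
  · intro h n
    have h3 := h2 n
    rw [h] at h3
    filter_upwards [h3] with k e1
    rw [Complex.ofReal_inv, eq_comm, inv_mul_eq_iff_eq_mul₀ (h0 n k)] at e1
    push_cast at e1 ⊢
    linear_combination e1

/-- The scalar inequality behind the approximation of the resolvent by Riemann sums of
the semigroup. -/
theorem abs_resolvent_sub_riemann_le {n : ℕ} (hn : 0 < n) {x : ℝ} (hx : 1 ≤ x) :
    |x⁻¹ - ∑ j ∈ Finset.range (n ^ 2), (n : ℝ)⁻¹ * Real.exp (-(j / n * x))|
      ≤ (n : ℝ)⁻¹ + 2 * Real.exp (-n) := by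
  have hn' : (0 : ℝ) < n := by exact_mod_cast hn
  have hn1 : (1 : ℝ) ≤ n := by exact_mod_cast hn
  set q := Real.exp (-(x / n)) with hq
  have hy : 0 < x / n := by positivity
  have hq1 : q < 1 := by rw [hq, ← Real.exp_zero]; exact Real.exp_lt_exp.2 (by linarith)
  have hterm : ∀ j : ℕ, Real.exp (-(j / n * x)) = q ^ j := fun j => by
    rw [hq, ← Real.exp_nat_mul]; congr 1; ring
  simp only [hterm]
  rw [← Finset.mul_sum, geom_sum_eq hq1.ne]
  -- The n² nodes with mesh 1/n cover [0, n]; what is cut off is of relative size e^{-nx} ≤ e^{-n}.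
  have hqN : q ^ (n ^ 2) ≤ Real.exp (-n) := by
    rw [hq, ← Real.exp_nat_mul]
    refine Real.exp_le_exp.2 ?_
    push_cast
    have : (n : ℝ) ^ 2 * -(x / n) = -(n * x) := by field_simp
    rw [this]; nlinarith
  have hqN0 : 0 ≤ q ^ (n ^ 2) := by positivity
  have h1 : x / n * q ≤ 1 - q := by
    have := Real.add_one_le_exp (x / n)
    have e : Real.exp (x / n) * q = 1 := by rw [hq, ← Real.exp_add]; simp
    have hq0 : 0 < q := Real.exp_pos _
    nlinarith
  have h2 : 1 - q ≤ x / n := by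
    have := Real.add_one_le_exp (-(x / n))
    linarith
  set a := (n : ℝ)⁻¹ * (1 - q)⁻¹ with ha
  have h3 : (0 : ℝ) < 1 - q := by linarith
  have ha1 : x⁻¹ ≤ a := by
    rw [ha, ← mul_inv]
    refine inv_anti₀ (by positivity) ?_
    calc (n : ℝ) * (1 - q) ≤ n * (x / n) := by gcongr
      _ = x := by field_simp
  have ha2 : a ≤ x⁻¹ + (n : ℝ)⁻¹ := by
    have : (1 - q)⁻¹ ≤ n / x + 1 := by
      rw [inv_le_iff_one_le_mul₀ h3]
      have h4 : q ≤ (1 - q) * (n / x) := by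
        have e : (x / n * q) * (n / x) = q := by field_simp
        calc q = (x / n * q) * (n / x) := e.symm
          _ ≤ _ := by gcongr
      linarith
    calc a ≤ (n : ℝ)⁻¹ * (n / x + 1) := by rw [ha]; gcongr
      _ = x⁻¹ + (n : ℝ)⁻¹ := by field_simp
  have e : (n : ℝ)⁻¹ * ((q ^ n ^ 2 - 1) / (q - 1)) = a * (1 - q ^ n ^ 2) := by
    rw [ha, ← neg_sub 1 q, ← neg_sub 1 (q ^ n ^ 2), neg_div_neg_eq, div_eq_mul_inv]; ring
  rw [e, abs_le]
  have hx1 : x⁻¹ ≤ 1 := inv_le_one_of_one_le₀ hx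
  have hni : (n : ℝ)⁻¹ ≤ 1 := inv_le_one_of_one_le₀ hn1
  have h5 : a * q ^ n ^ 2 ≤ 2 * Real.exp (-n) := by
    refine mul_le_mul (by linarith) hqN hqN0 (by norm_num)
  have h6 : 0 ≤ a * q ^ n ^ 2 := mul_nonneg (by positivity) hqN0
  constructor <;> nlinarith [Real.exp_pos (-(n : ℝ))]

/-- The resolvent is the limit of Riemann sums of the semigroup. -/
theorem tendsto_riemann_res (hω : Measurable ω) (hω0 : ∀ k, 0 ≤ ω k) {c : ℝ} (hc : 1 ≤ c)
    (ψ : Fock μ) :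
    Tendsto (fun n : ℕ => ∑ j ∈ Finset.range (n ^ 2),
      (((n : ℝ)⁻¹ * Real.exp (-(j / n * c)) : ℝ) : ℂ) • semi hω ((j : ℝ) / n) ψ)
      atTop (𝓝 (res hω c ψ)) := by
  rw [tendsto_iff_norm_sub_tendsto_zero]
  have hlim : Tendsto (fun n : ℕ => ((n : ℝ)⁻¹ + 2 * Real.exp (-(n : ℝ))) * ‖ψ‖) atTop (𝓝 0) := by
    have h1 : Tendsto (fun n : ℕ => (n : ℝ)⁻¹) atTop (𝓝 0) := tendsto_inv_atTop_nhds_zero_nat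
    have h2 : Tendsto (fun n : ℕ => Real.exp (-(n : ℝ))) atTop (𝓝 0) :=
      Real.tendsto_exp_neg_atTop_nhds_zero.comp tendsto_natCast_atTop_atTop
    simpa using (h1.add (h2.const_mul 2)).mul_const ‖ψ‖
  refine squeeze_zero' (Eventually.of_forall fun _ => norm_nonneg _) ?_ hlim
  filter_upwards [eventually_gt_atTop 0] with n hn
  have hb : BddMeas fun s => ∑ j ∈ Finset.range (n ^ 2),
      ((n : ℝ)⁻¹ * Real.exp (-(j / n * c))) * expF ((j : ℝ) / n) s := by
    refine ⟨Finset.measurable_fun_sum _ fun j _ => (measurable_expF _).const_mul _,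
      ∑ j ∈ Finset.range (n ^ 2), ((n : ℝ)⁻¹ * Real.exp (-(j / n * c))), fun s => ?_⟩
    refine (Finset.abs_sum_le_sum_abs _ _).trans (Finset.sum_le_sum fun j _ => ?_)
    rw [abs_of_nonneg (mul_nonneg (by positivity) (expF_pos _ _).le)]
    exact mul_le_of_le_one_right (by positivity) (expF_le_one _ _)
  rw [norm_sub_rev]
  have e := fc_sum hω hω0 (fun j : ℕ => bddMeas_expF ((j : ℝ) / n))
    (fun j => (n : ℝ)⁻¹ * Real.exp (-(j / n * c))) (n ^ 2) hb (fun s _ => rfl) ψ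
  simp only [semi]
  rw [e, res]
  refine norm_fc_sub_le hω hω0 (bddMeas_resF c) hb (by positivity) (fun s hs => ?_) ψ
  have := abs_resolvent_sub_riemann_le hn (x := c + s) (by linarith)
  rw [resF_eq hc hs]
  convert this using 4 with j hj
  rw [expF_eq (by positivity) hs, mul_assoc, ← Real.exp_add]
  congr 2; ring

end

/-! ### Totality of the exponential vectors -/

/-- Ryser's formula for the permanent. -/
theorem sum_powerset_prod_sum {n : ℕ} (a : Fin n → Fin n → ℂ) :
    ∑ S : Finset (Fin n), (-1) ^ S.card * ∏ j, ∑ i ∈ S, a i j =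
      (-1) ^ n * ∑ σ : Equiv.Perm (Fin n), ∏ j, a (σ j) j := by
  classical
  -- Inclusion-exclusion: toggling an element outside T reverses the sign, so only T = univ
  -- survives.
  have key : ∀ T : Finset (Fin n), ∑ S : Finset (Fin n), (if T ⊆ S then (-1 : ℂ) ^ S.card else 0)
      = if T = Finset.univ then (-1) ^ n else 0 := by
    intro T
    split_ifs with hT
    · subst hT
      rw [Finset.sum_eq_single Finset.univ]
      · simp
      · intro S _ hS
        rw [if_neg fun h => hS (Finset.univ_subset_iff.1 h)]
      · simp
    · obtain ⟨i, hi⟩ : ∃ i, i ∉ T := by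
        by_contra h
        push Not at h
        exact hT (Finset.eq_univ_iff_forall.2 h)
      refine Finset.sum_involution
        (fun S _ => if i ∈ S then S.erase i else insert i S) ?_ ?_ ?_ ?_
      · intro S _
        by_cases h : i ∈ S
        · have e : T ⊆ S.erase i ↔ T ⊆ S :=
            ⟨fun h1 => h1.trans (Finset.erase_subset _ _), fun h1 =>
              Finset.subset_erase.2 ⟨h1, hi⟩⟩
          simp only [h, if_true, e]
          split_ifs
          · rw [← Finset.card_erase_add_one h, pow_succ]; ring
          · simp
        · have e : T ⊆ insert i S ↔ T ⊆ S := by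
            rw [Finset.subset_insert_iff_of_notMem hi]
          simp only [h, if_false, e]
          split_ifs
          · rw [Finset.card_insert_of_notMem h, pow_succ]; ring
          · simp
      · intro S _ _
        by_cases h : i ∈ S
        · simp only [h, if_true]
          intro h2
          exact Finset.notMem_erase i S (by rw [h2]; exact h)
        · simp only [h, if_false]
          intro h2
          exact h (h2 ▸ Finset.mem_insert_self i S)
      · simp
      · intro S _
        by_cases h : i ∈ S
        · simp [h, Finset.insert_erase]
        · simp [h]
  have h1 : ∀ S : Finset (Fin n), ∏ j, ∑ i ∈ S, a i j =
      ∑ f : Fin n → Fin n, if Finset.univ.image f ⊆ S then ∏ j, a (f j) j else 0 := by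
    intro S
    rw [Finset.prod_univ_sum, ← Finset.sum_filter]
    refine Finset.sum_congr ?_ fun _ _ => rfl
    ext f
    simp [Fintype.mem_piFinset, Finset.image_subset_iff]
  simp only [h1, Finset.mul_sum]
  rw [Finset.sum_comm]
  -- Applied to the image of f, this leaves only the surjective f, which are the permutations.
  have h2 : ∀ f : Fin n → Fin n, ∑ S : Finset (Fin n), (-1) ^ S.card *
      (if Finset.univ.image f ⊆ S then ∏ j, a (f j) j else 0) =
      if Function.Bijective f then (-1) ^ n * ∏ j, a (f j) j else 0 := by
    intro f
    have h3 : Finset.univ.image f = Finset.univ ↔ Function.Bijective f := by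
      rw [← Finite.surjective_iff_bijective]
      simp [Finset.eq_univ_iff_forall, Function.Surjective]
    have h4 := congrArg (· * ∏ j, a (f j) j) (key (Finset.univ.image f))
    simp only [Finset.sum_mul, ite_mul, zero_mul, h3] at h4
    rw [← h4]
    refine Finset.sum_congr rfl fun S _ => ?_
    split_ifs <;> simp
  simp only [h2]
  rw [← Finset.sum_filter]
  refine (Finset.sum_bij' (fun (σ : Equiv.Perm (Fin n)) _ => (σ : Fin n → Fin n))
    (fun f hf => Equiv.ofBijective f (Finset.mem_filter.1 hf).2) ?_ ?_ ?_ ?_ ?_).symm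
  · intro σ _
    exact Finset.mem_filter.2 ⟨Finset.mem_univ _, σ.bijective⟩
  · simp
  · intro σ _; ext; simp
  · intro f _; rfl
  · intro σ _; rfl

section

variable {M : Type*} [MeasurableSpace M] {μ : Measure M} [SigmaFinite μ]

theorem integrableOn_L2 {α : Type*} [MeasurableSpace α] {ν : Measure α} (f : Lp ℂ 2 ν) {s : Set α}
    (hs : ν s < ∞) : IntegrableOn f s ν := by
  have : IsFiniteMeasure (ν.restrict s) := ⟨by simpa using hs⟩
  exact ((Lp.memLp f).restrict s).integrable (by norm_num)

/-- An `L²` function whose integrals over rectangles vanish is zero. -/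
theorem eq_zero_of_setIntegral_rectangle {n : ℕ} {ν : Measure (Fin n → M)}
    (hν : ν = Measure.pi fun _ : Fin n => μ) (f : Lp ℂ 2 ν)
    (h : ∀ A : Fin n → Set M, (∀ i, MeasurableSet (A i)) → (∀ i, μ (A i) < ∞) →
      ∫ k in Set.univ.pi A, f k ∂ν = 0) : f = 0 := by
  -- On a box of finite measure f is integrable, and vanishing integrals over measurable sets force
  -- f = 0 there. The boxes exhaust Mⁿ.
  have hB : ∀ N, f =ᵐ[ν.restrict (Set.univ.pi fun _ => spanningSets μ N)] 0 := by
    intro N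
    set B : Set (Fin n → M) := Set.univ.pi fun _ => spanningSets μ N with hBdef
    have hBm : MeasurableSet B := MeasurableSet.univ_pi fun _ => measurableSet_spanningSets μ N
    have hBf : ν B < ∞ := by
      rw [hν, hBdef, Measure.pi_pi]
      exact ENNReal.prod_lt_top fun _ _ => measure_spanningSets_lt_top μ N
    have hint : Integrable f (ν.restrict B) := integrableOn_L2 f hBf
    refine hint.ae_eq_zero_of_forall_setIntegral_eq_zero fun t ht _ => ?_
    -- Rectangles form a generating π-system, and a rectangle intersected with the box is a
    -- rectangle with sides of finite measure.
    induction t, ht using MeasurableSpace.induction_on_inter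
      (generateFrom_pi (ι := Fin n) (α := fun _ => M)).symm
      (isPiSystem_pi (ι := Fin n) (α := fun _ => M)) with
    | empty => simp
    | basic t ht =>
      obtain ⟨A, hA, rfl⟩ := ht
      simp only [Set.mem_pi, Set.mem_univ, true_implies, Set.mem_ofPred_eq] at hA
      rw [Measure.restrict_restrict (MeasurableSet.univ_pi hA), hBdef, ← Set.pi_inter_distrib]
      exact h _ (fun i => (hA i).inter (measurableSet_spanningSets μ N)) fun i =>
        (measure_mono Set.inter_subset_right).trans_lt (measure_spanningSets_lt_top μ N)
    | compl t ht ih =>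
      have ih := ih (measure_lt_top_of_subset (Set.subset_univ t) (by
        rw [Measure.restrict_apply_univ]; exact hBf.ne))
      rw [setIntegral_compl ht hint, ih, sub_zero]
      exact h _ (fun i => measurableSet_spanningSets μ N) fun i => measure_spanningSets_lt_top μ N
    | iUnion s hd hm ih =>
      rw [integral_iUnion hm hd hint.integrableOn]
      have : ∀ i, ∫ k in s i, f k ∂(ν.restrict B) = 0 := fun i =>
        ih i (measure_lt_top_of_subset (Set.subset_univ _) (by
          rw [Measure.restrict_apply_univ]; exact hBf.ne))
      simp [this]
  refine (Lp.eq_zero_iff_ae_eq_zero).2 ?_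
  have h2 : ∀ N, ∀ᵐ k ∂ν, k ∈ (Set.univ.pi fun _ : Fin n => spanningSets μ N) → f k = 0 := fun N =>
    (ae_restrict_iff' (MeasurableSet.univ_pi fun _ => measurableSet_spanningSets μ N)).1 (hB N)
  filter_upwards [ae_all_iff.2 h2] with k hk
  choose N hN using fun i => Set.mem_iUnion.1 ((iUnion_spanningSets μ).symm ▸ Set.mem_univ (k i))
  refine hk (Finset.univ.sup N) fun i _ => ?_
  exact monotone_spanningSets μ (Finset.le_sup (Finset.mem_univ i)) (hN i)

theorem inner_tensorPow_left {n : ℕ} (g : OneBoson μ) (f : symL2 μ n) :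
    ⟪tensorPow n g, f⟫_ℂ = ∫ k, (starRingEnd ℂ) (∏ i, g (k i)) *
      (f : Lp ℂ 2 (Measure.pi fun _ : Fin n => μ)) k ∂(Measure.pi fun _ : Fin n => μ) := by
  rw [Submodule.coe_inner, L2.inner_def]
  refine integral_congr_ae ?_
  filter_upwards [(memLp_tensorPow n g).coeFn_toLp] with k h1
  change ⟪((memLp_tensorPow n g).toLp _ : Lp ℂ 2 _) k, _⟫_ℂ = _
  rw [h1, RCLike.inner_apply, mul_comm]

theorem integrable_tensorPow_mul {n : ℕ} (g : OneBoson μ) (f : symL2 μ n) :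
    Integrable (fun k => (starRingEnd ℂ) (∏ i, g (k i)) *
      (f : Lp ℂ 2 (Measure.pi fun _ : Fin n => μ)) k) (Measure.pi fun _ : Fin n => μ) := by
  refine (L2.integrable_inner (𝕜 := ℂ) ((memLp_tensorPow n g).toLp _)
    (f : Lp ℂ 2 (Measure.pi fun _ : Fin n => μ))).congr ?_
  filter_upwards [(memLp_tensorPow n g).coeFn_toLp] with k h1
  rw [h1, RCLike.inner_apply, mul_comm]

/-- The tensor powers are total in the `n`-boson space. -/
theorem eq_zero_of_inner_tensorPow {n : ℕ} (f : symL2 μ n)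
    (h : ∀ g : OneBoson μ, ⟪tensorPow n g, f⟫_ℂ = 0) : f = 0 := by
  classical
  set ν := Measure.pi fun _ : Fin n => μ with hν
  set F : Lp ℂ 2 ν := (f : Lp ℂ 2 (Measure.pi fun _ : Fin n => μ)) with hF
  refine Subtype.ext (eq_zero_of_setIntegral_rectangle hν F fun A hA hAf => ?_)
  set a : Fin n → M → ℂ := fun i => (A i).indicator 1 with ha
  -- Polarization: an alternating sum over S of the tensor powers of these indicator sums is, by
  -- Ryser's formula, the symmetrized indicator of the rectangle.
  set G : Finset (Fin n) → OneBoson μ := fun S =>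
    ∑ i ∈ S, indicatorConstLp 2 (hA i) (hAf i).ne (1 : ℂ) with hG
  have hGae : ∀ S, ∀ᵐ x ∂μ, G S x = ∑ i ∈ S, a i x := by
    intro S
    have h1 : ∀ i, indicatorConstLp 2 (hA i) (hAf i).ne (1 : ℂ) =ᵐ[μ] a i :=
      fun i => indicatorConstLp_coeFn
    have h2 : (G S : M → ℂ) =ᵐ[μ] ∑ i ∈ S, (indicatorConstLp 2 (hA i) (hAf i).ne (1 : ℂ) : M → ℂ) :=
      Lp.coeFn_finsetSum _ _
    filter_upwards [h2, ae_all_iff.2 h1] with x e1 e2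
    rw [e1, Finset.sum_apply, Finset.sum_congr rfl fun i _ => e2 i]
  have hconj : ∀ i x, (starRingEnd ℂ) (a i x) = a i x := fun i x => by
    by_cases hx : x ∈ A i <;> simp [ha, hx]
  have hSae : ∀ S, (fun k => (starRingEnd ℂ) (∏ j, G S (k j)) * F k) =ᵐ[ν]
      fun k => (∏ j, ∑ i ∈ S, a i (k j)) * F k := by
    intro S
    filter_upwards [ae_pi_of_ae (n := n) (hGae S)] with k hk
    rw [Finset.prod_congr rfl fun j _ => hk j]
    simp only [map_prod, map_sum, hconj]
  have hS0 : ∀ S, ∫ k, (∏ j, ∑ i ∈ S, a i (k j)) * F k ∂ν = 0 := fun S => by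
    rw [← integral_congr_ae (hSae S), ← inner_tensorPow_left]; exact h _
  have hSint : ∀ S, Integrable (fun k => (∏ j, ∑ i ∈ S, a i (k j)) * F k) ν := fun S =>
    (integrable_tensorPow_mul (G S) f).congr (hSae S)
  have hind : ∀ (σ : Equiv.Perm (Fin n)), (fun k : Fin n → M => (∏ j, a (σ j) (k j)) * F k) =
      (Set.univ.pi fun j => A (σ j)).indicator F := by
    intro σ
    ext k
    by_cases hk : k ∈ Set.univ.pi fun j => A (σ j)
    · rw [Set.indicator_of_mem hk, Finset.prod_eq_one, one_mul]
      intro j _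
      simp only [Set.mem_pi, Set.mem_univ, true_implies] at hk
      simp [ha, hk j]
    · rw [Set.indicator_of_notMem hk]
      simp only [Set.mem_pi, Set.mem_univ, true_implies, not_forall] at hk
      obtain ⟨j, hj⟩ := hk
      rw [Finset.prod_eq_zero (Finset.mem_univ j) (by simp [ha, hj]), zero_mul]
  have hσm : ∀ σ : Equiv.Perm (Fin n), MeasurableSet (Set.univ.pi fun j => A (σ j)) :=
    fun σ => MeasurableSet.univ_pi fun j => hA _
  have hσint : ∀ σ : Equiv.Perm (Fin n),
      Integrable (fun k : Fin n → M => (∏ j, a (σ j) (k j)) * F k) ν := by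
    intro σ
    rw [hind, integrable_indicator_iff (hσm σ)]
    refine integrableOn_L2 F ?_
    rw [hν, Measure.pi_pi]
    exact ENNReal.prod_lt_top fun _ _ => hAf _
  -- The symmetry of f makes the n! permuted rectangles contribute equally.
  have hσ : ∀ σ : Equiv.Perm (Fin n), ∫ k, (∏ j, a (σ j) (k j)) * F k ∂ν
      = ∫ k in Set.univ.pi A, F k ∂ν := by
    intro σ
    have h1 := hind 1
    simp only [Equiv.Perm.coe_one, id] at h1
    rw [← integral_indicator (MeasurableSet.univ_pi hA), ← h1]
    have hp := measurePreserving_perm μ σ⁻¹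
    have h2 : ∫ k, (∏ j, a j (k j)) * F k ∂ν =
        ∫ k, (∏ j, a j (k (σ⁻¹ j))) * F (fun i => k (σ⁻¹ i)) ∂ν := by
      have hint := hσint 1
      simp only [Equiv.Perm.coe_one, id] at hint
      have h3 := integral_map hp.measurable.aemeasurable
        (f := fun k => (∏ j, a j (k j)) * F k)
        (by rw [hp.map_eq]; exact hint.aestronglyMeasurable)
      rw [hp.map_eq] at h3
      exact h3
    rw [h2]
    refine integral_congr_ae ?_
    have h3 := permL2_ae σ⁻¹ F
    rw [mem_symL2_iff.1 f.2 σ⁻¹] at h3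
    filter_upwards [h3] with k hk
    rw [← hk, ← Equiv.prod_comp σ⁻¹ fun j => a (σ j) (k j)]
    simp [hF]
  have hsum : ∑ S : Finset (Fin n), (-1 : ℂ) ^ S.card * ∫ k, (∏ j, ∑ i ∈ S, a i (k j)) * F k ∂ν
      = (-1) ^ n * ∑ σ : Equiv.Perm (Fin n), ∫ k, (∏ j, a (σ j) (k j)) * F k ∂ν := by
    simp only [← integral_const_mul]
    rw [← integral_finsetSum _ fun S _ => (hSint S).const_mul _,
      ← integral_finsetSum _ fun σ _ => hσint σ, ← integral_const_mul]
    congr 1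
    ext k
    have := sum_powerset_prod_sum fun i j => a i (k j)
    simp only [← mul_assoc, ← Finset.sum_mul, this]
  simp only [hS0, mul_zero, Finset.sum_const_zero, hσ, Finset.sum_const, Finset.card_univ,
    Fintype.card_perm, Fintype.card_fin, nsmul_eq_mul] at hsum
  have hne : (-1 : ℂ) ^ n ≠ 0 := pow_ne_zero _ (by norm_num)
  have hfac : ((n.factorial : ℕ) : ℂ) ≠ 0 := Nat.cast_ne_zero.2 n.factorial_ne_zero
  exact (mul_eq_zero.1 ((mul_eq_zero.1 hsum.symm).resolve_left hne)).resolve_left hfac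

theorem tensorPow_smul (n : ℕ) (c : ℂ) (g : OneBoson μ) :
    tensorPow n (c • g) = c ^ n • tensorPow n g := by
  refine Subtype.ext (Lp.ext ?_)
  change (memLp_tensorPow n (c • g)).toLp _ =ᵐ[_] (c ^ n • (memLp_tensorPow n g).toLp _ : Lp ℂ 2 _)
  filter_upwards [(memLp_tensorPow n (c • g)).coeFn_toLp, (memLp_tensorPow n g).coeFn_toLp,
    Lp.coeFn_smul (c ^ n) ((memLp_tensorPow n g).toLp _),
    ae_pi_of_ae (n := n) (Lp.coeFn_smul c g)] with k h1 h2 h3 h4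
  rw [h1, h3, Pi.smul_apply, h2, Finset.prod_congr rfl fun i _ => h4 i]
  simp [Finset.prod_mul_distrib]

/-- The exponential vectors are total in Fock space. -/
theorem eq_zero_of_inner_expVec (ψ : Fock μ) (h : ∀ g : OneBoson μ, ⟪expVec g, ψ⟫_ℂ = 0) :
    ψ = 0 := by
  refine lp.ext (funext fun n => ?_)
  refine eq_zero_of_inner_tensorPow ((ψ : ∀ n, symL2 μ n) n) fun g => ?_
  set c : ℕ → ℂ := fun n => ((1 / Real.sqrt n.factorial : ℝ) : ℂ) *
    ⟪tensorPow n g, (ψ : ∀ n, symL2 μ n) n⟫_ℂ with hc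
  -- As a function of z, ⟨ε(z̄g), ψ⟩ is a power series whose n-th coefficient is a nonzero multiple
  -- of ⟨g^{⊗n}, ψₙ⟩. It vanishes identically, so all coefficients do.
  have hp : HasFPowerSeriesAt (0 : ℂ → ℂ) (FormalMultilinearSeries.ofScalars ℂ c) 0 := by
    rw [hasFPowerSeriesAt_iff]
    refine Eventually.of_forall fun z => ?_
    have h1 := lp.hasSum_inner (𝕜 := ℂ) (expVec ((starRingEnd ℂ) z • g)) ψ
    rw [h] at h1
    refine h1.congr_fun ?_
    intro n
    change _ = ⟪((1 / Real.sqrt n.factorial : ℝ) : ℂ) • tensorPow n ((starRingEnd ℂ) z • g),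
      (ψ : ∀ n, symL2 μ n) n⟫_ℂ
    rw [tensorPow_smul, FormalMultilinearSeries.coeff_ofScalars]
    simp only [Submodule.coe_inner, Submodule.coe_smul, inner_smul_left, hc, map_pow,
      Complex.conj_conj, Complex.conj_ofReal, smul_eq_mul]
    ring
  have h0 := hp.eq_zero
  have h1 : c n = 0 := by
    rw [← FormalMultilinearSeries.coeff_ofScalars (𝕜 := ℂ) (p := c), h0]
    rfl
  refine (mul_eq_zero.1 h1).resolve_left ?_
  exact Complex.ofReal_ne_zero.2 (by positivity)

end

/-! ### Weyl operators as unitary operators; differentiability of exponential vectors -/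

section Abstract

variable {H : Type*} [NormedAddCommGroup H] [InnerProductSpace ℂ H]

/-- On the graph the projection to the first coordinate is isometric, so the domain is closed
because the graph is complete; being dense, it is everything. -/
theorem domain_eq_top_of_isometric [CompleteSpace H] (T : H →ₗ.[ℂ] H)
    (hcl : IsClosed (T.graph : Set (H × H)))
    (hn : ∀ p ∈ T.graph, ‖p.2‖ = ‖p.1‖) (hd : Dense (T.domain : Set H)) : T.domain = ⊤ := by
  have : CompleteSpace T.graph := hcl.completeSpace_coe
  have hiso : Isometry fun p : T.graph => p.1.1 := by
    refine AddMonoidHomClass.isometry_of_norm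
      ((LinearMap.fst ℂ H H).comp T.graph.subtype) fun p => ?_
    change ‖p.1.1‖ = ‖p.1‖
    rw [Prod.norm_def, hn _ p.2, max_self]
  have hr : IsClosed (Set.range fun p : T.graph => p.1.1) :=
    hiso.isClosedEmbedding.isClosed_range
  have hd' : (Set.range fun p : T.graph => p.1.1) = T.domain := by
    ext ψ
    constructor
    · rintro ⟨p, rfl⟩
      exact LinearPMap.mem_domain_of_mem_graph p.2
    · intro h
      obtain ⟨χ, hχ⟩ := LinearPMap.mem_domain_iff.1 h
      exact ⟨⟨_, hχ⟩, rfl⟩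
  rw [hd'] at hr
  rw [Submodule.eq_top_iff']
  intro ψ
  have := hr.closure_eq ▸ hd ψ
  exact this

/-- A closed densely defined isometric operator is an everywhere defined isometry. -/
theorem exists_isometry_of_isometric [CompleteSpace H] (T : H →ₗ.[ℂ] H)
    (hcl : IsClosed (T.graph : Set (H × H)))
    (hn : ∀ p ∈ T.graph, ‖p.2‖ = ‖p.1‖) (hd : Dense (T.domain : Set H)) :
    ∃ U : H →ₗᵢ[ℂ] H, ∀ p : H × H, p ∈ T.graph ↔ p.2 = U p.1 := by
  have ht := domain_eq_top_of_isometric T hcl hn hd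
  have hm : ∀ ψ : H, ψ ∈ T.domain := fun ψ => by rw [ht]; trivial
  refine ⟨⟨T.toFun.comp (LinearMap.id.codRestrict T.domain hm), fun ψ =>
    hn _ (LinearPMap.mem_graph T ⟨ψ, hm ψ⟩)⟩, fun p => ?_⟩
  have h : (p.1, T ⟨p.1, hm p.1⟩) ∈ T.graph := LinearPMap.mem_graph T ⟨p.1, hm p.1⟩
  constructor
  · intro hp
    exact LinearPMap.mem_graph_snd_inj' T hp h rfl
  · intro e
    have : p = (p.1, T ⟨p.1, hm p.1⟩) := Prod.ext rfl e
    rw [this]; exact h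

/-- A map that is linear against a total family is linear. -/
theorem exists_clm_of_inner {E ι : Type*} [NormedAddCommGroup E] [NormedSpace ℂ E] (F : E → H)
    (D : ι → H) (hD : ∀ ψ χ : H, (∀ i, ⟪D i, ψ⟫_ℂ = ⟪D i, χ⟫_ℂ) → ψ = χ)
    (G : ι → E →ₗ[ℂ] ℂ) (h : ∀ i r, ⟪D i, F r⟫_ℂ = G i r) (hn : ∀ r, ‖F r‖ ≤ ‖r‖) :
    ∃ L : E →L[ℂ] H, ∀ r, L r = F r :=
  ⟨LinearMap.mkContinuous
    { toFun := F
      map_add' := fun r s => hD _ _ fun g => by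
        rw [inner_add_right]; simp only [h, map_add]
      map_smul' := fun c r => hD _ _ fun g => by
        rw [RingHom.id_apply, inner_smul_right]; simp only [h, map_smul, smul_eq_mul] }
    1 fun r => by rw [one_mul]; exact hn r, fun _ => rfl⟩

/-- The algebra of the Taylor remainder of ε at h, with W = W(h) and a = ⟨h,k⟩, separated from the
concrete space. -/
theorem smul_map_expansion (W : H →ₗᵢ[ℂ] H) {C e a : ℂ} {x y z A B D : H}
    (hA : A = C • e • W y) (hB : B = C • W x) (hD : D = a • B + C • W z) :
    A - B - D = C • W ((e - 1 - a) • x + (e • (y - x - z) + (e - 1) • z)) := by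
  subst hA hB hD
  simp only [map_add, map_smul, map_sub]
  module

theorem isLittleO_of_norm_le_sq {E F : Type*} [NormedAddCommGroup E] [NormedAddCommGroup F]
    (D : E → F) {K r : ℝ} (hr : 0 < r) (h : ∀ k, ‖k‖ < r → ‖D k‖ ≤ K * ‖k‖ ^ 2) :
    D =o[𝓝 0] fun k : E => k := by
  have hO : D =O[𝓝 0] fun k : E => ‖k‖ ^ 2 := by
    refine Asymptotics.IsBigO.of_bound K ?_
    filter_upwards [Metric.ball_mem_nhds (0 : E) hr] with k hk
    rw [mem_ball_zero_iff] at hk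
    rw [Real.norm_of_nonneg (by positivity)]
    exact h k hk
  refine hO.trans_isLittleO ?_
  exact Asymptotics.isLittleO_norm_pow_id one_lt_two

end Abstract

section

variable {M : Type*} [MeasurableSpace M] {μ : Measure M} [SigmaFinite μ]

theorem dense_span_expVec :
    Dense (Submodule.span ℂ (Set.range (expVec (μ := μ))) : Set (Fock μ)) := by
  rw [Submodule.dense_iff_topologicalClosure_eq_top, Submodule.topologicalClosure_eq_top_iff,
    Submodule.eq_bot_iff]
  intro ψ hψ
  exact eq_zero_of_inner_expVec ψ fun g =>
    (Submodule.mem_orthogonal _ _).1 hψ _ (Submodule.subset_span ⟨g, rfl⟩)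

theorem ext_expVec {A B : Fock μ →L[ℂ] Fock μ} (h : ∀ g, A (expVec g) = B (expVec g)) : A = B := by
  refine ContinuousLinearMap.ext_on dense_span_expVec ?_
  rintro _ ⟨g, rfl⟩
  exact h g

theorem eq_of_inner_expVec {ψ χ : Fock μ} (h : ∀ g : OneBoson μ, ⟪expVec g, ψ⟫_ℂ = ⟪expVec g, χ⟫_ℂ) :
    ψ = χ := by
  rw [← sub_eq_zero]
  exact eq_zero_of_inner_expVec _ fun g => by rw [inner_sub_right, h, sub_self]

theorem weyl_graph (f : OneBoson μ) : (weyl f).graph =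
    (expGraph (fun g => Complex.exp (-(‖f‖ ^ 2 / 2 : ℝ) - ⟪f, g⟫_ℂ))
      fun g => f + g).topologicalClosure := by
  rw [weyl, ← (isClosable_weylCore f).graph_closure_eq_closure_graph, graph_weylCore]

theorem norm_of_mem_weyl_graph (f : OneBoson μ) {p : Fock μ × Fock μ} (hp : p ∈ (weyl f).graph) :
    ‖p.2‖ = ‖p.1‖ := by
  rw [weyl_graph] at hp
  have hcl : IsClosed {x : Fock μ × Fock μ | ‖x.2‖ = ‖x.1‖} :=
    isClosed_eq (by fun_prop) (by fun_prop)
  refine closure_minimal (fun y hy => ?_) hcl hp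
  have := inner_weyl_graph f y hy y hy
  rw [inner_self_eq_norm_sq_to_K, inner_self_eq_norm_sq_to_K] at this
  have h3 : ‖y.2‖^2 = ‖y.1‖^2 := by exact_mod_cast this
  exact (pow_left_inj₀ (norm_nonneg _) (norm_nonneg _) two_ne_zero).1 h3

theorem exists_weylU (f : OneBoson μ) :
    ∃ U : Fock μ →ₗᵢ[ℂ] Fock μ, ∀ p : Fock μ × Fock μ, p ∈ (weyl f).graph ↔ p.2 = U p.1 := by
  refine exists_isometry_of_isometric (weyl f) ?_ (fun p hp => norm_of_mem_weyl_graph f hp) ?_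
  · rw [weyl_graph]; exact Submodule.isClosed_topologicalClosure _
  · refine dense_span_expVec.mono ?_
    rw [SetLike.coe_subset_coe, Submodule.span_le]
    rintro _ ⟨g, rfl⟩
    exact LinearPMap.mem_domain_of_mem_graph (weyl_expVec f g)

/-- The Weyl operator as an everywhere defined isometry. -/
def weylU (f : OneBoson μ) : Fock μ →ₗᵢ[ℂ] Fock μ := (exists_weylU f).choose

theorem mem_weyl_graph_iff (f : OneBoson μ) (p : Fock μ × Fock μ) :
    p ∈ (weyl f).graph ↔ p.2 = weylU f p.1 := (exists_weylU f).choose_spec p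

theorem weylU_expVec (f g : OneBoson μ) : weylU f (expVec g) =
    Complex.exp (-(‖f‖ ^ 2 / 2 : ℝ) - ⟪f, g⟫_ℂ) • expVec (f + g) :=
  ((mem_weyl_graph_iff f _).1 (weyl_expVec f g)).symm

theorem inner_self_eq {H : Type*} [NormedAddCommGroup H] [InnerProductSpace ℂ H] (f : H) : ⟪f, f⟫_ℂ = ((‖f‖ ^ 2 : ℝ) : ℂ) := by
  rw [inner_self_eq_norm_sq_to_K]; push_cast; rfl

theorem weylU_neg_weylU (f : OneBoson μ) (ψ : Fock μ) : weylU (-f) (weylU f ψ) = ψ := by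
  have : (weylU (-f)).toContinuousLinearMap.comp (weylU f).toContinuousLinearMap =
      ContinuousLinearMap.id ℂ (Fock μ) := by
    refine ext_expVec fun g => ?_
    change weylU (-f) (weylU f (expVec g)) = expVec g
    rw [weylU_expVec, map_smul, weylU_expVec, smul_smul, ← Complex.exp_add, neg_add_cancel_left]
    have : (-((‖f‖ ^ 2 / 2 : ℝ) : ℂ) - ⟪f, g⟫_ℂ + (-((‖-f‖ ^ 2 / 2 : ℝ) : ℂ) - ⟪-f, f + g⟫_ℂ)) = 0 := by
      rw [inner_neg_left, inner_add_right, inner_self_eq, norm_neg]; push_cast; ring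
    rw [this, Complex.exp_zero, one_smul]
  exact DFunLike.congr_fun this ψ

theorem weylU_weylU_neg (f : OneBoson μ) (ψ : Fock μ) : weylU f (weylU (-f) ψ) = ψ := by
  have := weylU_neg_weylU (-f) ψ
  rwa [neg_neg] at this

theorem inner_weylU_left (f : OneBoson μ) (ψ χ : Fock μ) :
    ⟪weylU f ψ, χ⟫_ℂ = ⟪ψ, weylU (-f) χ⟫_ℂ := by
  conv_lhs => rw [← weylU_weylU_neg f χ]
  exact (weylU f).inner_map_map _ _

theorem norm_expVec (f : OneBoson μ) : ‖expVec f‖ = Real.exp (‖f‖ ^ 2 / 2) := by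
  have h2 : ‖expVec f‖ ^ 2 = Real.exp (‖f‖ ^ 2) := by
    have := inner_expVec f f
    rw [inner_self_eq_norm_sq_to_K, inner_self_eq_norm_sq_to_K] at this
    apply Complex.ofReal_injective
    push_cast
    exact this
  refine (pow_left_inj₀ (norm_nonneg _) (Real.exp_pos _).le two_ne_zero).1 ?_
  rw [h2, ← Real.exp_nat_mul]; congr 1; push_cast; ring

/-- The one-boson vector `r`, as an element of Fock space. -/
def onePart (r : OneBoson μ) : Fock μ := lp.single 2 1 (tensorPow 1 r)

theorem inner_onePart_expVec (r g : OneBoson μ) : ⟪onePart r, expVec g⟫_ℂ = ⟪r, g⟫_ℂ := by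
  rw [onePart, lp.inner_single_left]
  refine (inner_smul_right (𝕜 := ℂ) (tensorPow 1 r) (tensorPow 1 g) _).trans ?_
  rw [inner_tensorPow]; simp

theorem inner_expVec_onePart (r g : OneBoson μ) : ⟪expVec g, onePart r⟫_ℂ = ⟪g, r⟫_ℂ := by
  rw [← inner_conj_symm, inner_onePart_expVec, inner_conj_symm]

theorem norm_onePart (r : OneBoson μ) : ‖onePart r‖ = ‖r‖ := by
  have h : ⟪onePart r, onePart r⟫_ℂ = ⟪r, r⟫_ℂ := by
    conv_lhs => rw [onePart, lp.inner_single_left]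
    rw [lp.single_apply_self, inner_tensorPow, pow_one]
  rw [inner_self_eq_norm_sq_to_K, inner_self_eq_norm_sq_to_K] at h
  exact (pow_left_inj₀ (norm_nonneg _) (norm_nonneg _) two_ne_zero).1 (by exact_mod_cast h)

theorem exists_onePartL : ∃ L : OneBoson μ →L[ℂ] Fock μ, ∀ r, L r = onePart r :=
  exists_clm_of_inner onePart expVec (fun _ _ h => eq_of_inner_expVec h)
    (fun g => (innerSL ℂ g).toLinearMap) (fun g r => inner_expVec_onePart r g)
    fun r => (norm_onePart r).le

/-- The embedding of the one-boson space into Fock space. -/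
def onePartL : OneBoson μ →L[ℂ] Fock μ := exists_onePartL.choose

theorem onePartL_apply (r : OneBoson μ) : onePartL r = onePart r := exists_onePartL.choose_spec r

/-- The derivative of `f ↦ ε(f)` at `h`. -/
def dExp (h : OneBoson μ) : OneBoson μ →L[ℂ] Fock μ :=
  (innerSL ℂ h).smulRight (expVec h) +
    ((Real.exp (‖h‖ ^ 2 / 2) : ℝ) : ℂ) • (weylU h).toContinuousLinearMap.comp onePartL

theorem dExp_apply (h r : OneBoson μ) : dExp h r = ⟪h, r⟫_ℂ • expVec h +
    ((Real.exp (‖h‖ ^ 2 / 2) : ℝ) : ℂ) • weylU h (onePart r) := by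
  rw [← onePartL_apply]; rfl

/-- The squared norm is exactly e^s - 1 - s with s = ‖k‖². -/
theorem norm_expVec_sub_sub_le {k : OneBoson μ} (hk : ‖k‖ ≤ 1) :
    ‖expVec k - expVec 0 - onePart k‖ ≤ ‖k‖ ^ 2 := by
  have h0 : ⟪expVec k - expVec 0 - onePart k, expVec k - expVec 0 - onePart k⟫_ℂ =
      ((Real.exp (‖k‖ ^ 2) - 1 - ‖k‖ ^ 2 : ℝ) : ℂ) := by
    have h1 : ⟪onePart k, onePart k⟫_ℂ = ((‖k‖ ^ 2 : ℝ) : ℂ) := by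
      rw [inner_self_eq_norm_sq_to_K, norm_onePart]; push_cast; rfl
    simp only [inner_sub_left, inner_sub_right, inner_expVec, inner_onePart_expVec,
      inner_expVec_onePart, inner_zero_left, inner_zero_right, h1, inner_self_eq k, Complex.exp_zero]
    push_cast; ring
  rw [inner_self_eq_norm_sq_to_K] at h0
  have h1 : ‖expVec k - expVec 0 - onePart k‖ ^ 2 = Real.exp (‖k‖ ^ 2) - 1 - ‖k‖ ^ 2 := by
    apply Complex.ofReal_injective; rw [← h0]; push_cast; rfl
  have h2 : |‖k‖ ^ 2| ≤ 1 := by rw [abs_of_nonneg (by positivity)]; exact pow_le_one₀ (norm_nonneg _) hk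
  refine (pow_le_pow_iff_left₀ (norm_nonneg _) (by positivity) two_ne_zero).1 ?_
  rw [h1]
  exact (le_abs_self _).trans (Real.abs_exp_sub_one_sub_id_le h2)

/-- Up to the scalar e^{⟨h,k⟩}, the behaviour of ε near h is the unitary image of its behaviour near
0. -/
theorem expVec_add (h k : OneBoson μ) : expVec (h + k) =
    ((Real.exp (‖h‖ ^ 2 / 2) : ℝ) : ℂ) • Complex.exp ⟪h, k⟫_ℂ • weylU h (expVec k) := by
  rw [weylU_expVec, smul_smul, smul_smul, Complex.ofReal_exp, ← Complex.exp_add, ← Complex.exp_add]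
  have : ((‖h‖ ^ 2 / 2 : ℝ) : ℂ) + ⟪h, k⟫_ℂ + (-((‖h‖ ^ 2 / 2 : ℝ) : ℂ) - ⟪h, k⟫_ℂ) = 0 := by ring
  rw [this, Complex.exp_zero, one_smul]

theorem weylU_expVec_zero (h : OneBoson μ) :
    expVec h = ((Real.exp (‖h‖ ^ 2 / 2) : ℝ) : ℂ) • weylU h (expVec 0) := by
  have := expVec_add h 0
  rwa [add_zero, inner_zero_right, Complex.exp_zero, one_smul] at this

theorem norm_expVec_zero : ‖expVec (0 : OneBoson μ)‖ = 1 := by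
  rw [norm_expVec]; simp

attribute [local irreducible] expVec weylU onePart onePartL

theorem hasFDerivAt_expVec (h : OneBoson μ) : HasFDerivAt expVec (dExp h) h := by
  rw [hasFDerivAt_iff_isLittleO_nhds_zero]
  set C := Real.exp (‖h‖ ^ 2 / 2) with hC
  -- The radius guarantees ‖k‖ ≤ 1 and |⟨h,k⟩| ≤ 1, where the quadratic bounds for the exponential
  -- hold. The three terms of K belong to the bounds `b1`, `b2`, `b3`.
  refine isLittleO_of_norm_le_sq _ (K := C * (‖h‖ ^ 2 + 3 + 2 * ‖h‖)) (r := (1 + ‖h‖)⁻¹)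
    (by positivity) fun k hk => ?_
  have hk1 : ‖k‖ * (1 + ‖h‖) < 1 := by
    rwa [← one_div, lt_div_iff₀ (by positivity)] at hk
  have hk2 : ‖k‖ ≤ 1 := by nlinarith [norm_nonneg k, norm_nonneg h]
  set a := ⟪h, k⟫_ℂ with ha
  have ha1 : ‖a‖ ≤ ‖h‖ * ‖k‖ := norm_inner_le_norm _ _
  have ha2 : ‖a‖ ≤ 1 := by nlinarith [norm_nonneg k, norm_nonneg h]
  have e : expVec (h + k) - expVec h - dExp h k = (C : ℂ) • weylU h
      ((Complex.exp a - 1 - a) • expVec 0 + (Complex.exp a • (expVec k - expVec 0 - onePart k)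
        + (Complex.exp a - 1) • onePart k)) :=
    smul_map_expansion (weylU h) (expVec_add h k) (weylU_expVec_zero h) (dExp_apply h k)
  have b1 : ‖(Complex.exp a - 1 - a) • expVec (0 : OneBoson μ)‖ ≤ ‖h‖ ^ 2 * ‖k‖ ^ 2 := by
    rw [norm_smul, norm_expVec_zero, mul_one]
    refine (Complex.norm_exp_sub_one_sub_id_le ha2).trans ?_
    rw [← mul_pow]; gcongr
  have b0 : ‖Complex.exp a - 1‖ ≤ 2 * ‖a‖ := Complex.norm_exp_sub_one_le ha2
  have b2 : ‖Complex.exp a • (expVec k - expVec 0 - onePart k)‖ ≤ 3 * ‖k‖ ^ 2 := by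
    rw [norm_smul]
    refine mul_le_mul ?_ (norm_expVec_sub_sub_le hk2) (norm_nonneg _) (by norm_num)
    have := norm_add_le (Complex.exp a - 1) 1
    rw [sub_add_cancel, norm_one] at this
    linarith
  have b3 : ‖(Complex.exp a - 1) • onePart k‖ ≤ 2 * ‖h‖ * ‖k‖ ^ 2 := by
    rw [norm_smul, norm_onePart]
    calc ‖Complex.exp a - 1‖ * ‖k‖ ≤ (2 * (‖h‖ * ‖k‖)) * ‖k‖ := by gcongr; linarith
      _ = _ := by ring
  rw [e, norm_smul, LinearIsometry.norm_map, Complex.norm_real, Real.norm_of_nonneg (Real.exp_pos _).le]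
  calc C * _ ≤ C * (‖h‖ ^ 2 * ‖k‖ ^ 2 + (3 * ‖k‖ ^ 2 + 2 * ‖h‖ * ‖k‖ ^ 2)) := by
        refine mul_le_mul_of_nonneg_left ?_ (Real.exp_pos _).le
        exact (norm_add_le _ _).trans (add_le_add b1 ((norm_add_le _ _).trans (add_le_add b2 b3)))
    _ = _ := by ring

theorem continuous_expVec : Continuous (expVec (μ := μ)) :=
  continuous_iff_continuousAt.2 fun h => (hasFDerivAt_expVec h).continuousAt

theorem norm_dExp_le (h : OneBoson μ) : ‖dExp h‖ ≤ (‖h‖ + 1) * Real.exp (‖h‖ ^ 2 / 2) := by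
  refine ContinuousLinearMap.opNorm_le_bound _ (by positivity) fun r => ?_
  rw [dExp_apply]
  refine (norm_add_le _ _).trans ?_
  rw [norm_smul, norm_smul, LinearIsometry.norm_map, norm_onePart, norm_expVec, Complex.norm_real,
    Real.norm_of_nonneg (Real.exp_pos _).le]
  have := norm_inner_le_norm (𝕜 := ℂ) h r
  nlinarith [Real.exp_pos (‖h‖ ^ 2 / 2)]

theorem norm_expVec_sub_le {B : ℝ} {h k : OneBoson μ} (hh : ‖h‖ ≤ B) (hk : ‖k‖ ≤ B) :
    ‖expVec k - expVec h‖ ≤ (B + 1) * Real.exp (B ^ 2 / 2) * ‖k - h‖ := by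
  refine (convex_closedBall (0 : OneBoson μ) B).norm_image_sub_le_of_norm_hasFDerivWithin_le
    (𝕜 := ℂ) (f' := dExp) (fun x _ => (hasFDerivAt_expVec x).hasFDerivWithinAt) (fun x hx => ?_)
    (by simpa using hh) (by simpa using hk)
  have hx' : ‖x‖ ≤ B := by simpa using hx
  have hB : 0 ≤ B := (norm_nonneg _).trans hx'
  refine (norm_dExp_le x).trans ?_
  gcongr

/-- Differentiate ⟨ε(z), ε(y)⟩ = e^{⟨z,y⟩} in y and use uniqueness of the derivative. -/
theorem inner_expVec_dExp (z h r : OneBoson μ) :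
    ⟪expVec z, dExp h r⟫_ℂ = ⟪z, r⟫_ℂ * Complex.exp ⟪z, h⟫_ℂ := by
  have h1 := (innerSL ℂ (expVec z)).hasFDerivAt.comp h (hasFDerivAt_expVec h)
  have h2 : HasFDerivAt (fun y => Complex.exp ⟪z, y⟫_ℂ)
      (Complex.exp ⟪z, h⟫_ℂ • innerSL ℂ z) h := ((innerSL ℂ z).hasFDerivAt (x := h)).cexp
  have h3 : (innerSL ℂ (expVec z)) ∘ expVec = fun y => Complex.exp ⟪z, y⟫_ℂ := by
    ext y; exact inner_expVec z y
  rw [h3] at h1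
  have := DFunLike.congr_fun (h1.unique h2) r
  exact this.trans (mul_comm _ _)

theorem inner_dExp_expVec (z h r : OneBoson μ) :
    ⟪dExp h r, expVec z⟫_ℂ = ⟪r, z⟫_ℂ * Complex.exp ⟪h, z⟫_ℂ := by
  rw [← inner_conj_symm, inner_expVec_dExp, map_mul, inner_conj_symm, ← Complex.exp_conj,
    inner_conj_symm]

/-- As `dExp h r` is a†(r)ε(h), this is the canonical commutation relation: ⟨r,r'⟩ is the
commutator, the product term is the normal-ordered part. -/
theorem inner_dExp_dExp (h r h' r' : OneBoson μ) : ⟪dExp h r, dExp h' r'⟫_ℂ =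
    (⟪r, r'⟫_ℂ + ⟪r, h'⟫_ℂ * ⟪h, r'⟫_ℂ) * Complex.exp ⟪h, h'⟫_ℂ := by
  have h1 := (innerSL ℂ (dExp h r)).hasFDerivAt.comp h' (hasFDerivAt_expVec h')
  have h2 : HasFDerivAt (fun y => ⟪r, y⟫_ℂ * Complex.exp ⟪h, y⟫_ℂ)
      (⟪r, h'⟫_ℂ • (Complex.exp ⟪h, h'⟫_ℂ • innerSL ℂ h) + Complex.exp ⟪h, h'⟫_ℂ • innerSL ℂ r) h' :=
    ((innerSL ℂ r).hasFDerivAt (x := h')).mul ((innerSL ℂ h).hasFDerivAt (x := h')).cexp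
  have h3 : (innerSL ℂ (dExp h r)) ∘ expVec = fun y => ⟪r, y⟫_ℂ * Complex.exp ⟪h, y⟫_ℂ := by
    ext y; exact inner_dExp_expVec y h r
  rw [h3] at h1
  have := DFunLike.congr_fun (h1.unique h2) r'
  refine this.trans ?_
  change ⟪r, h'⟫_ℂ * (Complex.exp ⟪h, h'⟫_ℂ * ⟪h, r'⟫_ℂ) + Complex.exp ⟪h, h'⟫_ℂ * ⟪r, r'⟫_ℂ = _
  ring

end

/-! ### Unbounded operators given by a resolvent -/

section Abstract

variable {H : Type*} [NormedAddCommGroup H] [InnerProductSpace ℂ H]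

/-- `T = A⁻¹ - c`, where `A` is a bounded symmetric operator. -/
def HasRes (T : H →ₗ.[ℂ] H) (c : ℝ) (A : H →L[ℂ] H) : Prop :=
  (∀ ψ χ, ⟪A ψ, χ⟫_ℂ = ⟪ψ, A χ⟫_ℂ) ∧ ∀ p : H × H, p ∈ T.graph ↔ A (p.2 + (c : ℂ) • p.1) = p.1

theorem HasRes.graph {T : H →ₗ.[ℂ] H} {c : ℝ} {A : H →L[ℂ] H} (h : HasRes T c A) (φ : H) :
    (A φ, φ - (c : ℂ) • A φ) ∈ T.graph := by
  rw [h.2]; simp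

theorem HasRes.injective {T : H →ₗ.[ℂ] H} {c : ℝ} {A : H →L[ℂ] H} (h : HasRes T c A) {φ : H}
    (h0 : A φ = 0) : φ = 0 := by
  have := h.graph φ
  rw [h0, smul_zero, sub_zero] at this
  exact T.graph_fst_eq_zero_snd this rfl

/-- A vector η orthogonal to the domain is orthogonal to A(Aη), so ‖Aη‖² = 0; and A is injective. -/
theorem HasRes.dense [CompleteSpace H] {T : H →ₗ.[ℂ] H} {c : ℝ} {A : H →L[ℂ] H}
    (h : HasRes T c A) : Dense (T.domain : Set H) := by
  rw [Submodule.dense_iff_topologicalClosure_eq_top, Submodule.topologicalClosure_eq_top_iff,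
    Submodule.eq_bot_iff]
  intro η hη
  refine h.injective ?_
  rw [← inner_self_eq_zero (𝕜 := ℂ), h.1]
  rw [← inner_conj_symm, (Submodule.mem_orthogonal _ _).1 hη _
    (LinearPMap.mem_domain_of_mem_graph (h.graph (A η))), map_zero]

theorem HasRes.symm {T : H →ₗ.[ℂ] H} {c : ℝ} {A : H →L[ℂ] H} (h : HasRes T c A)
    {p q : H × H} (hp : p ∈ T.graph) (hq : q ∈ T.graph) : ⟪p.2, q.1⟫_ℂ = ⟪p.1, q.2⟫_ℂ := by
  have h1 := h.1 (p.2 + (c : ℂ) • p.1) (q.2 + (c : ℂ) • q.1)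
  rw [(h.2 p).1 hp, (h.2 q).1 hq, inner_add_left, inner_add_right, inner_smul_left,
    inner_smul_right, Complex.conj_ofReal] at h1
  exact (add_right_cancel h1).symm

/-- The range of A lies in the domain of T. Testing a pair of the adjoint graph against Aφ for
arbitrary φ gives the equation that characterizes the graph of T. -/
theorem HasRes.isSelfAdjoint [CompleteSpace H] {T : H →ₗ.[ℂ] H} {c : ℝ} {A : H →L[ℂ] H}
    (h : HasRes T c A) : IsSelfAdjoint T := by
  rw [LinearPMap.isSelfAdjoint_def]
  refine le_antisymm ?_ (LinearPMap.IsFormalAdjoint.le_adjoint h.dense fun x y =>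
    h.symm (T.mem_graph x) (T.mem_graph y))
  refine LinearPMap.le_of_le_graph fun p hp => ?_
  rw [h.2]
  obtain ⟨y, hy1, hy2⟩ := (LinearPMap.mem_graph_iff _).1 hp
  refine ext_inner_right ℂ fun φ => ?_
  rw [h.1]
  have h1 := LinearPMap.adjoint_isFormalAdjoint h.dense y
    ⟨A φ, LinearPMap.mem_domain_of_mem_graph (h.graph φ)⟩
  have h2 : T ⟨A φ, LinearPMap.mem_domain_of_mem_graph (h.graph φ)⟩ = φ - (c : ℂ) • A φ :=
    T.mem_graph_snd_inj' (T.mem_graph _) (h.graph φ) rfl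
  rw [h2, hy1, hy2] at h1
  change ⟪p.2, A φ⟫_ℂ = _ at h1
  rw [inner_add_left, h1, inner_sub_right, inner_smul_left, inner_smul_right, Complex.conj_ofReal]
  ring

/-- Sums, multiples and compositions of unbounded operators are handled through their graphs, which
avoids carrying proofs of domain membership inside terms. -/
theorem mem_opComp_graph (S T : H →ₗ.[ℂ] H) (p : H × H) :
    p ∈ (opComp S T).graph ↔ ∃ η, (p.1, η) ∈ T.graph ∧ (η, p.2) ∈ S.graph := by
  constructor
  · intro hp
    obtain ⟨y, hy1, hy2⟩ := (LinearPMap.mem_graph_iff _).1 hp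
    obtain ⟨x, hx, hx'⟩ := y.2
    have hx'' : (x : H) = y := hx'
    refine ⟨T x, ?_, ?_⟩
    · have := T.mem_graph x
      rwa [hx'', hy1] at this
    · have h1 : (opComp S T) y = S ⟨T x, hx⟩ := by
        change S ⟨T ⟨y, _⟩, _⟩ = _
        congr 2
        congr 1
        exact Subtype.ext hx''.symm
      have := S.mem_graph ⟨T x, hx⟩
      rwa [← h1, hy2] at this
  · rintro ⟨η, h1, h2⟩
    obtain ⟨x, hx1, hx2⟩ := (LinearPMap.mem_graph_iff _).1 h1
    obtain ⟨z, hz1, hz2⟩ := (LinearPMap.mem_graph_iff _).1 h2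
    simp only at hx1 hx2 hz1 hz2
    have hz : T x ∈ S.domain := by rw [hx2, ← hz1]; exact z.2
    have hd : p.1 ∈ (opComp S T).domain := ⟨x, hz, hx1⟩
    refine (LinearPMap.mem_graph_iff _).2 ⟨⟨p.1, hd⟩, rfl, ?_⟩
    rw [← hz2]
    change S ⟨T ⟨p.1, _⟩, _⟩ = _
    congr 1
    refine Subtype.ext ?_
    rw [hz1, ← hx2]
    change T _ = _
    congr 1
    exact Subtype.ext hx1.symm

theorem mem_add_graph (S T : H →ₗ.[ℂ] H) (p : H × H) :
    p ∈ (S + T).graph ↔ ∃ η₁ η₂, (p.1, η₁) ∈ S.graph ∧ (p.1, η₂) ∈ T.graph ∧ p.2 = η₁ + η₂ := by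
  constructor
  · intro hp
    obtain ⟨y, hy1, hy2⟩ := (LinearPMap.mem_graph_iff _).1 hp
    refine ⟨S ⟨y, y.2.1⟩, T ⟨y, y.2.2⟩, ?_, ?_, ?_⟩
    · rw [← hy1]; exact S.mem_graph ⟨y, y.2.1⟩
    · rw [← hy1]; exact T.mem_graph ⟨y, y.2.2⟩
    · rw [← hy2]; exact LinearPMap.add_apply S T y
  · rintro ⟨η₁, η₂, h1, h2, h3⟩
    obtain ⟨x, hx1, hx2⟩ := (LinearPMap.mem_graph_iff _).1 h1
    obtain ⟨z, hz1, hz2⟩ := (LinearPMap.mem_graph_iff _).1 h2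
    simp only at hx1 hx2 hz1 hz2
    have hd : p.1 ∈ S.domain ⊓ T.domain := ⟨by rw [← hx1]; exact x.2, by rw [← hz1]; exact z.2⟩
    refine (LinearPMap.mem_graph_iff _).2 ⟨⟨p.1, hd⟩, rfl, ?_⟩
    rw [h3, ← hx2, ← hz2]
    refine (LinearPMap.add_apply S T ⟨p.1, hd⟩).trans ?_
    congr 2
    · exact Subtype.ext hx1.symm
    · exact Subtype.ext hz1.symm

theorem mem_smul_graph (S : H →ₗ.[ℂ] H) (c : ℂ) (p : H × H) :
    p ∈ (c • S).graph ↔ ∃ η, (p.1, η) ∈ S.graph ∧ p.2 = c • η := by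
  constructor
  · intro hp
    obtain ⟨y, hy1, hy2⟩ := (LinearPMap.mem_graph_iff _).1 hp
    refine ⟨S y, ?_, ?_⟩
    · rw [← hy1]; exact S.mem_graph _
    · rw [← hy2]; rfl
  · rintro ⟨η, h1, h2⟩
    obtain ⟨x, hx1, hx2⟩ := (LinearPMap.mem_graph_iff _).1 h1
    refine (LinearPMap.mem_graph_iff _).2 ⟨x, hx1, ?_⟩
    simp only at hx2
    rw [h2, ← hx2]; rfl

theorem mem_smul_id_graph (c : ℂ) (p : H × H) :
    p ∈ ((c • (LinearMap.id : H →ₗ[ℂ] H)).toPMap ⊤).graph ↔ p.2 = c • p.1 := by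
  rw [LinearPMap.mem_graph_iff]
  constructor
  · rintro ⟨y, hy1, hy2⟩
    rw [← hy1, ← hy2]; rfl
  · intro h
    exact ⟨⟨p.1, trivial⟩, rfl, h.symm⟩

/-- A densely defined symmetric operator is closable. -/
theorem isClosable_of_symm {T : H →ₗ.[ℂ] H} (hd : Dense (T.domain : Set H))
    (hs : ∀ p ∈ T.graph, ∀ q ∈ T.graph, ⟪p.2, q.1⟫_ℂ = ⟪p.1, q.2⟫_ℂ) : T.IsClosable := by
  refine ⟨T.graph.topologicalClosure.toLinearPMap, (Submodule.toLinearPMap_graph_eq _ ?_).symm⟩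
  intro p hp h0
  refine hd.eq_zero_of_inner_right ℂ fun v hv => ?_
  have hcl : IsClosed {p : H × H | ⟪v, p.2⟫_ℂ = ⟪T ⟨v, hv⟩, p.1⟫_ℂ} :=
    isClosed_eq (by fun_prop) (by fun_prop)
  have h1 : p ∈ {p : H × H | ⟪v, p.2⟫_ℂ = ⟪T ⟨v, hv⟩, p.1⟫_ℂ} :=
    closure_minimal (fun q hq => (hs _ (T.mem_graph ⟨v, hv⟩) q hq).symm) hcl hp
  have h2 : ⟪v, p.2⟫_ℂ = ⟪T ⟨v, hv⟩, p.1⟫_ℂ := h1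
  rw [h2, h0, inner_zero_right]

theorem symm_add_adjoint [CompleteSpace H] {T : H →ₗ.[ℂ] H} (hd : Dense (T.domain : Set H)) :
    ∀ p ∈ (T + T.adjoint).graph, ∀ q ∈ (T + T.adjoint).graph,
      ⟪p.2, q.1⟫_ℂ = ⟪p.1, q.2⟫_ℂ := by
  have key : ∀ p ∈ T.adjoint.graph, ∀ q ∈ T.graph, ⟪p.2, q.1⟫_ℂ = ⟪p.1, q.2⟫_ℂ := by
    intro p hp q hq
    obtain ⟨y, hy1, hy2⟩ := (LinearPMap.mem_graph_iff _).1 hp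
    obtain ⟨z, hz1, hz2⟩ := (LinearPMap.mem_graph_iff _).1 hq
    rw [← hy1, ← hy2, ← hz1, ← hz2]
    exact LinearPMap.adjoint_isFormalAdjoint hd y z
  intro p hp q hq
  obtain ⟨a, b, h1, h2, h3⟩ := (mem_add_graph _ _ _).1 hp
  obtain ⟨a', b', h1', h2', h3'⟩ := (mem_add_graph _ _ _).1 hq
  have e1 := key _ h2 _ h1'
  have e2 := key _ h2' _ h1
  simp only at e1 e2
  rw [h3, h3', inner_add_left, inner_add_right, e1, ← inner_conj_symm a, ← e2, inner_conj_symm]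
  ring

/-- Sesquilinear identities extend from a family to linear combinations. -/
theorem inner_linearCombination_eq {K ι : Type*} [NormedAddCommGroup K] [InnerProductSpace ℂ K]
    {a b : ι → H} {a' b' : ι → K} (h : ∀ i j, ⟪a i, b j⟫_ℂ = ⟪a' i, b' j⟫_ℂ) (c d : ι →₀ ℂ) :
    ⟪Finsupp.linearCombination ℂ a c, Finsupp.linearCombination ℂ b d⟫_ℂ =
      ⟪Finsupp.linearCombination ℂ a' c, Finsupp.linearCombination ℂ b' d⟫_ℂ := by
  induction c using Finsupp.induction_linear with
  | zero => simp
  | add c₁ c₂ h₁ h₂ => simp only [map_add, inner_add_left, h₁, h₂]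
  | single i s =>
    induction d using Finsupp.induction_linear with
    | zero => simp
    | add d₁ d₂ h₁ h₂ => simp only [map_add, inner_add_right, h₁, h₂]
    | single j t =>
      simp only [Finsupp.linearCombination_single, inner_smul_left, inner_smul_right, h]

theorem dense_range_linearCombination [CompleteSpace H] {ι : Type*} {a : ι → H}
    (h : ∀ χ, (∀ i, ⟪a i, χ⟫_ℂ = 0) → χ = 0) :
    DenseRange (Finsupp.linearCombination ℂ a) := by
  have : Dense (LinearMap.range (Finsupp.linearCombination ℂ a) : Set H) := by
    rw [Submodule.dense_iff_topologicalClosure_eq_top, Submodule.topologicalClosure_eq_top_iff,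
      Submodule.eq_bot_iff]
    intro χ hχ
    refine h χ fun i => (Submodule.mem_orthogonal _ _).1 hχ _ ⟨Finsupp.single i 1, ?_⟩
    simp
  exact this

/-- The number estimate in abstract form: under these algebraic relations, `a + b` is bounded
with respect to `d`. -/
theorem norm_linearCombination_le {K ι : Type*} [NormedAddCommGroup K] [InnerProductSpace ℂ K]
    {e d a b : ι → H} {z : ι → K} {κ s : ℝ} (hκ : 0 ≤ κ) (hs : 0 ≤ s) (F : H → K)
    (hF : ∀ ξ, ‖F ξ‖ ≤ κ * ‖ξ‖)
    (h1 : ∀ i j, ⟪e i, d j⟫_ℂ = ⟪z i, z j⟫_ℂ) (h2 : ∀ ξ j, ⟪ξ, a j⟫_ℂ = ⟪F ξ, z j⟫_ℂ)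
    (h3 : ∀ i j, ⟪b i, b j⟫_ℂ = ⟪a i, a j⟫_ℂ + (s : ℂ) ^ 2 * ⟪e i, e j⟫_ℂ) (c : ι →₀ ℂ) :
    ‖Finsupp.linearCombination ℂ a c + Finsupp.linearCombination ℂ b c‖ ≤
      (2 * κ + s) * (‖Finsupp.linearCombination ℂ e c‖ + ‖Finsupp.linearCombination ℂ d c‖) := by
  set E := Finsupp.linearCombination ℂ e c with hE
  set D := Finsupp.linearCombination ℂ d c with hD
  set A := Finsupp.linearCombination ℂ a c with hA
  set B := Finsupp.linearCombination ℂ b c with hB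
  set Z := Finsupp.linearCombination ℂ z c with hZ
  -- In the application Z is √ω(k)a(k) applied to E, and D = dΓ(ω)E, so that ‖Z‖² = ⟨E, D⟩.
  have hZ2 : ‖Z‖ ≤ ‖E‖ + ‖D‖ := by
    have h := inner_linearCombination_eq h1 c c
    rw [inner_self_eq Z, ← hE, ← hD] at h
    have h4 : ‖Z‖ ^ 2 ≤ ‖E‖ * ‖D‖ := by
      have := norm_inner_le_norm (𝕜 := ℂ) E D
      rw [h, Complex.norm_real, Real.norm_of_nonneg (by positivity)] at this
      exact this
    nlinarith [norm_nonneg E, norm_nonneg D, norm_nonneg Z]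
  -- Taking ξ = A in the relation with F gives ‖A‖² = ⟨F A, Z⟩, by which a(ρ) is bounded by Z.
  have hA2 : ‖A‖ ≤ κ * ‖Z‖ := by
    have h : ∀ ξ, ⟪ξ, A⟫_ℂ = ⟪F ξ, Z⟫_ℂ := by
      intro ξ
      simp only [hA, hZ, Finsupp.linearCombination_apply, Finsupp.sum, inner_sum,
        inner_smul_right, h2]
    have h5 := h A
    rw [inner_self_eq A] at h5
    have := norm_inner_le_norm (𝕜 := ℂ) (F A) Z
    rw [← h5, Complex.norm_real, Real.norm_of_nonneg (by positivity)] at this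
    have h6 := hF A
    by_contra hlt
    push Not at hlt
    have : ‖A‖ * ‖A‖ ≤ κ * ‖Z‖ * ‖A‖ := by nlinarith [norm_nonneg Z]
    have h7 : 0 < ‖A‖ := lt_of_le_of_lt (by positivity) hlt
    nlinarith
  -- The commutation relation: the creation part exceeds the annihilation part by s²‖E‖² in squared
  -- norm.
  have hB2 : ‖B‖ ≤ ‖A‖ + s * ‖E‖ := by
    have h : ⟪B, B⟫_ℂ = ⟪A, A⟫_ℂ + (s : ℂ) ^ 2 * ⟪E, E⟫_ℂ := by
      simp only [hA, hB, hE, Finsupp.linearCombination_apply, Finsupp.sum, inner_sum, sum_inner,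
        inner_smul_right, inner_smul_left, h3, Finset.mul_sum, ← Finset.sum_add_distrib]
      refine Finset.sum_congr rfl fun i _ => Finset.sum_congr rfl fun j _ => ?_
      ring
    rw [inner_self_eq, inner_self_eq, inner_self_eq] at h
    have h8 : ‖B‖ ^ 2 = ‖A‖ ^ 2 + s ^ 2 * ‖E‖ ^ 2 := by exact_mod_cast h
    refine abs_le_of_sq_le_sq' ?_ (by positivity) |>.2
    have : 0 ≤ s * (‖A‖ * ‖E‖) := by positivity
    nlinarith
  have := norm_add_le A B
  nlinarith [norm_nonneg E, norm_nonneg D, norm_nonneg Z]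

end Abstract

/-! ### Graph membership by limits, and linear identities in an abstract space. -/

section Abstract

variable {H : Type*} [NormedAddCommGroup H] [InnerProductSpace ℂ H]

/-- Convergence to Tψ is only required after two applications of A, because the difference quotients
of a semigroup converge in norm only after such regularization. Injectivity of A cancels one factor,
leaving Aη = ψ - Aψ. -/
theorem HasRes.mem_graph_of_tendsto {T : H →ₗ.[ℂ] H} {A : H →L[ℂ] H} (h : HasRes T 1 A)
    {ψ η : H} {S : ℕ → H} (hS : Tendsto S atTop (𝓝 η))
    (hl : Tendsto (fun n => A (A (S n))) atTop (𝓝 (A (ψ - A ψ)))) : (ψ, η) ∈ T.graph := by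
  have hE : A (A η) = A (ψ - A ψ) :=
    tendsto_nhds_unique (((A.continuous.tendsto _).comp ((A.continuous.tendsto _).comp hS))) hl
  rw [h.2]
  have h3 : A η - (ψ - A ψ) = 0 := h.injective (by rw [map_sub, hE, sub_self])
  rw [Complex.ofReal_one, one_smul, map_add]
  change A η + A ψ = ψ
  rw [sub_eq_zero.1 h3]; abel

theorem smul_sub_eq_of_add {n : ℕ} {ψ S X : H}
    (h : ((n : ℝ) : ℂ) • ψ + ((-(n : ℝ) : ℝ) : ℂ) • S = X) : (n : ℂ) • (ψ - S) = X := by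
  rw [← h]; push_cast; module

theorem map_sub_eq_of_add {A : H →L[ℂ] H} {ψ X : H}
    (h : ((1 : ℝ) : ℂ) • A ψ + ((-1 : ℝ) : ℂ) • A (A ψ) = X) : A (ψ - A ψ) = X := by
  rw [← h, map_sub]; push_cast; module

theorem map_add_smul_eq {S : H →L[ℂ] H} {a b a' b' : H} {c : ℂ} (ha : S a = a') (hb : S b = b') :
    S (a + c • b) = a' + c • b' := by
  rw [map_add, map_smul, ha, hb]

theorem inner_eq_zero_of_tendsto_sum {a : ℕ → ℕ → ℂ} {N : ℕ → ℕ} {S : ℕ → ℕ → H} {x χ : H}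
    (h : Tendsto (fun n => ∑ j ∈ Finset.range (N n), a n j • S n j) atTop (𝓝 x))
    (h0 : ∀ n j, ⟪S n j, χ⟫_ℂ = 0) : ⟪x, χ⟫_ℂ = 0 := by
  refine tendsto_nhds_unique (h.inner (𝕜 := ℂ) (tendsto_const_nhds (x := χ)))
    (tendsto_const_nhds.congr fun n => ?_)
  rw [sum_inner]
  exact (Finset.sum_eq_zero fun j _ => by rw [inner_smul_left, h0, mul_zero]).symm

end Abstract

/-! ### The second quantization on exponential vectors -/

section SecondQuantization

variable {M : Type*} [MeasurableSpace M] {μ : Measure M} [SigmaFinite μ] {ω : M → ℝ}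

/-- The error s - n(1 - e^{-s/n}) lies between 0 and s²/n, and the factor (1 + s)⁻² of the two
resolvents absorbs the s². -/
theorem abs_expF_quotient_sub_le {n : ℕ} (hn : 0 < n) {s : ℝ} (hs : 0 ≤ s) :
    |resF 1 s * (resF 1 s * (n * (1 - expF (1 / n) s))) - (resF 1 s - resF 1 s * resF 1 s)|
      ≤ (n : ℝ)⁻¹ := by
  have hn' : (0 : ℝ) < n := by exact_mod_cast hn
  rw [resF_eq le_rfl hs, expF_eq (by positivity) hs]
  set e := Real.exp (-(1 / n * s)) with he
  have h1 : 1 - s / n ≤ e := by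
    have := Real.add_one_le_exp (-(1 / n * s))
    rw [← he] at this
    have h2 : -(1 / (n : ℝ) * s) = -(s / n) := by ring
    linarith
  have h2 : e * (1 + s / n) ≤ 1 := by
    have := Real.add_one_le_exp (1 / n * s)
    have h3 : e * Real.exp (1 / n * s) = 1 := by rw [he, ← Real.exp_add]; simp
    have h4 : (1 / (n : ℝ) * s) = s / n := by ring
    rw [h4] at this h3
    nlinarith [Real.exp_pos (-(1 / n * s))]
  have hsn : 0 ≤ s / n := by positivity
  have h3 : n * (1 - e) - s ≤ 0 := by
    have : (n : ℝ) * (s / n) = s := by field_simp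
    nlinarith
  have h4 : -(s ^ 2 / n) ≤ n * (1 - e) - s := by
    have h5 : 1 - e ≥ s / n - (s / n) ^ 2 := by
      have : e ≤ 1 := by nlinarith [Real.exp_pos (-(1 / n * s))]
      have : e * (1 + s / n) * (1 - s / n) ≤ 1 - s / n ∨ 1 < s / n := by
        by_cases h : s / n ≤ 1
        · left; nlinarith
        · right; linarith
      rcases this with h | h
      · nlinarith [sq_nonneg (s / n)]
      · nlinarith
    have h6 : (n : ℝ) * (s / n) = s := by field_simp
    have h7 : (n : ℝ) * (s / n) ^ 2 = s ^ 2 / n := by field_simp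
    nlinarith
  have h5 : (1 + s)⁻¹ * ((1 + s)⁻¹ * (n * (1 - e))) - ((1 + s)⁻¹ - (1 + s)⁻¹ * (1 + s)⁻¹) =
      (n * (1 - e) - s) / (1 + s) ^ 2 := by
    field_simp; ring
  rw [h5, abs_div, abs_of_nonpos h3, abs_of_pos (by positivity), div_le_iff₀ (by positivity)]
  have h6 : s ^ 2 / n ≤ (n : ℝ)⁻¹ * (1 + s) ^ 2 := by
    rw [div_eq_inv_mul]; gcongr; linarith
  linarith

theorem hasRes_dGamma (hω : Measurable ω) (hω0 : ∀ k, 0 ≤ ω k) {c : ℝ} (hc : 1 ≤ c) :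
    HasRes (dGamma μ ω) c (res hω c) :=
  ⟨inner_res_left hω c, mem_dGamma_graph_iff hω hω0 hc⟩

/-- A vector at which the semigroup is differentiable is in the domain of `dΓ(ω)`. -/
theorem mem_dGamma_graph_of_tendsto (hω : Measurable ω) (hω0 : ∀ k, 0 ≤ ω k) {ψ η : Fock μ}
    (h : Tendsto (fun n : ℕ => (n : ℂ) • (ψ - semi hω (1 / n : ℝ) ψ)) atTop (𝓝 η)) :
    (ψ, η) ∈ (dGamma μ ω).graph := by
  have hb (n : ℕ) : BddMeas fun s => (n : ℝ) * (1 - expF (1 / n) s) :=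
    ((bddMeas_const 1).sub (bddMeas_expF _)).const_mul _
  have hb1 (n : ℕ) : BddMeas fun s => resF 1 s * ((n : ℝ) * (1 - expF (1 / n) s)) :=
    (bddMeas_resF 1).mul (hb n)
  have hb2 (n : ℕ) : BddMeas fun s => resF 1 s * (resF 1 s * ((n : ℝ) * (1 - expF (1 / n) s))) :=
    (bddMeas_resF 1).mul (hb1 n)
  have hbr : BddMeas fun s => resF 1 s * resF 1 s := (bddMeas_resF 1).mul (bddMeas_resF 1)
  have hbl : BddMeas fun s => resF 1 s - resF 1 s * resF 1 s := (bddMeas_resF 1).sub hbr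
  have hA (n : ℕ) : res hω 1 (res hω 1 ((n : ℂ) • (ψ - semi hω (1 / n : ℝ) ψ))) =
      fc hω _ (hb2 n) ψ := by
    have h0 := fc_add_eq hω hω0 (bddMeas_const 1) (bddMeas_expF (1 / n : ℝ)) (hb n)
      (n : ℝ) (-(n : ℝ)) (fun s _ => by ring) ψ
    rw [fc_one hω hω0 (bddMeas_const 1) (fun _ _ => rfl) ψ] at h0
    refine (congrArg _ (congrArg _ (smul_sub_eq_of_add h0))).trans ?_
    exact (congrArg _ (fc_fc hω hω0 (bddMeas_resF 1) (hb n) (hb1 n) (fun _ _ => rfl) ψ)).trans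
      (fc_fc hω hω0 (bddMeas_resF 1) (hb1 n) (hb2 n) (fun _ _ => rfl) ψ)
  have hL : Tendsto (fun n => fc hω _ (hb2 n) ψ) atTop (𝓝 (fc hω _ hbl ψ)) := by
    rw [tendsto_iff_norm_sub_tendsto_zero]
    have hlim : Tendsto (fun n : ℕ => (n : ℝ)⁻¹ * ‖ψ‖) atTop (𝓝 0) := by
      simpa using tendsto_inv_atTop_nhds_zero_nat.mul_const ‖ψ‖
    refine squeeze_zero' (.of_forall fun _ => norm_nonneg _) ?_ hlim
    filter_upwards [eventually_gt_atTop 0] with n hn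
    exact norm_fc_sub_le hω hω0 (hb2 n) hbl (by positivity)
      (fun s hs => abs_expF_quotient_sub_le hn hs) ψ
  have hE2 : res hω 1 (ψ - res hω 1 ψ) = fc hω _ hbl ψ := by
    have h0 := fc_add_eq hω hω0 (bddMeas_resF 1) hbr hbl 1 (-1) (fun s _ => by ring) ψ
    rw [← fc_fc hω hω0 (bddMeas_resF 1) (bddMeas_resF 1) hbr (fun _ _ => rfl) ψ] at h0
    exact map_sub_eq_of_add h0
  refine (hasRes_dGamma hω hω0 le_rfl).mem_graph_of_tendsto h ?_
  rw [hE2]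
  exact hL.congr fun n => (hA n).symm

attribute [local irreducible] expVec weylU onePart onePartL semi res

/-- Dominated convergence: 0 ≤ n(1 - e^{-ω/n}) ≤ ω, so |ωy| dominates. -/
theorem tendsto_smul_decay_sub (hω : Measurable ω) (hω0 : ∀ k, 0 ≤ ω k) {y r : OneBoson μ}
    (hr : r =ᵐ[μ] fun k => (ω k : ℂ) * y k) :
    Tendsto (fun n : ℕ => (-(n : ℂ)) • (decay hω (1 / n : ℝ) y - y)) atTop (𝓝 r) := by
  have hae (n : ℕ) : ∀ᵐ k ∂μ, ((-(n : ℂ)) • (decay hω (1 / n : ℝ) y - y) : OneBoson μ) k =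
      ((n * (1 - expF (1 / n) (ω k)) : ℝ) : ℂ) * y k := by
    filter_upwards [Lp.coeFn_smul (-(n : ℂ)) (decay hω (1 / n : ℝ) y - y),
      Lp.coeFn_sub (decay hω (1 / n : ℝ) y) y,
      mulOp_ae ((bddMeas_expF (1 / n : ℝ)).comp hω) y] with k h1 h2 h3
    rw [h1, Pi.smul_apply, h2, Pi.sub_apply]
    change _ • (mulOp _ _ y k - _) = _
    rw [h3, smul_eq_mul]; push_cast; ring
  have hle (n : ℕ) (s : ℝ) (hs : 0 ≤ s) : 0 ≤ n * (1 - expF (1 / n) s) ∧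
      n * (1 - expF (1 / n) s) ≤ s := by
    refine ⟨mul_nonneg n.cast_nonneg (by linarith [expF_le_one (1 / n) s]), ?_⟩
    rcases Nat.eq_zero_or_pos n with rfl | hn
    · simpa
    have hn' : (0 : ℝ) < n := by exact_mod_cast hn
    rw [expF_eq (by positivity) hs]
    have := Real.add_one_le_exp (-(1 / n * s))
    have h6 : (n : ℝ) * (1 / n * s) = s := by field_simp
    nlinarith
  refine tendsto_of_ae_le (g := r) (fun n => ?_) ?_
  · filter_upwards [hae n, hr] with k h1 h2
    rw [h1, h2, norm_mul, norm_mul, Complex.norm_real, Complex.norm_real,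
      Real.norm_of_nonneg (hle n _ (hω0 k)).1, Real.norm_of_nonneg (hω0 k)]
    exact mul_le_mul_of_nonneg_right (hle n _ (hω0 k)).2 (norm_nonneg _)
  · filter_upwards [ae_all_iff.2 hae, hr] with k h1 h2
    simp only [h1, h2]
    refine Tendsto.mul_const _ ((Complex.continuous_ofReal.tendsto _).comp ?_)
    have h3 : HasDerivAt (fun t : ℝ => 1 - Real.exp (-(t * ω k))) (ω k) 0 := by
      have := ((((hasDerivAt_id (0 : ℝ)).mul_const (ω k)).neg).exp).const_sub 1
      simpa using this
    have h4 := h3.tendsto_slope_zero_right.comp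
      (tendsto_nhdsWithin_iff.2 ⟨tendsto_inv_atTop_nhds_zero_nat (𝕜 := ℝ),
        (eventually_gt_atTop 0).mono fun n hn => by
          simpa using (show (0 : ℝ) < n by exact_mod_cast hn)⟩)
    refine h4.congr fun n => ?_
    simp only [Function.comp_apply, inv_inv, zero_add, zero_mul, neg_zero, Real.exp_zero, sub_self,
      sub_zero, smul_eq_mul, one_div]
    rw [expF_eq (by positivity) (hω0 k)]

/-- Chain rule: the semigroup moves ε(y) along ε(e^{-tω}y), and -ωy is the velocity at t = 0. -/
theorem expVec_mem_dGamma_graph (hω : Measurable ω) (hω0 : ∀ k, 0 ≤ ω k) {y r : OneBoson μ}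
    (hr : r =ᵐ[μ] fun k => (ω k : ℂ) * y k) : (expVec y, dExp y r) ∈ (dGamma μ ω).graph := by
  refine mem_dGamma_graph_of_tendsto hω hω0 ?_
  have ht := tendsto_smul_decay_sub hω hω0 hr
  have h0 : Tendsto (fun n : ℕ => decay hω (1 / n : ℝ) y - y) atTop (𝓝 0) := by
    have h1 : Tendsto (fun n : ℕ => -(((n : ℝ)⁻¹ : ℝ) : ℂ)) atTop (𝓝 0) := by
      simpa using ((Complex.continuous_ofReal.tendsto _).comp
        (tendsto_inv_atTop_nhds_zero_nat (𝕜 := ℝ))).neg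
    have h2 := h1.smul ht
    rw [zero_smul] at h2
    refine h2.congr' ?_
    filter_upwards [eventually_gt_atTop 0] with n hn
    have hn' : (n : ℂ) ≠ 0 := by exact_mod_cast hn.ne'
    rw [smul_smul]
    push_cast
    rw [neg_mul_neg, inv_mul_cancel₀ hn', one_smul]
  have h := HasFDerivWithinAt.lim (hasFDerivAt_expVec y).hasFDerivWithinAt (s := Set.univ)
    h0 (.of_forall fun _ => trivial) ht
  refine h.congr fun n => ?_
  rw [add_sub_cancel, semi_expVec hω hω0, neg_smul, ← smul_neg, neg_sub]

theorem inner_semi_left (hω : Measurable ω) (t : ℝ) (ψ χ : Fock μ) :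
    ⟪semi hω t ψ, χ⟫_ℂ = ⟪ψ, semi hω t χ⟫_ℂ := by
  unfold semi; exact inner_fc_left hω _ ψ χ

theorem inner_decay_left (hω : Measurable ω) (t : ℝ) (f g : OneBoson μ) :
    ⟪decay hω t f, g⟫_ℂ = ⟪f, decay hω t g⟫_ℂ := inner_mulOp_left _ f g

theorem semi_dExp (hω : Measurable ω) (hω0 : ∀ k, 0 ≤ ω k) (t : ℝ) (y r : OneBoson μ) :
    semi hω t (dExp y r) = dExp (decay hω t y) (decay hω t r) := by
  refine eq_of_inner_expVec fun z => ?_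
  rw [← inner_semi_left, semi_expVec hω hω0, inner_expVec_dExp, inner_expVec_dExp,
    inner_decay_left, inner_decay_left]

/-- Multiplication by e^{-tω} preserves the domain of ω, so the exponential vectors over that domain
are a semigroup-invariant family. -/
theorem decay_mul_ae (hω : Measurable ω) (t : ℝ) {y r : OneBoson μ}
    (hr : r =ᵐ[μ] fun k => (ω k : ℂ) * y k) :
    decay hω t r =ᵐ[μ] fun k => (ω k : ℂ) * decay hω t y k := by
  filter_upwards [mulOp_ae ((bddMeas_expF t).comp hω) y,
    mulOp_ae ((bddMeas_expF t).comp hω) r, hr] with k h1 h2 h3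
  change mulOp _ _ r k = _ * mulOp _ _ y k
  rw [h1, h2, h3]; ring

/-- Vectors in the domain of `ω` are dense. -/
theorem exists_tendsto_mul_mem (hω : Measurable ω) (y : OneBoson μ) :
    ∃ yn rn : ℕ → OneBoson μ, (∀ n, rn n =ᵐ[μ] fun k => (ω k : ℂ) * yn n k) ∧
      Tendsto yn atTop (𝓝 y) := by
  have hpos (n : ℕ) (s : ℝ) : 0 < (n : ℝ) + 1 + |s| := by positivity
  have hb (n : ℕ) : BddMeas fun k => ((n : ℝ) + 1) / (n + 1 + |ω k|) :=
    ⟨by fun_prop, 1, fun k => by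
      rw [abs_of_pos (div_pos (by positivity) (hpos n _)), div_le_one (hpos n _)]
      linarith [abs_nonneg (ω k)]⟩
  have hb' (n : ℕ) : BddMeas fun k => ω k * (((n : ℝ) + 1) / (n + 1 + |ω k|)) :=
    ⟨by fun_prop, n + 1, fun k => by
      rw [abs_mul, abs_of_pos (div_pos (by positivity) (hpos n _)), ← mul_div_assoc,
        div_le_iff₀ (hpos n _)]
      nlinarith [abs_nonneg (ω k), n.cast_nonneg (α := ℝ)]⟩
  refine ⟨fun n => mulOp _ (hb n) y, fun n => mulOp _ (hb' n) y, fun n => ?_,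
    tendsto_mulOp hb (fun n k => ?_) y (ae_of_all _ fun k => ?_)⟩
  · filter_upwards [mulOp_ae (hb n) y, mulOp_ae (hb' n) y] with k h1 h2
    rw [h1, h2]; push_cast; ring
  · rw [abs_of_pos (div_pos (by positivity) (hpos n _)), div_le_one (hpos n _)]
    linarith [abs_nonneg (ω k)]
  · have h1 : Tendsto (fun n : ℕ => 1 - |ω k| / ((n : ℝ) + 1 + |ω k|)) atTop (𝓝 (1 - 0)) := by
      refine tendsto_const_nhds.sub (tendsto_const_nhds.div_atTop ?_)
      exact tendsto_atTop_add_const_right _ _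
        (tendsto_atTop_add_const_right _ _ tendsto_natCast_atTop_atTop)
    rw [sub_zero] at h1
    refine h1.congr fun n => ?_
    have := (hpos n (ω k)).ne'
    field_simp; ring

variable (μ ω) in
/-- The graph of multiplication by `ω` on the one-boson space. -/
abbrev MulGraph := {p : OneBoson μ × OneBoson μ // p.2 =ᵐ[μ] fun k => (ω k : ℂ) * p.1 k}

/-- Exponential vectors over the domain of `ω` span a core of `dΓ(ω)`. -/
theorem eq_zero_of_inner_dGamma (hω : Measurable ω) (hω0 : ∀ k, 0 ≤ ω k) {c : ℝ} (hc : 1 ≤ c)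
    (χ : Fock μ)
    (h : ∀ p : MulGraph μ ω, ⟪dExp p.1.1 p.1.2 + (c : ℂ) • expVec p.1.1, χ⟫_ℂ = 0) : χ = 0 := by
  have h1 : ∀ p : MulGraph μ ω, ⟪expVec p.1.1, χ⟫_ℂ = 0 := by
    rintro ⟨⟨y, r⟩, hr⟩
    have hres : res hω c (dExp y r + (c : ℂ) • expVec y) = expVec y :=
      ((hasRes_dGamma hω hω0 hc).2 _).1 (expVec_mem_dGamma_graph hω hω0 hr)
    have hlim := tendsto_riemann_res hω hω0 hc (dExp y r + (c : ℂ) • expVec y)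
    rw [hres] at hlim
    -- The family (dΓ(ω) + c)ε(y) is permuted by the semigroup. Orthogonality of χ to it therefore
    -- passes to the Riemann sums, whose limit is the resolvent applied to the family, that is ε(y).
    refine inner_eq_zero_of_tendsto_sum hlim fun n j => ?_
    refine (congrArg (fun ξ => ⟪ξ, χ⟫_ℂ) (map_add_smul_eq (semi_dExp hω hω0 _ y r)
      (semi_expVec hω hω0 _ y))).trans ?_
    exact h ⟨(decay hω _ y, decay hω _ r), decay_mul_ae hω _ hr⟩
  refine eq_zero_of_inner_expVec χ fun y => ?_
  obtain ⟨yn, rn, h2, h3⟩ := exists_tendsto_mul_mem hω y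
  have h4 := (((continuous_expVec (μ := μ)).tendsto y).comp h3).inner
    (tendsto_const_nhds (x := χ)) (𝕜 := ℂ)
  exact tendsto_nhds_unique h4 (tendsto_const_nhds.congr fun n => (h1 ⟨(yn n, rn n), h2 n⟩).symm)

/-! ### Field operators on exponential vectors -/

theorem annihilation_graph (f : OneBoson μ) : (annihilation f).graph =
    (expGraph (fun g => ⟪f, g⟫_ℂ) fun g => g).topologicalClosure := by
  rw [annihilation, ← (ann_closable f).1.graph_closure_eq_closure_graph, (ann_closable f).2]

theorem expVec_mem_annihilation_graph (f y : OneBoson μ) :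
    (expVec y, ⟪f, y⟫_ℂ • expVec y) ∈ (annihilation f).graph := by
  rw [annihilation_graph]
  exact Submodule.le_topologicalClosure _ (Submodule.subset_span ⟨y, rfl⟩)

theorem dense_annihilation_domain (f : OneBoson μ) :
    Dense ((annihilation f).domain : Set (Fock μ)) := by
  refine dense_span_expVec.mono ?_
  rw [SetLike.coe_subset_coe, Submodule.span_le]
  rintro _ ⟨g, rfl⟩
  exact LinearPMap.mem_domain_of_mem_graph (expVec_mem_annihilation_graph f g)

/-- The relation defines a closed subspace of the product space, so it is enough to verify it on
exponential vectors, where both sides are explicit. -/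
theorem inner_dExp_annihilation (f y : OneBoson μ) {p : Fock μ × Fock μ}
    (hp : p ∈ (annihilation f).graph) : ⟪dExp y f, p.1⟫_ℂ = ⟪expVec y, p.2⟫_ℂ := by
  rw [annihilation_graph] at hp
  have hcl : IsClosed {p : Fock μ × Fock μ | ⟪dExp y f, p.1⟫_ℂ = ⟪expVec y, p.2⟫_ℂ} :=
    isClosed_eq (by fun_prop) (by fun_prop)
  refine closure_minimal (fun q hq => ?_) hcl hp
  change ⟪dExp y f, q.1⟫_ℂ = ⟪expVec y, q.2⟫_ℂ
  have hq' : q ∈ Submodule.span ℂ (Set.range fun g => (expVec g, ⟪f, g⟫_ℂ • expVec g)) := hq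
  clear hq hp
  induction hq' using Submodule.span_induction with
  | zero => exact (inner_zero_right _).trans (inner_zero_right _).symm
  | add x z _ _ hx hz =>
    exact (inner_add_right _ _ _).trans ((congrArg₂ _ hx hz).trans (inner_add_right _ _ _).symm)
  | smul c x _ hx =>
    exact (inner_smul_right _ _ _).trans ((congrArg _ hx).trans (inner_smul_right _ _ _).symm)
  | mem x hx =>
    obtain ⟨g, rfl⟩ := hx
    change ⟪dExp y f, expVec g⟫_ℂ = ⟪expVec y, ⟪f, g⟫_ℂ • expVec g⟫_ℂ
    rw [inner_smul_right, inner_dExp_expVec, inner_expVec]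

/-- a†(f)ε(y) is the derivative of ε at y in the direction f. -/
theorem expVec_mem_creation_graph (f y : OneBoson μ) :
    (expVec y, dExp y f) ∈ (creation f).graph := by
  have h : ∀ x : (annihilation f).domain,
      ⟪dExp y f, (x : Fock μ)⟫_ℂ = ⟪expVec y, annihilation f x⟫_ℂ := fun x =>
    inner_dExp_annihilation f y ((annihilation f).mem_graph x)
  have hm : expVec y ∈ (creation f).domain :=
    LinearPMap.mem_adjoint_domain_of_exists _ ⟨_, h⟩
  have he : creation f ⟨expVec y, hm⟩ = dExp y f :=
    LinearPMap.adjoint_apply_eq (dense_annihilation_domain f) ⟨expVec y, hm⟩ h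
  exact (LinearPMap.mem_graph_iff _).2 ⟨⟨expVec y, hm⟩, rfl, he⟩

theorem expVec_mem_sum_graph (f y : OneBoson μ) :
    (expVec y, ⟪f, y⟫_ℂ • expVec y + dExp y f) ∈ (annihilation f + creation f).graph :=
  (mem_add_graph _ _ _).2 ⟨_, _, expVec_mem_annihilation_graph f y,
    expVec_mem_creation_graph f y, rfl⟩

theorem isClosable_annihilation_add_creation (f : OneBoson μ) :
    (annihilation f + creation f).IsClosable := by
  refine isClosable_of_symm ?_ (symm_add_adjoint (dense_annihilation_domain f))
  refine dense_span_expVec.mono ?_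
  rw [SetLike.coe_subset_coe, Submodule.span_le]
  rintro _ ⟨g, rfl⟩
  exact LinearPMap.mem_domain_of_mem_graph (expVec_mem_sum_graph f g)

theorem field_graph (f : OneBoson μ) :
    (field f).graph = (annihilation f + creation f).graph.topologicalClosure :=
  (isClosable_annihilation_add_creation f).graph_closure_eq_closure_graph.symm

theorem expVec_mem_field_graph (f y : OneBoson μ) :
    (expVec y, ⟪f, y⟫_ℂ • expVec y + dExp y f) ∈ (field f).graph := by
  rw [field_graph]
  exact Submodule.le_topologicalClosure _ (expVec_mem_sum_graph f y)

theorem isClosed_field_graph (f : OneBoson μ) :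
    IsClosed ((field f).graph : Set (Fock μ × Fock μ)) := by
  rw [field_graph]
  exact Submodule.isClosed_topologicalClosure _

end SecondQuantization

/-! ### Extension of relations from a core; unitary conjugation and completing the square. -/

section Abstract

variable {H : Type*} [NormedAddCommGroup H] [InnerProductSpace ℂ H]

theorem HasRes.isClosed_graph {T : H →ₗ.[ℂ] H} {c : ℝ} {A : H →L[ℂ] H} (h : HasRes T c A) :
    IsClosed (T.graph : Set (H × H)) := by
  have : (T.graph : Set (H × H)) = {p | A (p.2 + (c : ℂ) • p.1) = p.1} := Set.ext h.2
  rw [this]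
  exact isClosed_eq (by fun_prop) (by fun_prop)

/-- If `n` is relatively bounded with respect to `d` on a core, closed relations extend from the
core to the domain. -/
theorem HasRes.exists_extension [CompleteSpace H] {T : H →ₗ.[ℂ] H} {c : ℝ} {A : H →L[ℂ] H}
    (h : HasRes T c A) {ι : Type*} {e d n : ι → H} (he : ∀ i, (e i, d i) ∈ T.graph)
    (htot : ∀ χ, (∀ i, ⟪d i + (c : ℂ) • e i, χ⟫_ℂ = 0) → χ = 0) {K : ℝ} (hK : 0 ≤ K)
    (hb : ∀ a : ι →₀ ℂ, ‖Finsupp.linearCombination ℂ n a‖ ≤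
      K * (‖Finsupp.linearCombination ℂ e a‖ + ‖Finsupp.linearCombination ℂ d a‖))
    {p : H × H} (hp : p ∈ T.graph) :
    ∃ ζ, ∀ S : Submodule ℂ (H × H × H), IsClosed (S : Set (H × H × H)) →
      (∀ i, (e i, d i, n i) ∈ S) → (p.1, p.2, ζ) ∈ S := by
  -- The span of the (T + c)eᵢ is dense. Approximating (T + c)p there and applying the bounded A
  -- gives convergence in the graph norm of T.
  have hd := dense_range_linearCombination htot
  obtain ⟨u, hu⟩ := mem_closure_iff_seq_limit.1 (hd (p.2 + (c : ℂ) • p.1))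
  obtain ⟨hu1, hu2⟩ := hu
  choose a ha using hu1
  have hA : ∀ a : ι →₀ ℂ, A (Finsupp.linearCombination ℂ (fun i => d i + (c : ℂ) • e i) a) =
      Finsupp.linearCombination ℂ e a := by
    intro a
    have h1 : ∀ i, A (d i + (c : ℂ) • e i) = e i := fun i => (h.2 _).1 (he i)
    simp only [Finsupp.linearCombination_apply, Finsupp.sum, map_sum, map_smul, h1]
  have hsum : ∀ a : ι →₀ ℂ, Finsupp.linearCombination ℂ (fun i => d i + (c : ℂ) • e i) a =
      Finsupp.linearCombination ℂ d a + (c : ℂ) • Finsupp.linearCombination ℂ e a := by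
    intro a
    simp only [Finsupp.linearCombination_apply, Finsupp.sum, Finset.smul_sum,
      ← Finset.sum_add_distrib, smul_add, smul_comm (c : ℂ)]
  have hE : Tendsto (fun k => Finsupp.linearCombination ℂ e (a k)) atTop (𝓝 p.1) := by
    have := (A.continuous.tendsto _).comp hu2
    rw [(h.2 p).1 hp] at this
    exact this.congr fun k => by rw [Function.comp_apply, ← ha, hA]
  have hD : Tendsto (fun k => Finsupp.linearCombination ℂ d (a k)) atTop (𝓝 p.2) := by
    have := hu2.sub (hE.const_smul (c : ℂ))
    rw [add_sub_cancel_right] at this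
    exact this.congr fun k => by rw [← ha, hsum, add_sub_cancel_right]
  have hN : CauchySeq fun k => Finsupp.linearCombination ℂ n (a k) := by
    rw [Metric.cauchySeq_iff']
    intro ε hε
    obtain ⟨N1, h1⟩ := Metric.cauchySeq_iff'.1 hE.cauchySeq (ε / (2 * (K + 1))) (by positivity)
    obtain ⟨N2, h2⟩ := Metric.cauchySeq_iff.1 hD.cauchySeq (ε / (2 * (K + 1))) (by positivity)
    obtain ⟨N1, h1⟩ := Metric.cauchySeq_iff.1 hE.cauchySeq (ε / (2 * (K + 1))) (by positivity)
    refine ⟨max N1 N2, fun k hk => ?_⟩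
    have e1 := h1 k (le_trans (le_max_left _ _) hk) (max N1 N2) (le_max_left _ _)
    have e2 := h2 k (le_trans (le_max_right _ _) hk) (max N1 N2) (le_max_right _ _)
    rw [dist_eq_norm, ← map_sub] at e1 e2 ⊢
    refine (hb _).trans_lt ?_
    have h3 : (K + 1) * (ε / (2 * (K + 1)) + ε / (2 * (K + 1))) = ε := by field_simp; ring
    rw [← h3]
    refine mul_lt_mul' (by linarith) (add_lt_add e1 e2) (by positivity) (by linarith)
  obtain ⟨ζ, hζ⟩ := cauchySeq_tendsto_of_complete hN
  refine ⟨ζ, fun S hS hi => ?_⟩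
  -- Quantifying over all closed subspaces S lets several relations, here membership in two
  -- different graphs, hold for one and the same ζ.
  refine hS.mem_of_tendsto (hE.prodMk_nhds (hD.prodMk_nhds hζ)) (.of_forall fun k => ?_)
  have : (Finsupp.linearCombination ℂ e (a k), Finsupp.linearCombination ℂ d (a k),
      Finsupp.linearCombination ℂ n (a k)) = ∑ i ∈ (a k).support, a k i • (e i, d i, n i) := by
    simp only [Finsupp.linearCombination_apply, Finsupp.sum]
    ext <;> simp [Prod.fst_sum, Prod.snd_sum]
  rw [this]
  exact S.sum_mem fun i _ => S.smul_mem _ (hi i)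

/-- Completing the square: if `T + x Φ + κ` agrees with `W(x)* T W(x)` on a core of `T`, for both
signs `x`, then these operators coincide. -/
theorem HasRes.mem_graph_iff_conj [CompleteSpace H] {T Φ : H →ₗ.[ℂ] H} {c : ℝ} {A : H →L[ℂ] H}
    (h : HasRes T c A) (hΦ : IsClosed (Φ.graph : Set (H × H))) (W : ℤˣ → H →ₗᵢ[ℂ] H)
    (hW : ∀ x ψ, W (-x) (W x ψ) = ψ) {ι : Type*} {e d n : ι → H} {κ : ℂ}
    (he : ∀ i, (e i, d i) ∈ T.graph)
    (htot : ∀ χ, (∀ i, ⟪d i + (c : ℂ) • e i, χ⟫_ℂ = 0) → χ = 0) {K : ℝ} (hK : 0 ≤ K)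
    (hb : ∀ a : ι →₀ ℂ, ‖Finsupp.linearCombination ℂ n a‖ ≤
      K * (‖Finsupp.linearCombination ℂ e a‖ + ‖Finsupp.linearCombination ℂ d a‖))
    (hn : ∀ i, (e i, n i) ∈ Φ.graph)
    (hθ : ∀ (x : ℤˣ) i, (W x (e i), W x (d i + ((x : ℤ) : ℂ) • n i + κ • e i)) ∈ T.graph)
    (x : ℤˣ) (p : H × H) :
    p ∈ (T + ((x : ℤ) : ℂ) • Φ + (κ • (LinearMap.id : H →ₗ[ℂ] H)).toPMap ⊤).graph ↔
      (W x p.1, W x p.2) ∈ T.graph := by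
  -- Relative boundedness gives one inclusion, for both signs x: the conjugated operator extends T +
  -- xΦ + κ.
  have key : ∀ (x : ℤˣ), ∀ p ∈ T.graph, ∃ ζ, (p.1, ζ) ∈ Φ.graph ∧
      (W x p.1, W x (p.2 + ((x : ℤ) : ℂ) • ζ + κ • p.1)) ∈ T.graph := by
    intro x p hp
    obtain ⟨ζ, hζ⟩ := h.exists_extension he htot hK hb hp
    refine ⟨ζ, ?_, ?_⟩
    · let L : H × H × H →L[ℂ] H × H := (ContinuousLinearMap.fst ℂ H (H × H)).prod
        ((ContinuousLinearMap.snd ℂ H H).comp (ContinuousLinearMap.snd ℂ H (H × H)))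
      exact hζ (Φ.graph.comap L.toLinearMap) (hΦ.preimage L.continuous) hn
    · let L : H × H × H →L[ℂ] H × H :=
        ((W x).toContinuousLinearMap.comp (ContinuousLinearMap.fst ℂ H (H × H))).prod
        ((W x).toContinuousLinearMap.comp
          ((ContinuousLinearMap.fst ℂ H H).comp (ContinuousLinearMap.snd ℂ H (H × H)) +
            ((x : ℤ) : ℂ) •
              (ContinuousLinearMap.snd ℂ H H).comp (ContinuousLinearMap.snd ℂ H (H × H)) +
            κ • ContinuousLinearMap.fst ℂ H (H × H)))
      exact hζ (T.graph.comap L.toLinearMap) (h.isClosed_graph.preimage L.continuous) (hθ x)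
  constructor
  · intro hp
    obtain ⟨η, η₃, h1, h3, h4⟩ := (mem_add_graph _ _ _).1 hp
    obtain ⟨η₁, η₂, h5, h6, h7⟩ := (mem_add_graph _ _ _).1 h1
    obtain ⟨ζ', h8, h9⟩ := (mem_smul_graph _ _ _).1 h6
    rw [mem_smul_id_graph] at h3
    obtain ⟨ζ, hζ1, hζ2⟩ := key x _ h5
    have h10 : ζ = ζ' := Φ.mem_graph_snd_inj' hζ1 h8 rfl
    simp only at h3 h7 h9 hζ2
    rw [h4, h7, h9, h3, ← h10]
    exact hζ2
  · intro hp
    -- The reverse inclusion uses the opposite sign: W(-x) maps the domain of T into itself and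
    -- inverts W(x).
    have h1 : p.1 ∈ T.domain := by
      obtain ⟨ζ, -, h2⟩ := key (-x) _ hp
      have := LinearPMap.mem_domain_of_mem_graph h2
      rwa [hW] at this
    obtain ⟨ζ, hζ1, hζ2⟩ := key x _ (T.mem_graph ⟨p.1, h1⟩)
    simp only at hζ1 hζ2
    have h2 : p.2 = T ⟨p.1, h1⟩ + ((x : ℤ) : ℂ) • ζ + κ • p.1 :=
      (W x).injective (T.mem_graph_snd_inj' hp hζ2 rfl)
    have h3 : (p.1, κ • p.1) ∈ ((κ • (LinearMap.id : H →ₗ[ℂ] H)).toPMap ⊤).graph :=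
      (mem_smul_id_graph _ _).2 rfl
    have h4 : (p.1, ((x : ℤ) : ℂ) • ζ) ∈ (((x : ℤ) : ℂ) • Φ).graph :=
      (mem_smul_graph _ _ _).2 ⟨ζ, hζ1, rfl⟩
    have h5 : (p.1, T ⟨p.1, h1⟩ + ((x : ℤ) : ℂ) • ζ) ∈ (T + ((x : ℤ) : ℂ) • Φ).graph :=
      (mem_add_graph _ _ _).2 ⟨_, _, T.mem_graph ⟨p.1, h1⟩, h4, rfl⟩
    exact (mem_add_graph _ _ _).2 ⟨_, _, h5, h3, h2⟩

theorem smul_mem_graph_iff (T : H →ₗ.[ℂ] H) {a : ℂ} (ha : a ≠ 0) (ψ η : H) :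
    (a • ψ, a • η) ∈ T.graph ↔ (ψ, η) ∈ T.graph := by
  have : (a • ψ, a • η) = a • (ψ, η) := rfl
  rw [this, Submodule.smul_mem_iff _ ha]

/-- Conjugating an operator by a unitary conjugates its resolvent. -/
theorem HasRes.conj {T T' : H →ₗ.[ℂ] H} {c : ℝ} {A : H →L[ℂ] H} (h : HasRes T c A)
    {U V : H →ₗᵢ[ℂ] H} (hVU : ∀ ψ, V (U ψ) = ψ) (hUV : ∀ ψ, U (V ψ) = ψ)
    (hT' : ∀ p : H × H, p ∈ T'.graph ↔ (U p.1, U p.2) ∈ T.graph) :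
    HasRes T' c (V.toContinuousLinearMap ∘L A ∘L U.toContinuousLinearMap) := by
  have hadj : ∀ ψ χ, ⟪V ψ, χ⟫_ℂ = ⟪ψ, U χ⟫_ℂ := fun ψ χ => by
    rw [← U.inner_map_map, hUV]
  have hadj' : ∀ ψ χ, ⟪U ψ, χ⟫_ℂ = ⟪ψ, V χ⟫_ℂ := fun ψ χ => by
    rw [← V.inner_map_map, hVU]
  refine ⟨fun ψ χ => ?_, fun p => ?_⟩
  · change ⟪V (A (U ψ)), χ⟫_ℂ = ⟪ψ, V (A (U χ))⟫_ℂ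
    rw [hadj, h.1, hadj']
  · rw [hT', h.2]
    change A (U p.2 + (c : ℂ) • U p.1) = U p.1 ↔ V (A (U (p.2 + (c : ℂ) • p.1))) = p.1
    rw [map_add U, map_smul U]
    constructor
    · intro h1; rw [h1, hVU]
    · intro h1; rw [← hUV (A _), h1]

/-- Pure algebra of completing the square on one exponential vector: the hypothesis `h` says that
the scalars produced by the shift cancel against κ and the annihilation part. -/
theorem map_square_mem_graph {T : H →ₗ.[ℂ] H} {W : H →ₗᵢ[ℂ] H} {e e' d₁ d₂ d₁' d₂' : H}
    {C a₁ a₂ s b κ : ℂ} (hC : C ≠ 0) (he : W e = C • e') (h₁ : W d₁ = C • (d₁' - a₁ • e'))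
    (h₂ : W d₂ = C • (d₂' - a₂ • e')) (h : κ + s * b = a₁ + s * a₂)
    (hm : (e', d₁' + s • d₂') ∈ T.graph) :
    (W e, W (d₁ + s • (b • e + d₂) + κ • e)) ∈ T.graph := by
  have : W (d₁ + s • (b • e + d₂) + κ • e) = C • (d₁' + s • d₂') := by
    obtain rfl : κ = a₁ + s * a₂ - s * b := by rw [← h]; ring
    simp only [map_add, map_smul, he, h₁, h₂]
    module
  rw [this, he]
  exact (smul_mem_graph_iff T hC _ _).2 hm

theorem inner_smul_sub_smul (z a b : H) (c s : ℂ) :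
    ⟪z, c • (a - s • b)⟫_ℂ = c * (⟪z, a⟫_ℂ - s * ⟪z, b⟫_ℂ) := by
  rw [inner_smul_right, inner_sub_right, inner_smul_right]

theorem map_map_eq_smul {W₁ W₂ W₃ : H →ₗᵢ[ℂ] H} {e e' e'' : H} {a b c k : ℂ}
    (h₂ : W₂ e = a • e') (h₁ : W₁ e' = b • e'') (h₃ : W₃ e = c • e'') (hk : a * b = k * c) :
    W₁ (W₂ e) = k • W₃ e := by
  rw [h₂, map_smul, h₁, h₃, smul_smul, smul_smul, hk]

theorem mem_opComp_opComp_graph {S L R : H →ₗ.[ℂ] H} {U V : H →ₗᵢ[ℂ] H}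
    (hS : ∀ p : H × H, p ∈ S.graph ↔ p.2 = V p.1) (hR : ∀ p : H × H, p ∈ R.graph ↔ p.2 = U p.1)
    (hVU : ∀ ψ, V (U ψ) = ψ) (hUV : ∀ ψ, U (V ψ) = ψ) (p : H × H) :
    p ∈ (opComp S (opComp L R)).graph ↔ (U p.1, U p.2) ∈ L.graph := by
  rw [mem_opComp_graph]
  constructor
  · rintro ⟨η, h2, h3⟩
    obtain ⟨ξ, h4, h5⟩ := (mem_opComp_graph _ _ _).1 h2
    have h6 := (hR _).1 h4
    have h7 := (hS _).1 h3
    simp only at h6 h7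
    rw [h7, ← h6, hUV]
    exact h5
  · intro h2
    exact ⟨_, (mem_opComp_graph _ _ _).2 ⟨_, (hR _).2 rfl, h2⟩, (hS _).2 (hVU _).symm⟩

/-- A Weyl product equals a single Weyl operator up to a phase, and graphs are invariant under
nonzero scalars. -/
theorem map_map_mem_graph_iff {T : H →ₗ.[ℂ] H} {W₁ W₂ W : H →ₗᵢ[ℂ] H} {a : ℂ} (ha : a ≠ 0)
    (h : ∀ ψ, W₁ (W₂ ψ) = a • W ψ) (p : H × H) :
    (W₁ (W₂ p.1), W₁ (W₂ p.2)) ∈ T.graph ↔ (W p.1, W p.2) ∈ T.graph := by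
  rw [h, h, smul_mem_graph_iff T ha]

end Abstract

/-! ### The field operator as a perturbation of dΓ(ω), and the van Hove Hamiltonian as its Weyl
transform. -/

section VanHove

variable {M : Type*} [MeasurableSpace M] {μ : Measure M} [SigmaFinite μ] {ω : M → ℝ}

attribute [local irreducible] expVec weylU onePart onePartL semi res

/-- Weyl operators shift creation operators: W(k)a†(r) = (a†(r) - ⟨k,r⟩)W(k), evaluated at ε(h). -/
theorem weylU_dExp (k h r : OneBoson μ) : weylU k (dExp h r) =
    Complex.exp (-(‖k‖ ^ 2 / 2 : ℝ) - ⟪k, h⟫_ℂ) •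
      (dExp (k + h) r - ⟪k, r⟫_ℂ • expVec (k + h)) := by
  refine eq_of_inner_expVec fun z => ?_
  have h1 : ⟪weylU (-k) (expVec z), dExp h r⟫_ℂ = ⟪expVec z, weylU k (dExp h r)⟫_ℂ := by
    rw [inner_weylU_left, neg_neg]
  refine h1.symm.trans (((congrArg (fun ξ => ⟪ξ, dExp h r⟫_ℂ) (weylU_expVec (-k) z)).trans
    (inner_smul_left _ _ _)).trans (Eq.trans ?_ (inner_smul_sub_smul _ _ _ _ _).symm))
  rw [inner_expVec_dExp, inner_expVec_dExp, inner_expVec, ← Complex.exp_conj]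
  simp only [map_sub, map_neg, Complex.conj_ofReal, inner_conj_symm, inner_add_left,
    inner_neg_left, inner_neg_right, inner_add_right, norm_neg]
  have h2 : Complex.exp (-((‖k‖ ^ 2 / 2 : ℝ) : ℂ) - -⟪z, k⟫_ℂ) * Complex.exp (-⟪k, h⟫_ℂ + ⟪z, h⟫_ℂ) =
      Complex.exp (-((‖k‖ ^ 2 / 2 : ℝ) : ℂ) - ⟪k, h⟫_ℂ) * Complex.exp (⟪z, k⟫_ℂ + ⟪z, h⟫_ℂ) := by
    rw [← Complex.exp_add, ← Complex.exp_add]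
    congr 1
    ring
  linear_combination (⟪z, r⟫_ℂ - ⟪k, r⟫_ℂ) * h2

theorem inner_mul_ae {w : M → ℝ} {f f' g g' : OneBoson μ} (hf : f' =ᵐ[μ] fun k => (w k : ℂ) * f k)
    (hg : g' =ᵐ[μ] fun k => (w k : ℂ) * g k) : ⟪f', g⟫_ℂ = ⟪f, g'⟫_ℂ := by
  rw [L2.inner_def, L2.inner_def]
  refine integral_congr_ae ?_
  filter_upwards [hf, hg] with k h1 h2
  rw [h1, h2]
  simp only [RCLike.inner_apply, map_mul, Complex.conj_ofReal]
  ring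

/-- √ω ≤ 1 + ω, so |√ω y| is dominated by |y| + |ωy|. -/
theorem exists_sqrt_mul (hω : Measurable ω) (hω0 : ∀ k, 0 ≤ ω k) (p : MulGraph μ ω) :
    ∃ z : OneBoson μ, z =ᵐ[μ] fun k => (Real.sqrt (ω k) : ℂ) * p.1.1 k := by
  obtain ⟨⟨y, r⟩, hr⟩ := p
  have hm : MemLp (fun k => (Real.sqrt (ω k) : ℂ) * y k) 2 μ := by
    refine MemLp.mono' (g := fun k => ‖y k‖ + ‖r k‖) ((Lp.memLp y).norm.add (Lp.memLp r).norm)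
      ((Complex.measurable_ofReal.comp (Real.continuous_sqrt.measurable.comp
        hω)).aestronglyMeasurable.mul (Lp.aestronglyMeasurable y)) ?_
    filter_upwards [hr] with k hk
    rw [hk, norm_mul, norm_mul, Complex.norm_real, Complex.norm_real,
      Real.norm_of_nonneg (Real.sqrt_nonneg _), Real.norm_of_nonneg (hω0 k)]
    have : Real.sqrt (ω k) ≤ 1 + ω k := by
      rw [Real.sqrt_le_left (by linarith [hω0 k])]; nlinarith [hω0 k]
    nlinarith [norm_nonneg (y k)]
  exact ⟨hm.toLp _, hm.coeFn_toLp⟩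

/-- The relative bound of the field operator with respect to `dΓ(ω)`. -/
theorem norm_linearCombination_field_le (hω : Measurable ω) (hω0 : ∀ k, 0 ≤ ω k)
    {ρ γ : OneBoson μ} (hρ : ρ =ᵐ[μ] fun k => (Real.sqrt (ω k) : ℂ) * γ k)
    (a : MulGraph μ ω →₀ ℂ) :
    ‖Finsupp.linearCombination ℂ
        (fun p : MulGraph μ ω => ⟪ρ, p.1.1⟫_ℂ • expVec p.1.1 + dExp p.1.1 ρ) a‖ ≤
      (2 * ‖γ‖ + ‖ρ‖) *
        (‖Finsupp.linearCombination ℂ (fun p : MulGraph μ ω => expVec p.1.1) a‖ +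
          ‖Finsupp.linearCombination ℂ (fun p : MulGraph μ ω => dExp p.1.1 p.1.2) a‖) := by
  choose z hz using exists_sqrt_mul (μ := μ) hω hω0
  have hinner (p q : MulGraph μ ω) : ⟪z p, z q⟫_ℂ = ⟪p.1.1, q.1.2⟫_ℂ := by
    refine inner_mul_ae (w := fun k => Real.sqrt (ω k)) (hz p) ?_
    filter_upwards [hz q, q.2] with k h1 h2
    rw [h1, h2, ← mul_assoc, ← Complex.ofReal_mul, Real.mul_self_sqrt (hω0 k)]
  -- The vector z ⊗ ε(y) with z = √ω y stands for the function k ↦ √ω(k)a(k)ε(y). The map ξ ↦ γ ⊗ ξ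
  -- has norm ‖γ‖ and turns it back into a(ρ), as ρ = √ω γ.
  have h := norm_linearCombination_le (H := Fock μ) (K := TensorProduct ℂ (OneBoson μ) (Fock μ))
    (e := fun p : MulGraph μ ω => expVec p.1.1) (d := fun p => dExp p.1.1 p.1.2)
    (a := fun p => ⟪ρ, p.1.1⟫_ℂ • expVec p.1.1) (b := fun p => dExp p.1.1 ρ)
    (z := fun p => z p ⊗ₜ[ℂ] expVec p.1.1) (κ := ‖γ‖) (s := ‖ρ‖) (norm_nonneg _) (norm_nonneg _)
    (fun ξ => γ ⊗ₜ[ℂ] ξ) (fun ξ => (TensorProduct.norm_tmul γ ξ).le)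
    (fun p q => by
      rw [TensorProduct.inner_tmul, inner_expVec_dExp, hinner, inner_expVec])
    (fun ξ p => by
      rw [TensorProduct.inner_tmul, inner_smul_right,
        inner_mul_ae (w := fun k => Real.sqrt (ω k)) hρ (hz p)])
    (fun p q => by
      rw [inner_dExp_dExp, inner_smul_left, inner_smul_right, inner_expVec, inner_self_eq,
        inner_conj_symm]
      push_cast; ring) a
  refine le_trans (le_of_eq (congrArg _ ?_)) h
  simp only [Finsupp.linearCombination_apply, Finsupp.sum, smul_add, Finset.sum_add_distrib]

theorem intUnit_cast_mul_self (x : ℤˣ) : ((x : ℤ) : ℂ) * ((x : ℤ) : ℂ) = 1 := by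
  rcases Int.units_eq_one_or x with rfl | rfl <;> simp

theorem conj_intCast (n : ℤ) : (starRingEnd ℂ) (n : ℂ) = n := map_intCast _ n

/-- For k = xg one has ωk = xρ, so shifting the argument by k creates the term x a†(ρ). The scalars
match because ⟨k, ωy⟩ = x⟨ρ, y⟩ and x⟨k, ρ⟩ = ‖γ‖². -/
theorem weylU_square_mem_graph (hω : Measurable ω) (hω0 : ∀ k, 0 ≤ ω k) {g ρ γ : OneBoson μ}
    (hγ : γ =ᵐ[μ] fun k => (Real.sqrt (ω k) : ℂ) * g k)
    (hg : ρ =ᵐ[μ] fun k => (ω k : ℂ) * g k)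
    (hρ : ρ =ᵐ[μ] fun k => (Real.sqrt (ω k) : ℂ) * γ k) (x : ℤˣ) (p : MulGraph μ ω) :
    (weylU (((x : ℤ) : ℂ) • g) (expVec p.1.1), weylU (((x : ℤ) : ℂ) • g) (dExp p.1.1 p.1.2 +
      ((x : ℤ) : ℂ) • (⟪ρ, p.1.1⟫_ℂ • expVec p.1.1 + dExp p.1.1 ρ) +
        ((‖γ‖ ^ 2 : ℝ) : ℂ) • expVec p.1.1)) ∈ (dGamma μ ω).graph := by
  obtain ⟨⟨y, r⟩, hr⟩ := p
  simp only at hr ⊢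
  set k := ((x : ℤ) : ℂ) • g with hk
  have h1 : ⟪g, r⟫_ℂ = ⟪ρ, y⟫_ℂ := (inner_mul_ae (w := ω) hg hr).symm
  have h2 : ⟪g, ρ⟫_ℂ = ((‖γ‖ ^ 2 : ℝ) : ℂ) := by
    rw [← inner_self_eq]
    exact (inner_mul_ae (w := fun k => Real.sqrt (ω k)) hγ hρ).symm
  refine map_square_mem_graph (κ := ((‖γ‖ ^ 2 : ℝ) : ℂ)) (s := ((x : ℤ) : ℂ)) (b := ⟪ρ, y⟫_ℂ)
    (Complex.exp_ne_zero _) (weylU_expVec k y) (weylU_dExp k y r) (weylU_dExp k y ρ) (by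
      rw [hk, inner_smul_left, inner_smul_left, conj_intCast, h1, h2, ← mul_assoc,
        intUnit_cast_mul_self]
      ring) ?_
  have h4 : dExp (k + y) r + ((x : ℤ) : ℂ) • dExp (k + y) ρ =
      dExp (k + y) (r + ((x : ℤ) : ℂ) • ρ) := by rw [map_add, map_smul]
  rw [h4]
  refine expVec_mem_dGamma_graph hω hω0 ?_
  filter_upwards [hr, hg, Lp.coeFn_add r (((x : ℤ) : ℂ) • ρ), Lp.coeFn_add k y,
    Lp.coeFn_smul ((x : ℤ) : ℂ) ρ, Lp.coeFn_smul ((x : ℤ) : ℂ) g] with q e1 e2 e3 e4 e5 e6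
  rw [e3, e4, Pi.add_apply, Pi.add_apply, e5, hk, e6, Pi.smul_apply, Pi.smul_apply, e1, e2]
  simp only [smul_eq_mul]; ring

theorem mem_square_graph_iff (hω : Measurable ω) (hω0 : ∀ k, 0 ≤ ω k) {g ρ γ : OneBoson μ}
    (hγ : γ =ᵐ[μ] fun k => (Real.sqrt (ω k) : ℂ) * g k)
    (hg : ρ =ᵐ[μ] fun k => (ω k : ℂ) * g k)
    (hρ : ρ =ᵐ[μ] fun k => (Real.sqrt (ω k) : ℂ) * γ k) (x : ℤˣ) (p : Fock μ × Fock μ) :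
    p ∈ (dGamma μ ω + ((x : ℤ) : ℂ) • field ρ + (((‖γ‖ ^ 2 : ℝ) : ℂ) •
      (LinearMap.id : Fock μ →ₗ[ℂ] Fock μ)).toPMap ⊤).graph ↔
      (weylU (((x : ℤ) : ℂ) • g) p.1, weylU (((x : ℤ) : ℂ) • g) p.2) ∈ (dGamma μ ω).graph :=
  (hasRes_dGamma hω hω0 le_rfl).mem_graph_iff_conj (isClosed_field_graph ρ)
    (fun x => weylU (((x : ℤ) : ℂ) • g))
    (fun x ψ => by
      have := weylU_neg_weylU (((x : ℤ) : ℂ) • g) ψ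
      rw [← neg_smul] at this
      push_cast
      exact this)
    (fun p : MulGraph μ ω => expVec_mem_dGamma_graph hω hω0 p.2)
    (eq_zero_of_inner_dGamma hω hω0 le_rfl)
    (by positivity : (0 : ℝ) ≤ 2 * ‖γ‖ + ‖ρ‖)
    (norm_linearCombination_field_le hω hω0 hρ)
    (fun p => expVec_mem_field_graph ρ p.1.1)
    (weylU_square_mem_graph hω hω0 hγ hg hρ) x p

/-- The Weyl relation; the exponent is purely imaginary, so the factor is a phase. -/
theorem weylU_weylU (f g : OneBoson μ) (ψ : Fock μ) :
    weylU g (weylU f ψ) =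
      Complex.exp (((RCLike.re ⟪g, f⟫_ℂ : ℝ) : ℂ) - ⟪g, f⟫_ℂ) • weylU (g + f) ψ := by
  have : (weylU g).toContinuousLinearMap.comp (weylU f).toContinuousLinearMap =
      Complex.exp (((RCLike.re ⟪g, f⟫_ℂ : ℝ) : ℂ) - ⟪g, f⟫_ℂ) •
        (weylU (g + f)).toContinuousLinearMap := by
    refine ext_expVec fun z => ?_
    refine map_map_eq_smul (weylU_expVec f z) (weylU_expVec g (f + z))
      ((weylU_expVec (g + f) z).trans (by rw [add_assoc])) ?_
    rw [← Complex.exp_add, ← Complex.exp_add]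
    congr 1
    rw [@norm_add_sq ℂ, inner_add_left, inner_add_right]
    push_cast
    ring
  exact DFunLike.congr_fun this ψ

/-- The vector g that completes the square is reg/ω. It is square integrable as the difference of
v/ω and uv/ω; this is where infrared regularity of v enters. -/
theorem Decomposition.exists_square (hωpos : ∀ᵐ k ∂μ, 0 < ω k) {v : M → ℂ}
    (d : Decomposition μ ω v) {f : OneBoson μ} (hf : f =ᵐ[μ] fun k => v k / (ω k : ℂ)) :
    ∃ g γ : OneBoson μ, (γ =ᵐ[μ] fun k => (Real.sqrt (ω k) : ℂ) * g k) ∧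
      (d.regL2 =ᵐ[μ] fun k => (ω k : ℂ) * g k) ∧
      (d.regL2 =ᵐ[μ] fun k => (Real.sqrt (ω k) : ℂ) * γ k) ∧
      ∫ k, ‖d.reg k / (Real.sqrt (ω k) : ℂ)‖ ^ 2 ∂μ = ‖γ‖ ^ 2 ∧ g + d.uvL2 = f := by
  set g := f - d.uvL2 with hgdef
  set γ : OneBoson μ := d.reg_mem.2.toLp _ with hγdef
  have hγ0 : γ =ᵐ[μ] fun k => d.reg k / (Real.sqrt (ω k) : ℂ) := d.reg_mem.2.coeFn_toLp
  have hρ0 : d.regL2 =ᵐ[μ] d.reg := d.reg_mem.1.coeFn_toLp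
  have hu0 : d.uvL2 =ᵐ[μ] fun k => d.uv k / (ω k : ℂ) := d.uv_mem.2.coeFn_toLp
  have hsq {k : M} (hk : 0 < ω k) : (Real.sqrt (ω k) : ℂ) ≠ 0 ∧
      (Real.sqrt (ω k) : ℂ) * (Real.sqrt (ω k) : ℂ) = (ω k : ℂ) :=
    ⟨by exact_mod_cast (Real.sqrt_pos.2 hk).ne',
      by rw [← Complex.ofReal_mul, Real.mul_self_sqrt hk.le]⟩
  have hg0 : g =ᵐ[μ] fun k => d.reg k / (ω k : ℂ) := by
    filter_upwards [Lp.coeFn_sub f d.uvL2, hf, hu0, d.sum_eq] with k h1 h2 h3 h4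
    rw [hgdef, h1, Pi.sub_apply, h2, h3, h4]; ring
  have hg : d.regL2 =ᵐ[μ] fun k => (ω k : ℂ) * g k := by
    filter_upwards [hρ0, hg0, hωpos] with k h1 h2 h3
    rw [h1, h2]
    have : (ω k : ℂ) ≠ 0 := by exact_mod_cast h3.ne'
    field_simp
  have hρ : d.regL2 =ᵐ[μ] fun k => (Real.sqrt (ω k) : ℂ) * γ k := by
    filter_upwards [hρ0, hγ0, hωpos] with k h1 h2 h3
    rw [h1, h2]
    have := (hsq h3).1
    field_simp
  have hγ : γ =ᵐ[μ] fun k => (Real.sqrt (ω k) : ℂ) * g k := by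
    filter_upwards [hγ0, hg0, hωpos] with k h1 h2 h3
    rw [h1, h2, ← (hsq h3).2]
    have := (hsq h3).1
    field_simp
  have hκ : ∫ k, ‖d.reg k / (Real.sqrt (ω k) : ℂ)‖ ^ 2 ∂μ = ‖γ‖ ^ 2 := by
    rw [norm_sq_eq_integral]
    refine integral_congr_ae ?_
    filter_upwards [hγ0] with k h1
    rw [h1]
  exact ⟨g, γ, hγ, hg, hρ, hκ, sub_add_cancel _ _⟩

set_option maxHeartbeats 1000000 in
/-- The renormalized van Hove Hamiltonian is a Weyl transform of `dΓ(ω)`. -/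
theorem mem_vanHove_graph_iff (hω : Measurable ω) (hω0 : ∀ k, 0 ≤ ω k)
    (hωpos : ∀ᵐ k ∂μ, 0 < ω k) {v : M → ℂ} (d : Decomposition μ ω v) {f : OneBoson μ}
    (hf : f =ᵐ[μ] fun k => v k / (ω k : ℂ)) (x : ℤˣ) (p : Fock μ × Fock μ) :
    p ∈ (vanHove d x).graph ↔
      (weylU (((x : ℤ) : ℂ) • f) p.1, weylU (((x : ℤ) : ℂ) • f) p.2) ∈ (dGamma μ ω).graph := by
  obtain ⟨g, γ, hγ, hg, hρ, hκ, hsum⟩ := d.exists_square hωpos hf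
  -- The inner conjugation by W(xg) and the outer one by W(x uv/ω) combine, up to a phase, to W(xf),
  -- since g + uv/ω = f.
  have hW : ∀ ψ : Fock μ, weylU (((x : ℤ) : ℂ) • g) (weylU (((x : ℤ) : ℂ) • d.uvL2) ψ) =
      Complex.exp (((RCLike.re ⟪((x : ℤ) : ℂ) • g, ((x : ℤ) : ℂ) • d.uvL2⟫_ℂ : ℝ) : ℂ) -
        ⟪((x : ℤ) : ℂ) • g, ((x : ℤ) : ℂ) • d.uvL2⟫_ℂ) • weylU (((x : ℤ) : ℂ) • f) ψ := by
    intro ψ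
    rw [← hsum, smul_add]
    exact weylU_weylU _ _ ψ
  have h3 := mem_square_graph_iff hω hω0 hγ hg hρ x
    (weylU (((x : ℤ) : ℂ) • d.uvL2) p.1, weylU (((x : ℤ) : ℂ) • d.uvL2) p.2)
  rw [← hκ] at h3
  refine Iff.trans ?_ (h3.trans (map_map_mem_graph_iff (Complex.exp_ne_zero _) hW p))
  exact mem_opComp_opComp_graph
    (mem_weyl_graph_iff (-(((x : ℤ) : ℂ) • d.uvL2)))
    (mem_weyl_graph_iff (((x : ℤ) : ℂ) • d.uvL2)) (weylU_neg_weylU _) (weylU_weylU_neg _) p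

end VanHove

/-! ### Bounded perturbation of a resolvent -/

section Perturbation

variable {H : Type*} [NormedAddCommGroup H] [InnerProductSpace ℂ H]

/-- `A = (1 - R J)⁻¹ R`. -/
def IsPerturbed (R J A : H →L[ℂ] H) : Prop := ∀ φ, A φ = R (φ + J (A φ))

variable {R J A : H →L[ℂ] H} {c : ℝ}

theorem norm_comp_le (hR : ∀ ψ, ‖R ψ‖ ≤ (c + 1)⁻¹ * ‖ψ‖) (hc : 0 < c) (hJ : ∀ ψ, ‖J ψ‖ ≤ ‖ψ‖)
    (ψ : H) : ‖R (J ψ)‖ ≤ (c + 1)⁻¹ * ‖ψ‖ :=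
  (hR _).trans (mul_le_mul_of_nonneg_left (hJ ψ) (by positivity))

/-- In the application R = (h + c + 1)⁻¹; the extra 1 is the diagonal term of 1 - J. Hence ‖RJ‖ ≤ (c
+ 1)⁻¹ < 1 for every c > 0, and 1 - RJ is invertible. -/
theorem exists_isPerturbed [CompleteSpace H] (hc : 0 < c) (hR : ∀ ψ, ‖R ψ‖ ≤ (c + 1)⁻¹ * ‖ψ‖)
    (hJ : ∀ ψ, ‖J ψ‖ ≤ ‖ψ‖) : ∃ A, IsPerturbed R J A := by
  have hn : ‖R * J‖ < 1 := by
    refine (ContinuousLinearMap.opNorm_le_bound _ (by positivity)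
      (fun ψ => norm_comp_le hR hc hJ ψ)).trans_lt ?_
    exact inv_lt_one_of_one_lt₀ (by linarith)
  have hu := isUnit_one_sub_of_norm_lt_one hn
  refine ⟨Ring.inverse (1 - R * J) * R, fun φ => ?_⟩
  have h := DFunLike.congr_fun (Ring.mul_inverse_cancel _ hu) (R φ)
  change Ring.inverse (1 - R * J) (R φ) - R (J (Ring.inverse (1 - R * J) (R φ))) = R φ at h
  change Ring.inverse (1 - R * J) (R φ) = R (φ + J (Ring.inverse (1 - R * J) (R φ)))
  rw [map_add]
  exact (sub_eq_iff_eq_add.1 h)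

theorem IsPerturbed.unique (hA : IsPerturbed R J A) (hc : 0 < c)
    (hR : ∀ ψ, ‖R ψ‖ ≤ (c + 1)⁻¹ * ‖ψ‖) (hJ : ∀ ψ, ‖J ψ‖ ≤ ‖ψ‖) {φ ψ : H}
    (h : ψ = R (φ + J ψ)) : A φ = ψ := by
  have h1 : A φ - ψ = R (J (A φ - ψ)) := by
    conv_lhs => rw [hA φ, h]
    simp only [map_add, map_sub]
    abel
  have h2 : ‖A φ - ψ‖ ≤ (c + 1)⁻¹ * ‖A φ - ψ‖ := by
    conv_lhs => rw [h1]
    exact norm_comp_le hR hc hJ _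
  have h3 : (c + 1)⁻¹ < 1 := inv_lt_one_of_one_lt₀ (by linarith)
  have h4 : ‖A φ - ψ‖ = 0 := by nlinarith [norm_nonneg (A φ - ψ)]
  exact sub_eq_zero.1 (norm_eq_zero.1 h4)

theorem IsPerturbed.norm_apply_le (hA : IsPerturbed R J A) (hc : 0 < c)
    (hR : ∀ ψ, ‖R ψ‖ ≤ (c + 1)⁻¹ * ‖ψ‖) (hJ : ∀ ψ, ‖J ψ‖ ≤ ‖ψ‖) (φ : H) :
    ‖A φ‖ ≤ c⁻¹ * ‖φ‖ := by
  have h1 : ‖A φ‖ ≤ (c + 1)⁻¹ * (‖φ‖ + ‖A φ‖) := by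
    conv_lhs => rw [hA φ]
    exact (hR _).trans (mul_le_mul_of_nonneg_left
      ((norm_add_le _ _).trans (by gcongr; exact hJ _)) (by positivity))
  rw [inv_mul_eq_div, le_div_iff₀ (by positivity)] at h1
  rw [inv_mul_eq_div, le_div_iff₀ hc]
  linarith

theorem IsPerturbed.symm (hA : IsPerturbed R J A) (hR : ∀ ψ χ, ⟪R ψ, χ⟫_ℂ = ⟪ψ, R χ⟫_ℂ)
    (hJ : ∀ ψ χ, ⟪J ψ, χ⟫_ℂ = ⟪ψ, J χ⟫_ℂ) (φ ξ : H) : ⟪A φ, ξ⟫_ℂ = ⟪φ, A ξ⟫_ℂ := by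
  have h := hR (φ + J (A φ)) (ξ + J (A ξ))
  rw [← hA, ← hA, inner_add_left, inner_add_right, hJ] at h
  exact add_right_cancel h

theorem IsPerturbed.injective (hA : IsPerturbed R J A) (hR : ∀ ψ, R ψ = 0 → ψ = 0) {φ : H}
    (h : A φ = 0) : φ = 0 := by
  have h1 := hA φ
  rw [h, map_zero, add_zero] at h1
  exact hR _ h1.symm

/-- The Neumann iteration. -/
def neumann (R J : H →L[ℂ] H) (φ : H) : ℕ → H
  | 0 => 0
  | n + 1 => R (φ + J (neumann R J φ n))

/-- The iteration starts at 0 and uses only sums, J and R, so it stays in every convex cone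
containing φ that is preserved by J and R; a closed cone then contains Aφ. -/
theorem IsPerturbed.tendsto_neumann (hA : IsPerturbed R J A) (hc : 0 < c)
    (hR : ∀ ψ, ‖R ψ‖ ≤ (c + 1)⁻¹ * ‖ψ‖) (hJ : ∀ ψ, ‖J ψ‖ ≤ ‖ψ‖) (φ : H) :
    Tendsto (neumann R J φ) atTop (𝓝 (A φ)) := by
  have h : ∀ n, ‖neumann R J φ n - A φ‖ ≤ ((c + 1)⁻¹) ^ n * ‖A φ‖ := by
    intro n
    induction n with
    | zero => simp [neumann]
    | succ n ih =>
      have h1 : neumann R J φ (n + 1) - A φ = R (J (neumann R J φ n - A φ)) := by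
        conv_lhs => rw [hA φ, neumann]
        simp only [map_add, map_sub]
        abel
      rw [h1, pow_succ', mul_assoc]
      exact (norm_comp_le hR hc hJ _).trans (mul_le_mul_of_nonneg_left ih (by positivity))
  rw [tendsto_iff_norm_sub_tendsto_zero]
  refine squeeze_zero (fun _ => norm_nonneg _) h ?_
  have := (tendsto_pow_atTop_nhds_zero_of_lt_one (r := (c + 1)⁻¹) (by positivity)
    (inv_lt_one_of_one_lt₀ (by linarith))).mul_const ‖A φ‖
  rwa [zero_mul] at this

end Perturbation

/-! ### Powers of symmetric operators -/

section Powers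

variable {H : Type*} [NormedAddCommGroup H] [InnerProductSpace ℂ H] {A : H →L[ℂ] H}

/-- A constant independent of k disappears under 2^k-th roots. -/
theorem le_of_pow_two_pow_le {x y K : ℝ} (hy : 0 ≤ y)
    (h : ∀ k : ℕ, x ^ 2 ^ k ≤ K * y ^ 2 ^ k) : x ≤ y := by
  by_contra! hlt
  rcases hy.eq_or_lt with rfl | hy
  · have := h 0
    simp at this
    linarith
  · have h1 : 1 < x / y := (one_lt_div hy).2 hlt
    obtain ⟨n, hn⟩ := pow_unbounded_of_one_lt K h1
    have h2 : (x / y) ^ n ≤ (x / y) ^ 2 ^ n := pow_le_pow_right₀ h1.le Nat.lt_two_pow_self.le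
    have h3 := h n
    rw [← div_le_iff₀ (by positivity), ← div_pow] at h3
    linarith

theorem le_zero_of_pow_mul_le {x K a b : ℝ} (hb : 0 ≤ b) (hab : b < a)
    (h : ∀ n : ℕ, a ^ n * x ≤ K * b ^ n) : x ≤ 0 := by
  have ha : 0 < a := hb.trans_lt hab
  have h1 : Tendsto (fun n : ℕ => K * (b / a) ^ n) atTop (𝓝 (K * 0)) :=
    (tendsto_pow_atTop_nhds_zero_of_lt_one (by positivity) ((div_lt_one ha).2 hab)).const_mul K
  rw [mul_zero] at h1
  refine ge_of_tendsto' h1 fun n => ?_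
  rw [div_pow, ← mul_div_assoc, le_div_iff₀ (by positivity)]
  linarith [h n]

theorem inner_pow_left (hA : ∀ ψ χ, ⟪A ψ, χ⟫_ℂ = ⟪ψ, A χ⟫_ℂ) (n : ℕ) (ψ χ : H) :
    ⟪(A ^ n) ψ, χ⟫_ℂ = ⟪ψ, (A ^ n) χ⟫_ℂ := by
  induction n generalizing ψ χ with
  | zero => rfl
  | succ n ih =>
    have h1 : A ^ (n + 1) = A * A ^ n := pow_succ' A n
    have h2 : A ^ (n + 1) = A ^ n * A := pow_succ A n
    conv_lhs => rw [h1]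
    rw [h2]
    change ⟪A ((A ^ n) ψ), χ⟫_ℂ = ⟪ψ, (A ^ n) (A χ)⟫_ℂ
    rw [hA, ih]

/-- Log-convexity of n ↦ ‖Aⁿφ‖ by Cauchy-Schwarz. It replaces the spectral theorem in the estimate
of ‖A‖. -/
theorem norm_pow_sq_le (hA : ∀ ψ χ, ⟪A ψ, χ⟫_ℂ = ⟪ψ, A χ⟫_ℂ) (n : ℕ) (φ : H) :
    ‖(A ^ n) φ‖ ^ 2 ≤ ‖(A ^ (n * 2)) φ‖ * ‖φ‖ := by
  have h : ⟪(A ^ n) φ, (A ^ n) φ⟫_ℂ = ⟪φ, (A ^ (n * 2)) φ⟫_ℂ := by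
    rw [inner_pow_left hA, mul_two, pow_add]; rfl
  have h2 := norm_inner_le_norm (𝕜 := ℂ) φ ((A ^ (n * 2)) φ)
  rw [← h, inner_self_eq, Complex.norm_real, Real.norm_of_nonneg (by positivity)] at h2
  linarith

theorem norm_pow_pow_le (hA : ∀ ψ χ, ⟪A ψ, χ⟫_ℂ = ⟪ψ, A χ⟫_ℂ) (n : ℕ) {φ : H} (hφ : ‖φ‖ = 1)
    (k : ℕ) : ‖(A ^ n) φ‖ ^ 2 ^ k ≤ ‖(A ^ (n * 2 ^ k)) φ‖ := by
  induction k with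
  | zero => simp
  | succ k ih =>
    have h1 := norm_pow_sq_le hA (n * 2 ^ k) φ
    rw [hφ, mul_one, mul_assoc, ← pow_succ] at h1
    refine le_trans ?_ h1
    rw [pow_succ 2 k, pow_mul]
    exact pow_le_pow_left₀ (by positivity) ih 2

/-- If the powers of a symmetric operator on a total family are bounded by a sequence `m` with
`m (2 n) ≤ κ m(n)²`, then `‖A‖ⁿ ≤ κ m(n)`. -/
theorem norm_pow_le_of_total [CompleteSpace H] (h0 : 0 < ‖A‖) (hA : ∀ ψ χ, ⟪A ψ, χ⟫_ℂ = ⟪ψ, A χ⟫_ℂ) {m : ℕ → ℝ}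
    (hm : ∀ n, 0 ≤ m n) {κ : ℝ} (hκ : 0 < κ) (hm2 : ∀ n, m (n * 2) ≤ κ * m n ^ 2) {ι : Type*}
    {w : ι → H} (hw : ∀ χ, (∀ i, ⟪w i, χ⟫_ℂ = 0) → χ = 0)
    (hb : ∀ i, ∃ K, ∀ n, ‖(A ^ n) (w i)‖ ≤ K * m n) (n : ℕ) : ‖A‖ ^ n ≤ κ * m n := by
  have h1 : ∀ a : ι →₀ ℂ, ∃ K, ∀ n, ‖(A ^ n) (Finsupp.linearCombination ℂ w a)‖ ≤ K * m n := by
    intro a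
    induction a using Finsupp.induction_linear with
    | zero => exact ⟨0, fun n => by simp⟩
    | add a b ha hb =>
      obtain ⟨K, hK⟩ := ha
      obtain ⟨L, hL⟩ := hb
      refine ⟨K + L, fun n => ?_⟩
      rw [map_add, map_add, add_mul]
      exact (norm_add_le _ _).trans (add_le_add (hK n) (hL n))
    | single i z =>
      obtain ⟨K, hK⟩ := hb i
      refine ⟨‖z‖ * K, fun n => ?_⟩
      rw [Finsupp.linearCombination_single, map_smul, norm_smul, mul_assoc]
      exact mul_le_mul_of_nonneg_left (hK n) (norm_nonneg _)
  have hmk : ∀ n k, κ * m (n * 2 ^ k) ≤ (κ * m n) ^ 2 ^ k := by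
    intro n k
    induction k with
    | zero => simp
    | succ k ih =>
      have h2 := hm2 (n * 2 ^ k)
      rw [mul_assoc, ← pow_succ] at h2
      calc κ * m (n * 2 ^ (k + 1)) ≤ κ * (κ * m (n * 2 ^ k) ^ 2) := by gcongr
        _ = (κ * m (n * 2 ^ k)) ^ 2 := by ring
        _ ≤ ((κ * m n) ^ 2 ^ k) ^ 2 :=
          pow_le_pow_left₀ (mul_nonneg hκ.le (hm _)) ih 2
        _ = (κ * m n) ^ 2 ^ (k + 1) := by rw [pow_succ 2 k, pow_mul]
  have h3 : ∀ n (a : ι →₀ ℂ), ‖(A ^ n) (Finsupp.linearCombination ℂ w a)‖ ≤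
      κ * m n * ‖Finsupp.linearCombination ℂ w a‖ := by
    intro n a
    obtain ⟨K, hK⟩ := h1 a
    set φ := Finsupp.linearCombination ℂ w a
    rcases eq_or_ne φ 0 with h0 | h0
    · rw [h0]; simp
    have hφ : 0 < ‖φ‖ := norm_pos_iff.2 h0
    set φ' := ((‖φ‖⁻¹ : ℝ) : ℂ) • φ with hφ'
    have hn : ∀ n, ‖(A ^ n) φ'‖ = ‖φ‖⁻¹ * ‖(A ^ n) φ‖ := fun n => by
      rw [hφ', map_smul, norm_smul, Complex.norm_real, Real.norm_of_nonneg (by positivity)]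
    have hone : ‖φ'‖ = 1 := by
      have := hn 0
      rw [pow_zero] at this
      change ‖φ'‖ = ‖φ‖⁻¹ * ‖φ‖ at this
      rw [this, inv_mul_cancel₀ hφ.ne']
    -- The constant K depends on φ. It is removed by passing from n to n·2^k, where log-convexity
    -- and the doubling bound on m raise both sides to the power 2^k.
    have h4 : ‖(A ^ n) φ'‖ ≤ κ * m n := by
      refine le_of_pow_two_pow_le (K := ‖φ‖⁻¹ * |K| / κ) (mul_nonneg hκ.le (hm n)) fun k => ?_
      refine (norm_pow_pow_le hA n hone k).trans ?_
      rw [hn]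
      have h5 : ‖(A ^ (n * 2 ^ k)) φ‖ ≤ |K| * m (n * 2 ^ k) :=
        (hK _).trans (mul_le_mul_of_nonneg_right (le_abs_self K) (hm _))
      calc ‖φ‖⁻¹ * ‖(A ^ (n * 2 ^ k)) φ‖ ≤ ‖φ‖⁻¹ * (|K| * m (n * 2 ^ k)) := by gcongr
        _ = ‖φ‖⁻¹ * |K| / κ * (κ * m (n * 2 ^ k)) := by field_simp
        _ ≤ _ := mul_le_mul_of_nonneg_left (hmk n k) (by positivity)
    rw [hn, inv_mul_le_iff₀ hφ] at h4
    linarith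
  have h4 : ∀ n, ‖A ^ n‖ ≤ κ * m n := by
    intro n
    refine ContinuousLinearMap.opNorm_le_bound _ (mul_nonneg hκ.le (hm n)) fun ψ => ?_
    refine (dense_range_linearCombination hw).induction_on
      (p := fun ψ => ‖(A ^ n) ψ‖ ≤ κ * m n * ‖ψ‖) ψ ?_ (h3 n)
    exact isClosed_le (by fun_prop) (by fun_prop)
  -- To replace ‖Aⁿ‖ by ‖A‖ⁿ, the C*-identity at the power 2ⁿ ≥ n is combined with
  -- submultiplicativity for the remaining 2ⁿ - n factors.
  have hsa : IsSelfAdjoint A := ContinuousLinearMap.isSelfAdjoint_iff_isSymmetric.2 hA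
  refine le_trans ?_ (h4 n)
  have h5 := hsa.norm_pow_two_pow n
  have h6 : n ≤ 2 ^ n := Nat.lt_two_pow_self.le
  have h7 : ‖A ^ 2 ^ n‖ ≤ ‖A ^ n‖ * ‖A‖ ^ (2 ^ n - n) := by
    rcases Nat.eq_zero_or_pos (2 ^ n - n) with h8 | h8
    · have : 2 ^ n = n := by omega
      exact absurd this Nat.lt_two_pow_self.ne'
    · conv_lhs => rw [← Nat.add_sub_cancel' h6, pow_add]
      exact (norm_mul_le _ _).trans
        (mul_le_mul_of_nonneg_left (norm_pow_le' A h8) (norm_nonneg _))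
  rw [h5] at h7
  have h8 : ‖A‖ ^ 2 ^ n = ‖A‖ ^ n * ‖A‖ ^ (2 ^ n - n) := by
    rw [← pow_add, Nat.add_sub_cancel' h6]
  rw [h8] at h7
  exact le_of_mul_le_mul_right h7 (by positivity)

/-- A symmetric operator whose powers do not decay relative to the powers of its norm on `Ω` has
an eigenvector for the eigenvalue `‖A‖`. -/
theorem exists_eigenvector [CompleteSpace H] (ha : 0 < ‖A‖) {Ω : H} {κ : ℝ}
    (h : ∀ n : ℕ, κ * ‖A‖ ^ n ≤ RCLike.re ⟪Ω, (A ^ n) Ω⟫_ℂ) :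
    ∃ ψ, A ψ = ((‖A‖ : ℝ) : ℂ) • ψ ∧ κ ≤ ‖ψ‖ ^ 2 ∧ ⟪Ω, ψ⟫_ℂ = ((‖ψ‖ ^ 2 : ℝ) : ℂ) ∧
      Tendsto (fun n : ℕ => ∑ j ∈ Finset.range n,
        ((n : ℝ)⁻¹ * (‖A‖⁻¹) ^ j) • (A ^ j) Ω) atTop (𝓝 ψ) := by
  set B : H →L[ℂ] H := ((‖A‖⁻¹ : ℝ) : ℂ) • A with hB
  have hBn : ‖B‖ ≤ 1 := by
    rw [hB, norm_smul, Complex.norm_real, Real.norm_of_nonneg (by positivity),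
      inv_mul_cancel₀ ha.ne']
  have hBpow : ∀ j, (⇑B)^[j] Ω = ((‖A‖⁻¹) ^ j) • (A ^ j) Ω := by
    intro j
    have h1 : (⇑B)^[j] Ω = (B ^ j) Ω := (congrFun (FunLike.coe_pow_eq_iterate B j) Ω).symm
    rw [h1, hB, smul_pow, ← Complex.ofReal_pow]
    exact Complex.coe_smul _ _
  -- Von Neumann's mean ergodic theorem for the contraction B = A/‖A‖. The limit is the projection
  -- of Ω onto the fixed vectors, so ⟨Ω,ψ⟩ = ‖ψ‖², and the bound on every ⟨Ω, BʲΩ⟩ survives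
  -- averaging.
  have hlim := B.tendsto_birkhoffAverage_orthogonalProjection hBn Ω
  set K : Submodule ℂ H := B.eqLocus (1 : H →L[ℂ] H)
  set ψ : H := (K.orthogonalProjectionOnto Ω).1 with hψ
  have hlim2 : Tendsto (fun n : ℕ => ∑ j ∈ Finset.range n,
        ((n : ℝ)⁻¹ * (‖A‖⁻¹) ^ j) • (A ^ j) Ω) atTop (𝓝 ψ) := by
    refine hlim.congr fun n => ?_
    rw [birkhoffAverage, birkhoffSum, Finset.smul_sum]
    refine Finset.sum_congr rfl fun j _ => ?_
    rw [id, hBpow, mul_smul, ← Complex.coe_smul ((n : ℝ)⁻¹)]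
    push_cast; rfl
  have hin : ⟪Ω, ψ⟫_ℂ = ((‖ψ‖ ^ 2 : ℝ) : ℂ) := by
    rw [← inner_self_eq, hψ]
    exact (K.inner_orthogonalProjectionOnto_eq_of_mem_right (K.orthogonalProjectionOnto Ω) Ω).symm
  refine ⟨ψ, ?_, ?_, hin, hlim2⟩
  · have h1 : B ψ = ψ := (K.orthogonalProjectionOnto Ω).2
    rw [hB] at h1
    change ((‖A‖⁻¹ : ℝ) : ℂ) • A ψ = ψ at h1
    conv_rhs => rw [← h1]
    rw [smul_smul, ← Complex.ofReal_mul, mul_inv_cancel₀ ha.ne', Complex.ofReal_one, one_smul]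
  · have h1 : Tendsto (fun n : ℕ => RCLike.re ⟪Ω, ∑ j ∈ Finset.range n,
        ((n : ℝ)⁻¹ * (‖A‖⁻¹) ^ j) • (A ^ j) Ω⟫_ℂ) atTop (𝓝 (RCLike.re ⟪Ω, ψ⟫_ℂ)) :=
      (RCLike.continuous_re.tendsto _).comp (Tendsto.inner tendsto_const_nhds hlim2)
    rw [hin] at h1
    have h2 : RCLike.re (((‖ψ‖ ^ 2 : ℝ) : ℂ)) = ‖ψ‖ ^ 2 := Complex.ofReal_re _
    rw [h2] at h1
    refine ge_of_tendsto h1 ?_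
    filter_upwards [eventually_gt_atTop 0] with n hn
    have hn' : (0 : ℝ) < n := by exact_mod_cast hn
    rw [inner_sum, map_sum]
    have h3 : ∀ j ∈ Finset.range n, (n : ℝ)⁻¹ * κ ≤
        RCLike.re ⟪Ω, ((n : ℝ)⁻¹ * (‖A‖⁻¹) ^ j) • (A ^ j) Ω⟫_ℂ := by
      intro j _
      rw [← Complex.coe_smul, inner_smul_right, RCLike.re_to_complex, Complex.re_ofReal_mul, mul_assoc]
      refine mul_le_mul_of_nonneg_left ?_ (by positivity)
      have := h j
      rw [inv_pow, inv_mul_eq_div, le_div_iff₀ (by positivity)]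
      exact this
    refine le_trans (le_of_eq ?_) (Finset.sum_le_sum h3)
    rw [Finset.sum_const, Finset.card_range, nsmul_eq_mul]
    field_simp

end Powers

/-! ### Closed convex cones -/

section Cone

variable {V W : Type*} [NormedAddCommGroup V] [NormedSpace ℝ V] [NormedAddCommGroup W]
  [NormedSpace ℝ W]

/-- The bidual cone (the closed convex cone generated by `G`). -/
def biCone (G : Set V) : Set V := {v | ∀ Φ : V →L[ℝ] ℝ, (∀ g ∈ G, 0 ≤ Φ g) → 0 ≤ Φ v}

variable {G : Set V}

theorem subset_biCone : G ⊆ biCone G := fun g hg _ h => h g hg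

theorem zero_mem_biCone : (0 : V) ∈ biCone G := fun Φ _ => by rw [map_zero]

theorem add_mem_biCone {v w : V} (hv : v ∈ biCone G) (hw : w ∈ biCone G) : v + w ∈ biCone G :=
  fun Φ h => by rw [map_add]; exact add_nonneg (hv Φ h) (hw Φ h)

theorem smul_mem_biCone {r : ℝ} (hr : 0 ≤ r) {v : V} (hv : v ∈ biCone G) : r • v ∈ biCone G :=
  fun Φ h => by rw [map_smul]; exact mul_nonneg hr (hv Φ h)

theorem sum_mem_biCone {ι : Type*} (s : Finset ι) {v : ι → V} (hv : ∀ i ∈ s, v i ∈ biCone G) :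
    ∑ i ∈ s, v i ∈ biCone G :=
  fun Φ h => by rw [map_sum]; exact Finset.sum_nonneg fun i hi => hv i hi Φ h

theorem mem_biCone_of_tendsto {u : ℕ → V} {v : V} (h : Tendsto u atTop (𝓝 v))
    (hu : ∀ n, u n ∈ biCone G) : v ∈ biCone G :=
  fun Φ hΦ => ge_of_tendsto' ((Φ.continuous.tendsto v).comp h) fun n => hu n Φ hΦ

theorem map_mem_biCone {G' : Set W} (L : V →L[ℝ] W) (hL : ∀ g ∈ G, L g ∈ biCone G') {v : V}
    (hv : v ∈ biCone G) : L v ∈ biCone G' :=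
  fun Φ hΦ => hv (Φ.comp L) fun g hg => hL g hg Φ hΦ

/-- The Riemann weights of the Laplace transform are nonnegative, so resolvents inherit the
invariant cones of the semigroup. -/
theorem mem_biCone_of_riemann {c : ℝ} {S : ℕ → ℕ → V} {v : V}
    (h : Tendsto (fun n : ℕ => ∑ j ∈ Finset.range (n ^ 2),
      ((n : ℝ)⁻¹ * Real.exp (-(j / n * c))) • S n j) atTop (𝓝 v))
    (hS : ∀ n j, S n j ∈ biCone G) : v ∈ biCone G :=
  mem_biCone_of_tendsto h fun _ => sum_mem_biCone _ fun _ _ =>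
    smul_mem_biCone (by positivity) (hS _ _)

end Cone

/-! ### Real multiples of a one-boson function -/

section RealMul

variable {M : Type*} [MeasurableSpace M] {μ : Measure M} {ω : M → ℝ}

/-- `h = r f` with a real function `r`. -/
def RealMul (f h : OneBoson μ) : Prop := ∀ᵐ k ∂μ, ∃ r : ℝ, h k = r * f k

/-- `y = r f` with a real function `|r| ≤ 1`. -/
def UnitMul (f y : OneBoson μ) : Prop := ∀ᵐ k ∂μ, ∃ r : ℝ, |r| ≤ 1 ∧ y k = r * f k

variable {f g h y : OneBoson μ}

theorem UnitMul.realMul (hy : UnitMul f y) : RealMul f y :=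
  hy.mono fun _ ⟨r, _, hr⟩ => ⟨r, hr⟩

theorem unitMul_zero : UnitMul f 0 := by
  filter_upwards [Lp.coeFn_zero ℂ 2 μ] with k hk
  exact ⟨0, by simp, by rw [hk]; simp⟩

theorem unitMul_self : UnitMul f f := ae_of_all _ fun _ => ⟨1, by simp, by simp⟩

theorem UnitMul.neg (hy : UnitMul f y) : UnitMul f (-y) := by
  filter_upwards [hy, Lp.coeFn_neg y] with k ⟨r, h1, h2⟩ h3
  exact ⟨-r, by rwa [abs_neg], by rw [h3, Pi.neg_apply, h2]; push_cast; ring⟩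

theorem RealMul.sub (hg : RealMul f g) (hh : RealMul f h) : RealMul f (g - h) := by
  filter_upwards [hg, hh, Lp.coeFn_sub g h] with k ⟨r, h1⟩ ⟨s, h2⟩ h3
  exact ⟨r - s, by rw [h3, Pi.sub_apply, h1, h2]; push_cast; ring⟩

theorem decay_ae (hω : Measurable ω) (t : ℝ) (h : OneBoson μ) :
    decay hω t h =ᵐ[μ] fun k => (expF t (ω k) : ℂ) * h k := mulOp_ae _ h

theorem RealMul.decay (hω : Measurable ω) (t : ℝ) (hh : RealMul f h) :
    RealMul f (decay hω t h) := by
  filter_upwards [hh, decay_ae hω t h] with k ⟨r, h1⟩ h2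
  exact ⟨expF t (ω k) * r, by rw [h2, h1]; push_cast; ring⟩

theorem UnitMul.norm_le (hy : UnitMul f y) : ‖y‖ ≤ ‖f‖ := by
  refine Lp.norm_le_norm_of_ae_le ?_
  filter_upwards [hy] with k ⟨r, h1, h2⟩
  rw [h2, norm_mul, Complex.norm_real, Real.norm_eq_abs]
  exact mul_le_of_le_one_left (norm_nonneg _) h1

/-- The integrand is rs|f|², which is real. -/
theorem RealMul.inner_eq (hg : RealMul f g) (hh : RealMul f h) :
    ⟪g, h⟫_ℂ = ((RCLike.re ⟪g, h⟫_ℂ : ℝ) : ℂ) := by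
  have : ⟪g, h⟫_ℂ = ((∫ k, RCLike.re ⟪g k, h k⟫_ℂ ∂μ : ℝ) : ℂ) := by
    rw [L2.inner_def, ← integral_complex_ofReal]
    refine integral_congr_ae ?_
    filter_upwards [hg, hh] with k ⟨r, h1⟩ ⟨s, h2⟩
    have h3 : ⟪g k, h k⟫_ℂ = ((r * s * ‖f k‖ ^ 2 : ℝ) : ℂ) := by
      rw [h1, h2, RCLike.inner_apply, map_mul, Complex.conj_ofReal]
      have := RCLike.mul_conj (f k)
      push_cast
      linear_combination (r : ℂ) * s * this
    rw [h3, RCLike.re_to_complex, Complex.ofReal_re]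
  rw [this]
  rw [RCLike.re_to_complex, Complex.ofReal_re]

/-- The integral of `|f| |h|`. -/
def overlap (f h : OneBoson μ) : ℝ := ∫ k, ‖f k‖ * ‖h k‖ ∂μ

theorem integrable_overlap (f h : OneBoson μ) : Integrable (fun k => ‖f k‖ * ‖h k‖) μ :=
  (Lp.memLp f).norm.integrable_mul (Lp.memLp h).norm

theorem overlap_nonneg (f h : OneBoson μ) : 0 ≤ overlap f h :=
  integral_nonneg fun _ => by positivity

theorem overlap_mono (hgh : ∀ᵐ k ∂μ, ‖g k‖ ≤ ‖h k‖) : overlap f g ≤ overlap f h := by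
  refine integral_mono_ae (integrable_overlap _ _) (integrable_overlap _ _) ?_
  filter_upwards [hgh] with k hk
  exact mul_le_mul_of_nonneg_left hk (norm_nonneg _)

theorem UnitMul.overlap_le (hy : UnitMul f y) : overlap f y ≤ ‖f‖ ^ 2 := by
  rw [norm_sq_eq_integral]
  refine integral_mono_ae (integrable_overlap _ _) (integrable_norm_sq f) ?_
  filter_upwards [hy] with k ⟨r, h1, h2⟩
  simp only [h2, norm_mul, Complex.norm_real, Real.norm_eq_abs]
  nlinarith [norm_nonneg (f k), mul_nonneg (norm_nonneg (f k)) (norm_nonneg (f k))]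

/-- The exponent picked up when h decays is paid for by the loss of ∫|f||h|. Thus the modulus of the
accumulated exponent plus the remaining overlap never increases. -/
theorem norm_inner_sub_decay_le (hω : Measurable ω) (t : ℝ) (f h : OneBoson μ) :
    ‖⟪f, h - decay hω t h⟫_ℂ‖ ≤ overlap f h - overlap f (decay hω t h) := by
  rw [L2.inner_def, overlap, overlap,
    ← integral_sub (integrable_overlap _ _) (integrable_overlap _ _)]
  refine norm_integral_le_of_norm_le ((integrable_overlap _ _).sub (integrable_overlap _ _)) ?_
  filter_upwards [Lp.coeFn_sub h (decay hω t h), decay_ae hω t h] with k h1 h2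
  rw [h1, Pi.sub_apply, h2, RCLike.inner_apply]
  have h3 : h k - (expF t (ω k) : ℂ) * h k = ((1 - expF t (ω k) : ℝ) : ℂ) * h k := by
    push_cast; ring
  rw [h3, norm_mul, norm_mul, norm_mul, RCLike.norm_conj, Complex.norm_real, Complex.norm_real,
    Real.norm_of_nonneg (by linarith [expF_le_one t (ω k)]),
    Real.norm_of_nonneg (expF_pos t (ω k)).le]
  exact le_of_eq (by ring)

/-- On the support of h the frequency is at least δ, which gives an exponential rate. -/
theorem norm_decay_le (hω : Measurable ω) (hω0 : ∀ k, 0 ≤ ω k) {t δ : ℝ} (ht : 0 ≤ t)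
    (hδ : ∀ᵐ k ∂μ, ω k < δ → h k = 0) : ‖decay hω t h‖ ≤ Real.exp (-(t * δ)) * ‖h‖ := by
  refine norm_mulOp_le _ h ?_
  filter_upwards [hδ] with k hk
  by_cases hd : ω k < δ
  · exact Or.inr (hk hd)
  · left
    rw [abs_of_pos (expF_pos _ _), expF_eq ht (hω0 k)]
    push Not at hd
    gcongr

/-- The action of the semigroup on the arguments of exponential vectors. -/
def shift (hω : Measurable ω) (f : OneBoson μ) (t : ℝ) (x : ℤˣ) (z : OneBoson μ) : OneBoson μ :=
  decay hω t z - ((x : ℤ) : ℂ) • (f - decay hω t f)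

theorem shift_add (hω : Measurable ω) (t : ℝ) (x : ℤˣ) :
    shift hω f t x (h + y) = decay hω t h + shift hω f t x y := by
  rw [shift, shift, map_add]; abel

theorem shift_neg (hω : Measurable ω) (t : ℝ) (x : ℤˣ) :
    shift hω f t (-x) (-y) = -shift hω f t x y := by
  rw [shift, shift, map_neg]; push_cast; rw [neg_smul]; abel

/-- The multiplier r becomes e^{-tω}r - (1 - e^{-tω})x, a convex combination of r and -x. This is
the source of all invariant cones below. -/
theorem UnitMul.shift (hω : Measurable ω) (t : ℝ) (x : ℤˣ) (hy : UnitMul f y) :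
    UnitMul f (shift hω f t x y) := by
  filter_upwards [hy, decay_ae hω t y, decay_ae hω t f, Lp.coeFn_sub f (decay hω t f),
    Lp.coeFn_smul ((x : ℤ) : ℂ) (f - decay hω t f),
    Lp.coeFn_sub (decay hω t y) (((x : ℤ) : ℂ) • (f - decay hω t f))] with k ⟨r, h1, h2⟩ h3 h4 h5 h6 h7
  refine ⟨expF t (ω k) * r - (x : ℤ) * (1 - expF t (ω k)), ?_, ?_⟩
  · have e1 := expF_le_one t (ω k)
    have e2 := expF_pos t (ω k)
    rw [abs_le] at h1 ⊢
    rcases Int.units_eq_one_or x with rfl | rfl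
    · push_cast; constructor <;> nlinarith
    · push_cast; constructor <;> nlinarith
  · change (decay hω t y - ((x : ℤ) : ℂ) • (f - decay hω t f) : OneBoson μ) k = _
    rw [h7, Pi.sub_apply, h6, Pi.smul_apply, h5, Pi.sub_apply, h3, h4, h2, smul_eq_mul]
    push_cast; ring

end RealMul

/-! ### The spin boson semigroup in abstract form -/

/-- Exponential vectors `e(z, x)` over `L² × {±1}`, the spin flip `J`, the semigroup `T` of the
van Hove Hamiltonians and its resolvents `R`. -/
structure SpinSemigroup {M : Type*} [MeasurableSpace M] {μ : Measure M} {ω : M → ℝ}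
    (hω : Measurable ω) (f : OneBoson μ) (K : Type*) [NormedAddCommGroup K]
    [InnerProductSpace ℂ K] where
  e : OneBoson μ → ℤˣ → K
  inner_e_same : ∀ g h x, ⟪e g x, e h x⟫_ℂ = Complex.exp ⟪g, h⟫_ℂ
  inner_e_flip : ∀ g h x, ⟪e g x, e h (-x)⟫_ℂ = 0
  total : ∀ χ, (∀ g x, ⟪e g x, χ⟫_ℂ = 0) → χ = 0
  lip : ∀ B g h x, ‖g‖ ≤ B → ‖h‖ ≤ B →
    ‖e h x - e g x‖ ≤ (B + 1) * Real.exp (B ^ 2 / 2) * ‖h - g‖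
  J : K →L[ℂ] K
  J_e : ∀ g x, J (e g x) = e g (-x)
  J_symm : ∀ ψ χ, ⟪J ψ, χ⟫_ℂ = ⟪ψ, J χ⟫_ℂ
  norm_J : ∀ ψ, ‖J ψ‖ ≤ ‖ψ‖
  T : ℝ → K →L[ℂ] K
  T_e : ∀ t z x, T t (e z x) = Complex.exp (-⟪f, f - decay hω t f⟫_ℂ -
    ((x : ℤ) : ℂ) * ⟪f, z - decay hω t z⟫_ℂ) • e (shift hω f t x z) x
  R : ℝ → K →L[ℂ] K
  R_lim : ∀ c, 1 ≤ c → ∀ ψ, Tendsto (fun n : ℕ => ∑ j ∈ Finset.range (n ^ 2),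
    (((n : ℝ)⁻¹ * Real.exp (-(j / n * c)) : ℝ) : ℂ) • T ((j : ℝ) / n) ψ) atTop (𝓝 (R c ψ))
  R_symm : ∀ c ψ χ, ⟪R c ψ, χ⟫_ℂ = ⟪ψ, R c χ⟫_ℂ
  norm_R : ∀ c, 1 ≤ c → ∀ ψ, ‖R c ψ‖ ≤ c⁻¹ * ‖ψ‖
  R_inj : ∀ c, 1 ≤ c → ∀ ψ, R c ψ = 0 → ψ = 0
  R_shift : ∀ c c', 1 ≤ c → 1 ≤ c' → ∀ φ, R c (φ - ((c' - c : ℝ) : ℂ) • R c' φ) = R c' φ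

namespace SpinSemigroup

variable {M : Type*} [MeasurableSpace M] {μ : Measure M} {ω : M → ℝ}
  {hω : Measurable ω} {f : OneBoson μ} {K : Type*} [NormedAddCommGroup K]
  [InnerProductSpace ℂ K] (S : SpinSemigroup hω f K)

/-- The norm factor in the action of the semigroup. -/
def wt (hω : Measurable ω) (f : OneBoson μ) (t : ℝ) (x : ℤˣ) (y : OneBoson μ) : ℝ :=
  Real.exp (-RCLike.re ⟪f, f - decay hω t f⟫_ℂ - (x : ℤ) * RCLike.re ⟪f, y - decay hω t y⟫_ℂ)

/-- Invariance under (x, y) ↦ (-x, -y), the parity symmetry of the model. -/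
theorem wt_neg (t : ℝ) (x : ℤˣ) (y : OneBoson μ) : wt hω f t (-x) (-y) = wt hω f t x y := by
  have : (-y - decay hω t (-y)) = -(y - decay hω t y) := by rw [map_neg]; abel
  rw [wt, wt, this, inner_neg_right, map_neg]
  push_cast
  congr 1
  ring

/-- The scalar splits into a positive weight, depending only on y because f and y are real multiples
of f, and a complex factor from h. The weight is the one with which ε(y) itself evolves, so the two
vectors can be compared. -/
theorem T_add (t : ℝ) (x : ℤˣ) (h : OneBoson μ) {y : OneBoson μ} (hy : UnitMul f y) :
    S.T t (S.e (h + y) x) = (wt hω f t x y : ℂ) •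
      Complex.exp (-(((x : ℤ) : ℂ) * ⟪f, h - decay hω t h⟫_ℂ)) •
        S.e (decay hω t h + shift hω f t x y) x := by
  rw [S.T_e, shift_add, smul_smul, wt, Complex.ofReal_exp, ← Complex.exp_add]
  have h1 := unitMul_self.realMul.inner_eq
    ((unitMul_self (f := f)).realMul.sub ((unitMul_self (f := f)).realMul.decay hω t))
  have h2 := unitMul_self.realMul.inner_eq (hy.realMul.sub (hy.realMul.decay hω t))
  have h3 : h + y - decay hω t (h + y) = (h - decay hω t h) + (y - decay hω t y) := by
    rw [map_add]; abel
  congr 2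
  rw [h3, inner_add_right]
  push_cast
  rw [← h1, ← h2]
  ring

theorem T_unit (t : ℝ) (x : ℤˣ) {y : OneBoson μ} (hy : UnitMul f y) :
    S.T t (S.e y x) = (wt hω f t x y : ℂ) • S.e (shift hω f t x y) x := by
  have := S.T_add t x 0 hy
  rwa [zero_add, map_zero, sub_zero, inner_zero_right, mul_zero, neg_zero, Complex.exp_zero,
    one_smul, zero_add] at this

theorem norm_e (g : OneBoson μ) (x : ℤˣ) : ‖S.e g x‖ = Real.exp (‖g‖ ^ 2 / 2) := by
  have h2 : ‖S.e g x‖ ^ 2 = Real.exp (‖g‖ ^ 2) := by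
    have := S.inner_e_same g g x
    rw [inner_self_eq, inner_self_eq, ← Complex.ofReal_exp] at this
    exact_mod_cast this
  refine (pow_left_inj₀ (norm_nonneg _) (Real.exp_pos _).le two_ne_zero).1 ?_
  rw [h2, ← Real.exp_nat_mul]
  congr 1
  push_cast; ring

/-- The unnormalized vacuum. -/
def vac : K := S.e 0 1 + S.e 0 (-1)

theorem inner_e_zero (g : OneBoson μ) (x : ℤˣ) : ⟪S.e 0 x, S.e g x⟫_ℂ = 1 := by
  rw [S.inner_e_same, inner_zero_left, Complex.exp_zero]

/-- Pairing with the vacuum normalizes every exponential vector to 1; bounds on generators therefore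
become linear bounds on cones. -/
theorem inner_vac (g : OneBoson μ) (x : ℤˣ) : ⟪S.vac, S.e g x⟫_ℂ = 1 := by
  rw [vac, inner_add_left]
  rcases Int.units_eq_one_or x with rfl | rfl
  · have := S.inner_e_flip 0 g (-1)
    rw [neg_neg] at this
    rw [S.inner_e_zero, this, add_zero]
  · rw [S.inner_e_zero, S.inner_e_flip, zero_add]

theorem continuous_e (x : ℤˣ) : Continuous fun g => S.e g x := by
  rw [continuous_iff_continuousAt]
  intro g
  rw [ContinuousAt, tendsto_iff_norm_sub_tendsto_zero]
  have h1 : Tendsto (fun h : OneBoson μ => ((‖g‖ + 1) + 1) * Real.exp ((‖g‖ + 1) ^ 2 / 2) * ‖h - g‖)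
      (𝓝 g) (𝓝 0) := by
    have h2 : Continuous fun h : OneBoson μ =>
      ((‖g‖ + 1) + 1) * Real.exp ((‖g‖ + 1) ^ 2 / 2) * ‖h - g‖ := by fun_prop
    have := h2.tendsto g
    rwa [sub_self, norm_zero, mul_zero] at this
  refine squeeze_zero' (.of_forall fun _ => norm_nonneg _) ?_ h1
  filter_upwards [Metric.ball_mem_nhds g one_pos] with h hh
  rw [mem_ball_iff_norm] at hh
  refine S.lip _ g h x (by linarith) ?_
  have := norm_add_le g (h - g)
  rw [add_sub_cancel] at this
  linarith

/-! ### Invariant cones -/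

/-- A triple of bounded operators. -/
def tri (L₁ L₂ L₃ : K →L[ℂ] K) : K × K × K →L[ℝ] K × K × K :=
  (L₁.prodMap (L₂.prodMap L₃)).restrictScalars ℝ

/-- Real parts of inner products with a triple of vectors. -/
def reF (ξ₁ ξ₂ ξ₃ : K) : K × K × K →L[ℝ] ℝ :=
  Complex.reCLM.comp (((innerSL ℂ ξ₁).comp (ContinuousLinearMap.fst ℂ K (K × K)) +
    (innerSL ℂ ξ₂).comp ((ContinuousLinearMap.fst ℂ K K).comp (ContinuousLinearMap.snd ℂ K (K × K))) +
    (innerSL ℂ ξ₃).comp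
      ((ContinuousLinearMap.snd ℂ K K).comp (ContinuousLinearMap.snd ℂ K (K × K)))).restrictScalars ℝ)

theorem reF_apply (ξ₁ ξ₂ ξ₃ : K) (v : K × K × K) :
    reF ξ₁ ξ₂ ξ₃ v = RCLike.re ⟪ξ₁, v.1⟫_ℂ + RCLike.re ⟪ξ₂, v.2.1⟫_ℂ + RCLike.re ⟪ξ₃, v.2.2⟫_ℂ := rfl

/-- The real part of the inner product with a vector. -/
def reF₁ (ξ : K) : K →L[ℝ] ℝ := Complex.reCLM.comp ((innerSL ℂ ξ).restrictScalars ℝ)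

theorem reF₁_apply (ξ v : K) : reF₁ ξ v = RCLike.re ⟪ξ, v⟫_ℂ := rfl

theorem R_mem_biCone {c : ℝ} (hc : 1 ≤ c) {G : Set K} (hT : ∀ t, ∀ g ∈ G, S.T t g ∈ biCone G)
    {v : K} (hv : v ∈ biCone G) : S.R c v ∈ biCone G := by
  refine map_mem_biCone ((S.R c).restrictScalars ℝ) (fun g hg => ?_) hv
  exact mem_biCone_of_riemann (c := c) (S.R_lim c hc g) fun n j => hT _ g hg

theorem sum_triple {ι : Type*} (s : Finset ι) (a b d : ι → K) :
    (∑ i ∈ s, a i, ∑ i ∈ s, b i, ∑ i ∈ s, d i) = ∑ i ∈ s, (a i, b i, d i) := by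
  refine Prod.ext ?_ (Prod.ext ?_ ?_) <;> simp only [Prod.fst_sum, Prod.snd_sum]

variable {c δ : ℝ} {A A' : K →L[ℂ] K}

/-- The cone is preserved by the two resolvents and the flip, hence by the Neumann iterates and
their limits. The factor e^{-tδ} in the third component turns the resolvent at c + 1 into the one at
c + δ + 1. -/
theorem tri_mem_biCone (hc : 1 ≤ c) (hδ : 0 ≤ δ) (hA : IsPerturbed (S.R (c + 1)) S.J A)
    (hA' : IsPerturbed (S.R (c + δ + 1)) S.J A') {G : Set (K × K × K)}
    (hT : ∀ t, 0 ≤ t → ∀ g ∈ G,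
      (S.T t g.1, S.T t g.2.1, Real.exp (-(t * δ)) • S.T t g.2.2) ∈ biCone G)
    (hJ : ∀ g ∈ G, (S.J g.1, S.J g.2.1, S.J g.2.2) ∈ biCone G) {v : K × K × K}
    (hv : v ∈ biCone G) : (A v.1, A v.2.1, A' v.2.2) ∈ biCone G := by
  have hR : ∀ v ∈ biCone G,
      (S.R (c + 1) v.1, S.R (c + 1) v.2.1, S.R (c + δ + 1) v.2.2) ∈ biCone G := by
    intro v hv
    refine map_mem_biCone (tri (S.R (c + 1)) (S.R (c + 1)) (S.R (c + δ + 1))) (fun g hg => ?_) hv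
    refine mem_biCone_of_riemann (c := c + 1) (S := fun n j => (S.T ((j : ℝ) / n) g.1,
      S.T ((j : ℝ) / n) g.2.1, Real.exp (-((j : ℝ) / n * δ)) • S.T ((j : ℝ) / n) g.2.2)) ?_
      fun n j => hT _ (by positivity) g hg
    have h1 := S.R_lim (c + 1) (by linarith) g.1
    have h2 := S.R_lim (c + 1) (by linarith) g.2.1
    have h3 := S.R_lim (c + δ + 1) (by linarith) g.2.2
    refine (h1.prodMk_nhds (h2.prodMk_nhds h3)).congr fun n => ?_
    rw [sum_triple]
    refine Finset.sum_congr rfl fun j _ => ?_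
    refine Prod.ext rfl (Prod.ext rfl ?_)
    -- The factor e^{-tδ} is absorbed into the Laplace weight e^{-t(c+1)}.
    change ((((n : ℝ)⁻¹ * Real.exp (-(j / n * (c + δ + 1))) : ℝ) : ℂ) • _ : K) = ((n : ℝ)⁻¹ * Real.exp (-(j / n * (c + 1)))) •
      (Real.exp (-((j : ℝ) / n * δ)) • S.T ((j : ℝ) / n) g.2.2)
    rw [smul_smul, mul_assoc, ← Real.exp_add, Complex.coe_smul]
    congr 3
    ring_nf
  have hJ' : ∀ v ∈ biCone G, (S.J v.1, S.J v.2.1, S.J v.2.2) ∈ biCone G := fun v hv =>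
    map_mem_biCone (tri S.J S.J S.J) hJ hv
  have hN : ∀ n, (neumann (S.R (c + 1)) S.J v.1 n, neumann (S.R (c + 1)) S.J v.2.1 n,
      neumann (S.R (c + δ + 1)) S.J v.2.2 n) ∈ biCone G := by
    intro n
    induction n with
    | zero => exact zero_mem_biCone
    | succ n ih => exact hR _ (add_mem_biCone hv (hJ' _ ih))
  have hc' : 0 < c := by linarith
  have hcδ : 0 < c + δ := by linarith
  have h1 := hA.tendsto_neumann hc' (S.norm_R _ (by linarith)) S.norm_J
  have h3 := hA'.tendsto_neumann hcδ (S.norm_R _ (by linarith)) S.norm_J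
  exact mem_biCone_of_tendsto ((h1 v.1).prodMk_nhds ((h1 v.2.1).prodMk_nhds (h3 v.2.2))) hN

theorem tri_pow_mem_biCone (hc : 1 ≤ c) (hδ : 0 ≤ δ) (hA : IsPerturbed (S.R (c + 1)) S.J A)
    (hA' : IsPerturbed (S.R (c + δ + 1)) S.J A') {G : Set (K × K × K)}
    (hT : ∀ t, 0 ≤ t → ∀ g ∈ G,
      (S.T t g.1, S.T t g.2.1, Real.exp (-(t * δ)) • S.T t g.2.2) ∈ biCone G)
    (hJ : ∀ g ∈ G, (S.J g.1, S.J g.2.1, S.J g.2.2) ∈ biCone G) {v : K × K × K}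
    (hv : v ∈ biCone G) (n : ℕ) : ((A ^ n) v.1, (A ^ n) v.2.1, (A' ^ n) v.2.2) ∈ biCone G := by
  induction n with
  | zero => exact hv
  | succ n ih =>
    have h1 : A ^ (n + 1) = A * A ^ n := pow_succ' A n
    have h2 : A' ^ (n + 1) = A' * A' ^ n := pow_succ' A' n
    rw [h1, h2]
    exact S.tri_mem_biCone hc hδ hA hA' hT hJ ih

/-- Pairs of exponential vectors `e(h + y, x)`, `e(y, x)`, with control of the distance. -/
def pairs (δ B C : ℝ) (b : Prop) : Set (K × K × K) :=
  {v | ∃ (x : ℤˣ) (y h : OneBoson μ) (q : ℝ) (ζ : ℂ), UnitMul f y ∧ 0 ≤ q ∧ q ≤ 1 ∧ ‖h‖ ≤ q * B ∧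
    ‖ζ‖ + overlap f h ≤ C ∧ (∀ᵐ k ∂μ, ω k < δ → h k = 0) ∧ (b → ζ.im = 0 ∧ RealMul f h) ∧
    v = (Complex.exp (-ζ) • S.e (h + y) x, S.e y x, (q : ℂ) • S.e y x)}

theorem J_pairs (δ B C : ℝ) (b : Prop) :
    ∀ g ∈ S.pairs δ B C b, (S.J g.1, S.J g.2.1, S.J g.2.2) ∈ biCone (S.pairs δ B C b) := by
  rintro _ ⟨x, y, h, q, ζ, h1, h2, h3, h4, h5, h6, h7, rfl⟩
  refine subset_biCone ⟨-x, y, h, q, ζ, h1, h2, h3, h4, h5, h6, h7, ?_⟩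
  simp only [map_smul, S.J_e]

theorem norm_intUnit_cast (x : ℤˣ) : ‖((x : ℤ) : ℂ)‖ = 1 := by
  rcases Int.units_eq_one_or x with rfl | rfl <;> simp

/-- The evolution replaces h by e^{-tω}h and adds x⟨f, h - e^{-tω}h⟩ to ζ, which
`norm_inner_sub_decay_le` keeps within the budget C. The number q records the guaranteed decay of h:
it acquires e^{-tδ}. With `b`, everything remains real. -/
theorem T_pairs (hω0 : ∀ k, 0 ≤ ω k) {δ : ℝ} (hδ : 0 ≤ δ) (B C : ℝ) (b : Prop) :
    ∀ t, 0 ≤ t → ∀ g ∈ S.pairs δ B C b,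
      (S.T t g.1, S.T t g.2.1, Real.exp (-(t * δ)) • S.T t g.2.2) ∈
        biCone (S.pairs δ B C b) := by
  rintro t ht _ ⟨x, y, h, q, ζ, h1, h2, h3, h4, h5, h6, h7, rfl⟩
  have hE : Real.exp (-(t * δ)) ≤ 1 := Real.exp_le_one_iff.2 (by nlinarith)
  have hmem : (Complex.exp (-(ζ + ((x : ℤ) : ℂ) * ⟪f, h - decay hω t h⟫_ℂ)) •
      S.e (decay hω t h + shift hω f t x y) x, S.e (shift hω f t x y) x,
      ((Real.exp (-(t * δ)) * q : ℝ) : ℂ) • S.e (shift hω f t x y) x) ∈ S.pairs δ B C b := by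
    refine ⟨x, _, _, _, _, h1.shift hω t x, by positivity, ?_, ?_, ?_, ?_, ?_, rfl⟩
    · nlinarith [Real.exp_pos (-(t * δ))]
    · refine (norm_decay_le hω hω0 ht h6).trans ?_
      rw [mul_assoc]
      exact mul_le_mul_of_nonneg_left h4 (Real.exp_pos _).le
    · have e1 := norm_inner_sub_decay_le hω t f h
      have e2 := norm_add_le ζ (((x : ℤ) : ℂ) * ⟪f, h - decay hω t h⟫_ℂ)
      rw [norm_mul, norm_intUnit_cast, one_mul] at e2
      linarith
    · filter_upwards [h6, decay_ae hω t h] with k hk1 hk2 hk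
      rw [hk2, hk1 hk, mul_zero]
    · intro hb
      obtain ⟨h8, h9⟩ := h7 hb
      refine ⟨?_, h9.decay hω t⟩
      rw [unitMul_self.realMul.inner_eq (h9.sub (h9.decay hω t))]
      simp [h8]
  -- All three components share the positive weight of the evolution of ε(y).
  have := smul_mem_biCone (Real.exp_pos (-RCLike.re ⟪f, f - decay hω t f⟫_ℂ -
    (x : ℤ) * RCLike.re ⟪f, y - decay hω t y⟫_ℂ)).le (subset_biCone hmem)
  convert this using 1
  refine Prod.ext ?_ (Prod.ext ?_ ?_)
  · change S.T t (Complex.exp (-ζ) • S.e (h + y) x) = (wt hω f t x y) • _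
    rw [map_smul, S.T_add t x h h1, ← Complex.coe_smul]
    simp only [smul_smul]
    congr 1
    rw [neg_add, Complex.exp_add]; ring
  · change S.T t (S.e y x) = (wt hω f t x y) • _
    rw [S.T_unit t x h1, Complex.coe_smul]
  · change Real.exp (-(t * δ)) • S.T t ((q : ℂ) • S.e y x) = (wt hω f t x y) • _
    rw [map_smul, S.T_unit t x h1, ← Complex.coe_smul, ← Complex.coe_smul (wt hω f t x y)]
    simp only [smul_smul]
    congr 1
    push_cast; ring

/-- The spin-flip symmetric pairs of exponential vectors. -/
def parity : Set (K × K × K) := {v | ∃ y, UnitMul f y ∧ v = (S.e y 1 + S.e (-y) (-1), 0, 0)}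

theorem J_parity : ∀ g ∈ S.parity, (S.J g.1, S.J g.2.1, S.J g.2.2) ∈ biCone S.parity := by
  rintro _ ⟨y, hy, rfl⟩
  refine subset_biCone ⟨-y, hy.neg, ?_⟩
  simp only [map_add, S.J_e, map_zero, neg_neg]
  rw [add_comm]

theorem T_parity (δ : ℝ) : ∀ t, 0 ≤ t → ∀ g ∈ S.parity,
      (S.T t g.1, S.T t g.2.1, Real.exp (-(t * δ)) • S.T t g.2.2) ∈ biCone S.parity := by
  rintro t - _ ⟨y, hy, rfl⟩
  have h0 : 0 ≤ wt hω f t 1 y := (Real.exp_pos _).le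
  have := smul_mem_biCone h0 (subset_biCone (G := S.parity) ⟨_, hy.shift hω t 1, rfl⟩)
  convert this using 1
  refine Prod.ext ?_ (Prod.ext ?_ ?_)
  · change S.T t (S.e y 1 + S.e (-y) (-1)) = wt hω f t 1 y • _
    rw [map_add, S.T_unit t 1 hy, S.T_unit t (-1) hy.neg, wt_neg, shift_neg, ← Complex.coe_smul,
      smul_add]
  · change S.T t 0 = wt hω f t 1 y • (0 : K)
    rw [map_zero, smul_zero]
  · change _ • S.T t 0 = wt hω f t 1 y • (0 : K)
    rw [map_zero, smul_zero, smul_zero]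

end SpinSemigroup

namespace SpinSemigroup

variable {M : Type*} [MeasurableSpace M] {μ : Measure M} {ω : M → ℝ}
  {hω : Measurable ω} {f : OneBoson μ} {K : Type*} [NormedAddCommGroup K]
  [InnerProductSpace ℂ K] (S : SpinSemigroup hω f K) {c δ : ℝ} {A A' : K →L[ℂ] K}

/-! ### Existence of a ground state -/

theorem pairs_mem {g : OneBoson μ} (hω0 : ∀ k, 0 ≤ ω k) {y : OneBoson μ} (hy : UnitMul f y) (x : ℤˣ) :
    (S.e (g + y) x, S.e y x, S.e y x) ∈ S.pairs 0 ‖g‖ (overlap f g) False := by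
  refine ⟨x, y, g, 1, 0, hy, zero_le_one, le_rfl, (one_mul _).ge, by simp,
    ae_of_all _ fun k hk => absurd hk (not_lt.2 (hω0 k)), False.elim, by simp⟩

theorem re_vac_nonneg {B C : ℝ} {b : Prop} {v : K × K × K} (hv : v ∈ biCone (S.pairs δ B C b)) :
    0 ≤ RCLike.re ⟪S.vac, v.2.1⟫_ℂ := by
  have := hv (reF 0 S.vac 0) ?_
  · simpa [reF_apply] using this
  rintro _ ⟨x, y, h, q, ζ, -, -, -, -, -, -, -, rfl⟩
  simp [reF_apply, S.inner_vac]

/-- The norm is not linear, so the cone is tested with the functional w ↦ L‖v₁‖⟨Ω, w₂⟩ - Re⟨v₁, w₁⟩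
built from the vector itself. It is nonnegative on generators, where ‖w₁‖ ≤ L and ⟨Ω, w₂⟩ = 1. -/
theorem norm_fst_le {B C : ℝ} {b : Prop} (hB : 0 ≤ B) {v : K × K × K}
    (hv : v ∈ biCone (S.pairs δ B C b)) :
    ‖v.1‖ ≤ Real.exp (C + (B + ‖f‖) ^ 2 / 2) * RCLike.re ⟪S.vac, v.2.1⟫_ℂ := by
  set L := Real.exp (C + (B + ‖f‖) ^ 2 / 2) with hL
  have h0 := S.re_vac_nonneg hv
  have := hv (reF (-v.1) (((L * ‖v.1‖ : ℝ) : ℂ) • S.vac) 0) ?_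
  · rw [reF_apply, inner_neg_left, inner_self_eq, inner_smul_left, Complex.conj_ofReal,
      inner_zero_left] at this
    simp only [RCLike.re_to_complex, Complex.neg_re, Complex.ofReal_re, Complex.re_ofReal_mul,
      Complex.zero_re, add_zero] at this h0 ⊢
    rcases (norm_nonneg v.1).eq_or_lt with h1 | h1
    · rw [← h1]; exact mul_nonneg (Real.exp_pos _).le h0
    · nlinarith
  rintro _ ⟨x, y, h, q, ζ, h1, h2, h3, h4, h5, h6, h7, rfl⟩
  have hn : ‖Complex.exp (-ζ) • S.e (h + y) x‖ ≤ L := by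
    rw [norm_smul, S.norm_e, Complex.norm_exp, ← Real.exp_add, hL]
    have e1 : ‖h‖ ≤ B := h4.trans (mul_le_of_le_one_left hB h3)
    have e2 : ‖h + y‖ ≤ B + ‖f‖ := (norm_add_le _ _).trans (add_le_add e1 h1.norm_le)
    have e3 := Complex.abs_re_le_norm ζ
    have e4 := overlap_nonneg f h
    rw [abs_le] at e3
    have e5 : ‖h + y‖ ^ 2 ≤ (B + ‖f‖) ^ 2 := pow_le_pow_left₀ (norm_nonneg _) e2 2
    rw [Complex.neg_re]
    gcongr
    linarith
  rw [reF_apply, inner_neg_left, inner_smul_left, Complex.conj_ofReal, inner_zero_left]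
  simp only [S.inner_vac, mul_one, map_zero, add_zero, map_neg, RCLike.re_to_complex,
    Complex.ofReal_re]
  have h8 := (Complex.re_le_norm _).trans
    (norm_inner_le_norm (𝕜 := ℂ) v.1 (Complex.exp (-ζ) • S.e (h + y) x))
  have := mul_le_mul_of_nonneg_left hn (norm_nonneg v.1)
  linarith

theorem norm_le (hc : 1 ≤ c) (hA : IsPerturbed (S.R (c + 1)) S.J A) : ‖A‖ ≤ c⁻¹ :=
  ContinuousLinearMap.opNorm_le_bound _ (by positivity)
    (hA.norm_apply_le (by linarith) (S.norm_R _ (by linarith)) S.norm_J)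

theorem symm (hA : IsPerturbed (S.R (c + 1)) S.J A) (ψ χ : K) : ⟪A ψ, χ⟫_ℂ = ⟪ψ, A χ⟫_ℂ :=
  hA.symm (S.R_symm _) S.J_symm ψ χ

theorem e_ne_zero (g : OneBoson μ) (x : ℤˣ) : S.e g x ≠ 0 := by
  rw [← norm_pos_iff, S.norm_e]; exact Real.exp_pos _

theorem norm_pos (hc : 1 ≤ c) (hA : IsPerturbed (S.R (c + 1)) S.J A) : 0 < ‖A‖ := by
  rw [norm_pos_iff]
  rintro rfl
  exact S.e_ne_zero 0 1 (hA.injective (S.R_inj _ (by linarith)) rfl)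

theorem pow_pairs_mem (hω0 : ∀ k, 0 ≤ ω k) (hc : 1 ≤ c) (hA : IsPerturbed (S.R (c + 1)) S.J A)
    (g : OneBoson μ) {y : OneBoson μ} (hy : UnitMul f y) (x : ℤˣ) (n : ℕ) :
    ((A ^ n) (S.e (g + y) x), (A ^ n) (S.e y x), (A ^ n) (S.e y x)) ∈
      biCone (S.pairs 0 ‖g‖ (overlap f g) False) :=
  S.tri_pow_mem_biCone hc le_rfl hA (by rwa [add_zero]) (S.T_pairs hω0 le_rfl _ _ _)
    (S.J_pairs _ _ _ _) (subset_biCone (S.pairs_mem hω0 hy x)) n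

theorem re_vac_pow_nonneg (hω0 : ∀ k, 0 ≤ ω k) (hc : 1 ≤ c)
    (hA : IsPerturbed (S.R (c + 1)) S.J A) (x : ℤˣ) (n : ℕ) :
    0 ≤ RCLike.re ⟪S.vac, (A ^ n) (S.e 0 x)⟫_ℂ :=
  S.re_vac_nonneg (S.pow_pairs_mem hω0 hc hA 0 unitMul_zero x n)

theorem re_vac_pow_le (hω0 : ∀ k, 0 ≤ ω k) (hc : 1 ≤ c)
    (hA : IsPerturbed (S.R (c + 1)) S.J A) (x : ℤˣ) (n : ℕ) :
    RCLike.re ⟪S.vac, (A ^ n) (S.e 0 x)⟫_ℂ ≤ RCLike.re ⟪S.vac, (A ^ n) S.vac⟫_ℂ := by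
  have h1 := S.re_vac_pow_nonneg hω0 hc hA 1 n
  have h2 := S.re_vac_pow_nonneg hω0 hc hA (-1) n
  have h3 : ⟪S.vac, (A ^ n) S.vac⟫_ℂ =
      ⟪S.vac, (A ^ n) (S.e 0 1)⟫_ℂ + ⟪S.vac, (A ^ n) (S.e 0 (-1))⟫_ℂ := by
    rw [← inner_add_right, ← map_add]; rfl
  rw [h3, map_add]
  rcases Int.units_eq_one_or x with rfl | rfl <;> linarith

/-- The exponential vectors are total, so their growth under Aⁿ determines ‖A‖; it is controlled by
the single sequence ⟨Ω, AⁿΩ⟩. -/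
theorem exists_norm_pow_le (hω0 : ∀ k, 0 ≤ ω k) (hc : 1 ≤ c)
    (hA : IsPerturbed (S.R (c + 1)) S.J A) (g : OneBoson μ) (x : ℤˣ) :
    ∃ L, ∀ n, ‖(A ^ n) (S.e g x)‖ ≤ L * RCLike.re ⟪S.vac, (A ^ n) S.vac⟫_ℂ := by
  refine ⟨Real.exp (overlap f g + (‖g‖ + ‖f‖) ^ 2 / 2), fun n => ?_⟩
  have h := S.norm_fst_le (norm_nonneg g) (S.pow_pairs_mem hω0 hc hA g unitMul_zero x n)
  simp only [add_zero] at h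
  exact h.trans (mul_le_mul_of_nonneg_left (S.re_vac_pow_le hω0 hc hA x n) (Real.exp_pos _).le)

theorem re_exp_inner_le {y z : OneBoson μ} (hy : UnitMul f y) (hz : UnitMul f z) :
    (Complex.exp ⟪y, z⟫_ℂ).re ≤ Real.exp (‖f‖ ^ 2) := by
  refine (Complex.re_le_norm _).trans ?_
  rw [Complex.norm_exp]
  gcongr
  refine (Complex.re_le_norm _).trans ((norm_inner_le_norm _ _).trans ?_)
  rw [sq]
  exact mul_le_mul hy.norm_le hz.norm_le (norm_nonneg _) (norm_nonneg _)

/-- Two generators have inner product 2e^{⟨y,z⟩} ≤ 2e^{‖f‖²}, while each pairs to 2 with Ω. Parity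
gains the factor ½ over the cone of single unit vectors, and this factor gives the overlap bound its
constant 1. -/
theorem re_inner_parity_le {v w : K × K × K} (hv : v ∈ biCone S.parity) (hw : w ∈ biCone S.parity) :
    RCLike.re ⟪v.1, w.1⟫_ℂ ≤
      Real.exp (‖f‖ ^ 2) / 2 * RCLike.re ⟪S.vac, v.1⟫_ℂ * RCLike.re ⟪S.vac, w.1⟫_ℂ := by
  set C := Real.exp (‖f‖ ^ 2) / 2 with hC
  have hvac (y : OneBoson μ) : ⟪S.vac, S.e y 1 + S.e (-y) (-1)⟫_ℂ = 2 := by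
    rw [inner_add_right, S.inner_vac, S.inner_vac]; norm_num
  have h1 : ∀ g ∈ S.parity, RCLike.re ⟪g.1, w.1⟫_ℂ ≤
      C * RCLike.re ⟪S.vac, g.1⟫_ℂ * RCLike.re ⟪S.vac, w.1⟫_ℂ := by
    intro g hg
    have := hw (reF (-g.1 + ((C * RCLike.re ⟪S.vac, g.1⟫_ℂ : ℝ) : ℂ) • S.vac) 0 0) ?_
    · simp only [reF_apply, inner_add_left, inner_neg_left, inner_smul_left, Complex.conj_ofReal,
        inner_zero_left, map_zero, add_zero, RCLike.re_to_complex, Complex.add_re, Complex.neg_re,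
        Complex.re_ofReal_mul] at this ⊢
      linarith
    rintro _ ⟨z, hz, rfl⟩
    obtain ⟨y, hy, rfl⟩ := hg
    have hflip : ⟪S.e (-y) (-1), S.e z 1⟫_ℂ = 0 := by
      have := S.inner_e_flip (-y) z (-1)
      rwa [neg_neg] at this
    simp only [reF_apply, inner_add_left, inner_neg_left, inner_smul_left, Complex.conj_ofReal,
      inner_zero_left, map_zero, add_zero, hvac, inner_add_right, S.inner_e_same, S.inner_e_flip,
      hflip, RCLike.re_to_complex, Complex.add_re, Complex.neg_re, Complex.re_ofReal_mul,
      inner_neg_right, neg_neg, zero_add, S.inner_vac, Complex.one_re, Complex.re_ofNat]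
    have := re_exp_inner_le hy hz
    rw [hC]
    linarith
  have := hv (reF (-w.1 + ((C * RCLike.re ⟪S.vac, w.1⟫_ℂ : ℝ) : ℂ) • S.vac) 0 0) ?_
  · simp only [reF_apply, inner_add_left, inner_neg_left, inner_smul_left, Complex.conj_ofReal,
      inner_zero_left, map_zero, add_zero, RCLike.re_to_complex, Complex.add_re, Complex.neg_re,
      Complex.re_ofReal_mul] at this ⊢
    have h2 : (⟪v.1, w.1⟫_ℂ).re = (⟪w.1, v.1⟫_ℂ).re := by
      rw [← inner_conj_symm, Complex.conj_re]
    rw [h2]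
    linarith
  intro g hg
  have h2 := h1 g hg
  simp only [reF_apply, inner_add_left, inner_neg_left, inner_smul_left, Complex.conj_ofReal,
    inner_zero_left, map_zero, add_zero, RCLike.re_to_complex, Complex.add_re, Complex.neg_re,
    Complex.re_ofReal_mul] at h2 ⊢
  have h3 : (⟪g.1, w.1⟫_ℂ).re = (⟪w.1, g.1⟫_ℂ).re := by
    rw [← inner_conj_symm, Complex.conj_re]
  rw [h3] at h2
  linarith

/-- ⟨Ω, A²ⁿΩ⟩ = ‖AⁿΩ‖², and AⁿΩ lies in the parity cone. -/
theorem re_vac_pow_two_le (hc : 1 ≤ c) (hA : IsPerturbed (S.R (c + 1)) S.J A) (n : ℕ) :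
    RCLike.re ⟪S.vac, (A ^ (n * 2)) S.vac⟫_ℂ ≤
      Real.exp (‖f‖ ^ 2) / 2 * RCLike.re ⟪S.vac, (A ^ n) S.vac⟫_ℂ ^ 2 := by
  have h0 : ((S.vac, 0, 0) : K × K × K) ∈ biCone S.parity :=
    subset_biCone ⟨0, unitMul_zero, by rw [neg_zero]; rfl⟩
  have h1 := S.tri_pow_mem_biCone hc le_rfl hA (by rwa [add_zero]) (S.T_parity 0) S.J_parity h0 n
  have h2 := S.re_inner_parity_le h1 h1
  have h3 : ⟪S.vac, (A ^ (n * 2)) S.vac⟫_ℂ = ⟪(A ^ n) S.vac, (A ^ n) S.vac⟫_ℂ := by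
    rw [inner_pow_left (S.symm hA), mul_two, pow_add]; rfl
  rw [h3]
  refine h2.trans (le_of_eq ?_)
  ring

/-- Exponential vectors of real multiples of `f` bounded by `|f|`. -/
def unitVecs : Set K := {v | ∃ y x, UnitMul f y ∧ v = S.e y x}

theorem pow_e_mem (hω0 : ∀ k, 0 ≤ ω k) (hc : 1 ≤ c) (hA : IsPerturbed (S.R (c + 1)) S.J A)
    {y : OneBoson μ} (hy : UnitMul f y) (x : ℤˣ) (n : ℕ) :
    (A ^ n) (S.e y x) ∈ biCone S.unitVecs := by
  refine map_mem_biCone ((ContinuousLinearMap.fst ℝ K K).comp (ContinuousLinearMap.snd ℝ K (K × K)))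
    ?_ (S.pow_pairs_mem hω0 hc hA 0 hy x n)
  rintro _ ⟨x, y, h, q, ζ, h1, -, -, -, -, -, -, rfl⟩
  exact subset_biCone ⟨y, x, h1, rfl⟩

/-- The doubling bound and the growth bound yield ‖A‖ⁿ ≤ ½e^{‖f‖²}⟨Ω, AⁿΩ⟩, hence a nonzero ergodic
limit. As a limit of positive combinations of AʲΩ it stays in the cone. -/
theorem exists_ground [CompleteSpace K] (hω0 : ∀ k, 0 ≤ ω k) (hc : 1 ≤ c)
    (hA : IsPerturbed (S.R (c + 1)) S.J A) :
    ∃ ψ, A ψ = ((‖A‖ : ℝ) : ℂ) • ψ ∧ 2 * Real.exp (-‖f‖ ^ 2) ≤ ‖ψ‖ ^ 2 ∧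
      ⟪S.vac, ψ⟫_ℂ = ((‖ψ‖ ^ 2 : ℝ) : ℂ) ∧ ψ ∈ biCone S.unitVecs := by
  have hnn : ∀ n, 0 ≤ RCLike.re ⟪S.vac, (A ^ n) S.vac⟫_ℂ := fun n =>
    (S.re_vac_pow_nonneg hω0 hc hA 1 n).trans (S.re_vac_pow_le hω0 hc hA 1 n)
  have hpow := norm_pow_le_of_total (S.norm_pos hc hA) (S.symm hA) hnn
    (by positivity : 0 < Real.exp (‖f‖ ^ 2) / 2) (S.re_vac_pow_two_le hc hA)
    (w := fun p : OneBoson μ × ℤˣ => S.e p.1 p.2) (fun χ h => S.total χ fun g x => h (g, x))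
    fun p => S.exists_norm_pow_le hω0 hc hA p.1 p.2
  obtain ⟨ψ, h1, h2, h3, h4⟩ := exists_eigenvector (Ω := S.vac) (κ := 2 * Real.exp (-‖f‖ ^ 2))
    (S.norm_pos hc hA) (fun n => by
      have h := mul_le_mul_of_nonneg_left (hpow n)
        (by positivity : 0 ≤ 2 * Real.exp (-‖f‖ ^ 2))
      refine h.trans (le_of_eq ?_)
      have : Real.exp (-‖f‖ ^ 2) * Real.exp (‖f‖ ^ 2) = 1 := by rw [← Real.exp_add]; simp
      linear_combination (RCLike.re ⟪S.vac, (A ^ n) S.vac⟫_ℂ) * this)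
  refine ⟨ψ, h1, h2, h3, mem_biCone_of_tendsto h4 fun n => sum_mem_biCone _ fun j _ =>
    smul_mem_biCone (by positivity) ?_⟩
  rw [vac, map_add]
  exact add_mem_biCone (S.pow_e_mem hω0 hc hA unitMul_zero _ _)
    (S.pow_e_mem hω0 hc hA unitMul_zero _ _)

/-! ### Uniqueness of the ground state -/

/-- A' has an eigenvector for a = ‖A'‖. A and A' invert the same operator shifted by c and c + δ, so
A has the same eigenvector with eigenvalue a/(1 - δa) > a; the bound a ≤ (c + δ)⁻¹ gives δa < 1. -/
theorem norm_lt_norm [CompleteSpace K] (hω0 : ∀ k, 0 ≤ ω k) (hc : 1 ≤ c) (hδ : 0 < δ)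
    (hA : IsPerturbed (S.R (c + 1)) S.J A) (hA' : IsPerturbed (S.R (c + δ + 1)) S.J A') :
    ‖A'‖ < ‖A‖ := by
  obtain ⟨ψ, h1, h2, -, -⟩ := S.exists_ground hω0 (by linarith : 1 ≤ c + δ) hA'
  set a := ‖A'‖ with ha
  have ha0 : 0 < a := S.norm_pos (by linarith : 1 ≤ c + δ) hA'
  have hle : a ≤ (c + δ)⁻¹ := S.norm_le (by linarith : 1 ≤ c + δ) hA'
  have hδa : δ * a < 1 := by
    have : a * (c + δ) ≤ 1 := by
      rwa [← one_div, le_div_iff₀ (by linarith)] at hle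
    nlinarith
  have h3 : A' ψ = S.R (c + δ + 1) (ψ + S.J (A' ψ)) := hA' ψ
  have h4 := S.R_shift (c + 1) (c + δ + 1) (by linarith) (by linarith) (ψ + S.J (A' ψ))
  rw [← h3] at h4
  have h5 : A (((1 - δ * a : ℝ) : ℂ) • ψ) = ((a : ℝ) : ℂ) • ψ := by
    refine hA.unique (by linarith) (S.norm_R _ (by linarith)) S.norm_J ?_
    rw [h1] at h4
    rw [← h4]
    congr 1
    rw [h4, map_smul, smul_smul]
    push_cast
    module
  have hψ : 0 < ‖ψ‖ := by
    have := Real.exp_pos (-‖f‖ ^ 2)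
    by_contra h0
    have : ‖ψ‖ = 0 := le_antisymm (not_lt.1 h0) (norm_nonneg _)
    rw [this] at h2
    norm_num at h2
    linarith
  have h6 := A.le_opNorm (((1 - δ * a : ℝ) : ℂ) • ψ)
  rw [h5, norm_smul, norm_smul, Complex.norm_real, Complex.norm_real,
    Real.norm_of_nonneg ha0.le, Real.norm_of_nonneg (by linarith), ← mul_assoc] at h6
  have h7 := le_of_mul_le_mul_right h6 hψ
  have : 0 < ‖A‖ := S.norm_pos hc hA
  nlinarith [mul_pos hδ ha0, mul_pos (mul_pos hδ ha0) this]

/-- Nonnegativity on the unit exponential vectors. -/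
def Pos (χ : K) : Prop := ∀ y x, UnitMul f y → 0 ≤ RCLike.re ⟪χ, S.e y x⟫_ℂ

theorem inner_pow_eigen (hA : IsPerturbed (S.R (c + 1)) S.J A) {χ : K}
    (hχ : A χ = ((‖A‖ : ℝ) : ℂ) • χ) (n : ℕ) (v : K) :
    RCLike.re ⟪χ, (A ^ n) v⟫_ℂ = ‖A‖ ^ n * RCLike.re ⟪χ, v⟫_ℂ := by
  rw [← inner_pow_left (S.symm hA)]
  have : (A ^ n) χ = ((‖A‖ ^ n : ℝ) : ℂ) • χ := by
    induction n with
    | zero => simp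
    | succ n ih =>
      have h1 : A ^ (n + 1) = A * A ^ n := pow_succ' A n
      rw [h1]
      change A ((A ^ n) χ) = _
      rw [ih, map_smul, hχ, smul_smul]
      push_cast; ring_nf
  rw [this, inner_smul_left, Complex.conj_ofReal, RCLike.re_to_complex, Complex.re_ofReal_mul]
  rfl

/-- Harnack inequality with a gap. Along the evolution h dies out, so ε(h + y) is compared with
e^{-ζ}ε(y), |ζ| ≤ ∫|f||h|; the remainder is of size q and evolves with A', hence is negligible
against ‖A‖ⁿ. The hypothesis `h12` handles the limiting comparison, with real ζ if `b` holds. -/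
theorem re_inner_le_of_support [CompleteSpace K] (hω0 : ∀ k, 0 ≤ ω k) (hc : 1 ≤ c) (hδ : 0 < δ)
    (hA : IsPerturbed (S.R (c + 1)) S.J A) {χ χ₂ : K} (hχ : A χ = ((‖A‖ : ℝ) : ℂ) • χ)
    (hχ₂ : A χ₂ = ((‖A‖ : ℝ) : ℂ) • χ₂) {b : Prop}
    (h12 : ∀ y x (ζ : ℂ), UnitMul f y → (b → ζ.im = 0) →
      RCLike.re ⟪χ, Complex.exp (-ζ) • S.e y x⟫_ℂ ≤ Real.exp ‖ζ‖ * RCLike.re ⟪χ₂, S.e y x⟫_ℂ)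
    (hpos : S.Pos χ₂) {y h : OneBoson μ} (hy : UnitMul f y)
    (hs : ∀ᵐ k ∂μ, ω k < δ → h k = 0) (hb : b → RealMul f h) (x : ℤˣ) :
    RCLike.re ⟪χ, S.e (h + y) x⟫_ℂ ≤ Real.exp (overlap f h) * RCLike.re ⟪χ₂, S.e y x⟫_ℂ := by
  obtain ⟨A', hA'⟩ := exists_isPerturbed (R := S.R (c + δ + 1)) (J := S.J)
    (by linarith : 0 < c + δ) (S.norm_R _ (by linarith)) S.norm_J
  set B := ‖h‖ with hB
  set C := overlap f h with hC
  set L := ((B + ‖f‖) + 1) * Real.exp ((B + ‖f‖) ^ 2 / 2) with hL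
  have hL0 : 0 ≤ L := by positivity
  -- A bound for |⟨χ, e^{-ζ}(ε(h + y) - ε(y))⟩|/q from the local Lipschitz constant L of ε and ‖h‖ ≤
  -- qB.
  set D := Real.exp C * ‖χ‖ * L * B with hD
  have hD0 : 0 ≤ D := by positivity
  have hmem : (S.e (h + y) x, S.e y x, S.e y x) ∈ S.pairs δ B C b :=
    ⟨x, y, h, 1, 0, hy, zero_le_one, le_rfl, (one_mul _).ge, by simp [hC], hs,
      fun hb' => ⟨rfl, hb hb'⟩, by simp⟩
  have hΦ : ∀ g ∈ S.pairs δ B C b,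
      0 ≤ reF (-χ) (((Real.exp C : ℝ) : ℂ) • χ₂) ((D : ℂ) • S.vac) g := by
    rintro _ ⟨x, y, h, q, ζ, h1, h2, h3, h4, h5, h6, h7, rfl⟩
    have e0 : ‖ζ‖ ≤ C := by linarith [overlap_nonneg f h]
    have e1 := h12 y x ζ h1 fun hb => (h7 hb).1
    have e2 : Real.exp ‖ζ‖ * RCLike.re ⟪χ₂, S.e y x⟫_ℂ ≤ Real.exp C * RCLike.re ⟪χ₂, S.e y x⟫_ℂ :=
      mul_le_mul_of_nonneg_right (Real.exp_le_exp.2 e0) (hpos y x h1)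
    have hhB : ‖h‖ ≤ B := h4.trans (mul_le_of_le_one_left (norm_nonneg _) h3)
    have e3 : ‖S.e (h + y) x - S.e y x‖ ≤ L * (q * B) := by
      have := S.lip (B + ‖f‖) y (h + y) x (by linarith [h1.norm_le, norm_nonneg h])
        ((norm_add_le _ _).trans (add_le_add hhB h1.norm_le))
      rw [add_sub_cancel_right] at this
      exact this.trans (mul_le_mul_of_nonneg_left h4 hL0)
    have e4 : ‖Complex.exp (-ζ)‖ ≤ Real.exp C := by
      rw [Complex.norm_exp, Complex.neg_re]
      have := Complex.abs_re_le_norm ζ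
      rw [abs_le] at this
      gcongr
      linarith
    have e5 : RCLike.re ⟪χ, Complex.exp (-ζ) • (S.e (h + y) x - S.e y x)⟫_ℂ ≤ D * q := by
      refine (RCLike.re_le_norm _).trans ((norm_inner_le_norm _ _).trans ?_)
      rw [norm_smul]
      calc ‖χ‖ * (‖Complex.exp (-ζ)‖ * ‖S.e (h + y) x - S.e y x‖)
          ≤ ‖χ‖ * (Real.exp C * (L * (q * B))) := by gcongr
        _ = D * q := by rw [hD]; ring
    have e6 : RCLike.re ⟪χ, Complex.exp (-ζ) • S.e (h + y) x⟫_ℂ =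
        RCLike.re ⟪χ, Complex.exp (-ζ) • S.e y x⟫_ℂ +
          RCLike.re ⟪χ, Complex.exp (-ζ) • (S.e (h + y) x - S.e y x)⟫_ℂ := by
      rw [← map_add, ← inner_add_right, ← smul_add, add_sub_cancel]
    rw [reF_apply, inner_neg_left, map_neg]
    simp only [inner_smul_left, Complex.conj_ofReal, inner_smul_right (_ : K) _ (q : ℂ), S.inner_vac,
      RCLike.re_to_complex, Complex.re_ofReal_mul, mul_one, Complex.ofReal_re] at *
    linarith
  -- The eigenvalue equations extract ‖A‖ⁿ from the first two components; the third grows only like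
  -- ‖A'‖ⁿ.
  have hfin : ∀ n : ℕ, ‖A‖ ^ n * (RCLike.re ⟪χ, S.e (h + y) x⟫_ℂ -
      Real.exp C * RCLike.re ⟪χ₂, S.e y x⟫_ℂ) ≤ D * ‖S.vac‖ * ‖S.e y x‖ * ‖A'‖ ^ n := by
    intro n
    have h1 := S.tri_pow_mem_biCone hc hδ.le hA hA' (S.T_pairs hω0 hδ.le B C b)
      (S.J_pairs δ B C b) (subset_biCone hmem) n _ hΦ
    have e1 := S.inner_pow_eigen hA hχ n (S.e (h + y) x)
    have e2 := S.inner_pow_eigen hA hχ₂ n (S.e y x)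
    rw [reF_apply] at h1
    simp only [inner_neg_left, inner_smul_left, Complex.conj_ofReal, map_neg,
      RCLike.re_to_complex, Complex.re_ofReal_mul] at h1 e1 e2 ⊢
    rw [e1, e2] at h1
    have h2 : RCLike.re ⟪S.vac, (A' ^ n) (S.e y x)⟫_ℂ ≤ ‖S.vac‖ * (‖A'‖ ^ n * ‖S.e y x‖) := by
      refine (RCLike.re_le_norm _).trans ((norm_inner_le_norm _ _).trans ?_)
      refine mul_le_mul_of_nonneg_left ?_ (norm_nonneg _)
      have h3 : ∀ n : ℕ, ‖(A' ^ n) (S.e y x)‖ ≤ ‖A'‖ ^ n * ‖S.e y x‖ := by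
        intro n
        induction n with
        | zero => simp
        | succ n ih =>
          have h1 : A' ^ (n + 1) = A' * A' ^ n := pow_succ' A' n
          rw [h1, pow_succ', mul_assoc]
          exact (A'.le_opNorm _).trans (mul_le_mul_of_nonneg_left ih (norm_nonneg _))
      exact h3 n
    have h3 := mul_le_mul_of_nonneg_left h2 hD0
    rw [RCLike.re_to_complex] at h3
    linarith
  have := le_zero_of_pow_mul_le (norm_nonneg A') (S.norm_lt_norm hω0 hc hδ hA hA') hfin
  linarith

/-- The truncations of h to {ω ≥ 1/(j+1)} converge to h since ω > 0 almost everywhere, and their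
overlaps with f are no larger. The constant does not depend on the gap, so no mass is needed. -/
theorem re_inner_le [CompleteSpace K] (hω0 : ∀ k, 0 ≤ ω k) (hωpos : ∀ᵐ k ∂μ, 0 < ω k)
    (hc : 1 ≤ c) (hA : IsPerturbed (S.R (c + 1)) S.J A) {χ χ₂ : K}
    (hχ : A χ = ((‖A‖ : ℝ) : ℂ) • χ) (hχ₂ : A χ₂ = ((‖A‖ : ℝ) : ℂ) • χ₂) {b : Prop}
    (h12 : ∀ y x (ζ : ℂ), UnitMul f y → (b → ζ.im = 0) →
      RCLike.re ⟪χ, Complex.exp (-ζ) • S.e y x⟫_ℂ ≤ Real.exp ‖ζ‖ * RCLike.re ⟪χ₂, S.e y x⟫_ℂ)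
    (hpos : S.Pos χ₂) {y h : OneBoson μ} (hy : UnitMul f y) (hb : b → RealMul f h) (x : ℤˣ) :
    RCLike.re ⟪χ, S.e (h + y) x⟫_ℂ ≤ Real.exp (overlap f h) * RCLike.re ⟪χ₂, S.e y x⟫_ℂ := by
  let b : ℕ → M → ℝ := fun j k => if 1 / ((j : ℝ) + 1) ≤ ω k then 1 else 0
  have hb1 : ∀ j k, |b j k| ≤ 1 := fun j k => by
    simp only [b]; split_ifs <;> simp
  have hbm : ∀ j, BddMeas (b j) := fun j =>
    ⟨Measurable.ite (measurableSet_le measurable_const hω) measurable_const measurable_const,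
      1, hb1 j⟩
  have hlim : ∀ᵐ k ∂μ, Tendsto (fun j => b j k) atTop (𝓝 1) := by
    filter_upwards [hωpos] with k hk
    refine tendsto_const_nhds.congr' ?_
    filter_upwards [tendsto_one_div_add_atTop_nhds_zero_nat.eventually_le_const hk] with j hj
    exact (if_pos hj).symm
  have hh := tendsto_mulOp hbm hb1 h hlim
  have hcont : Continuous fun g => RCLike.re ⟪χ, S.e (g + y) x⟫_ℂ :=
    RCLike.continuous_re.comp
      (continuous_const.inner ((S.continuous_e x).comp (continuous_id.add continuous_const)))
  refine le_of_tendsto ((hcont.tendsto h).comp hh) (.of_forall fun j => ?_)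
  refine (S.re_inner_le_of_support (δ := 1 / ((j : ℝ) + 1)) hω0 hc (by positivity) hA hχ hχ₂ h12
    hpos hy ?_ (fun h' => ?_) x).trans ?_
  · filter_upwards [mulOp_ae (hbm j) h] with k hk hlt
    rw [hk]
    simp only [b, if_neg (not_le.2 hlt), Complex.ofReal_zero, zero_mul]
  · filter_upwards [mulOp_ae (hbm j) h, hb h'] with k h1 ⟨r, h2⟩
    exact ⟨b j k * r, by rw [h1, h2]; push_cast; ring⟩
  · refine mul_le_mul_of_nonneg_right (Real.exp_le_exp.2 (overlap_mono ?_)) (hpos y x hy)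
    filter_upwards [mulOp_ae (hbm j) h] with k hk
    rw [hk, norm_mul, Complex.norm_real, Real.norm_eq_abs]
    exact mul_le_of_le_one_left (norm_nonneg _) (hb1 j k)

theorem Pos.re_inner_smul_le {χ : K} (hpos : S.Pos χ) (y : OneBoson μ) (x : ℤˣ) (ζ : ℂ)
    (hy : UnitMul f y) (hζ : ζ.im = 0) :
    RCLike.re ⟪χ, Complex.exp (-ζ) • S.e y x⟫_ℂ ≤ Real.exp ‖ζ‖ * RCLike.re ⟪χ, S.e y x⟫_ℂ := by
  have h1 : ζ = (ζ.re : ℂ) := Complex.ext rfl (by simpa using hζ)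
  have h2 : Complex.exp (-ζ) = ((Real.exp (-ζ.re) : ℝ) : ℂ) := by
    rw [h1]; push_cast; simp
  rw [h2, inner_smul_right, RCLike.re_to_complex, Complex.re_ofReal_mul]
  refine mul_le_mul_of_nonneg_right (Real.exp_le_exp.2 ?_) (hpos y x hy)
  have := Complex.abs_re_le_norm ζ
  rw [abs_le] at this
  linarith

/-! ### Harnack inequalities and strict positivity for nonnegative eigenvectors. -/

section Eigenvectors

variable [CompleteSpace K] (hω0 : ∀ k, 0 ≤ ω k) (hωpos : ∀ᵐ k ∂μ, 0 < ω k)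
    (hc : 1 ≤ c) (hA : IsPerturbed (S.R (c + 1)) S.J A)
include hω0 hωpos hc hA

/-- The Harnack inequality with base point 0 and perturbation h = y. -/
theorem Pos.le_zero {χ : K} (hχ : A χ = ((‖A‖ : ℝ) : ℂ) • χ) (hpos : S.Pos χ) {y : OneBoson μ}
    (hy : UnitMul f y) (x : ℤˣ) :
    RCLike.re ⟪χ, S.e y x⟫_ℂ ≤ Real.exp (‖f‖ ^ 2) * RCLike.re ⟪χ, S.e 0 x⟫_ℂ := by
  have := S.re_inner_le (b := True) hω0 hωpos hc hA hχ hχ (fun y x ζ h1 h2 =>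
    hpos.re_inner_smul_le S y x ζ h1 (h2 trivial)) hpos unitMul_zero (fun _ => hy.realMul) x
  rw [add_zero] at this
  exact this.trans (mul_le_mul_of_nonneg_right (Real.exp_le_exp.2 hy.overlap_le)
    (hpos 0 x unitMul_zero))

/-- The same with base point y and perturbation h = -y, so that h + y = 0. -/
theorem Pos.zero_le {χ : K} (hχ : A χ = ((‖A‖ : ℝ) : ℂ) • χ) (hpos : S.Pos χ) {y : OneBoson μ}
    (hy : UnitMul f y) (x : ℤˣ) :
    RCLike.re ⟪χ, S.e 0 x⟫_ℂ ≤ Real.exp (‖f‖ ^ 2) * RCLike.re ⟪χ, S.e y x⟫_ℂ := by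
  have := S.re_inner_le (b := True) hω0 hωpos hc hA hχ hχ (fun y x ζ h1 h2 =>
    hpos.re_inner_smul_le S y x ζ h1 (h2 trivial)) hpos hy (fun _ => hy.neg.realMul) x
  rw [neg_add_cancel] at this
  exact this.trans (mul_le_mul_of_nonneg_right (Real.exp_le_exp.2 hy.neg.overlap_le)
    (hpos y x hy))

/-- The flip couples the two spin components: pairing ‖A‖χ = R(χ + ‖A‖Jχ) with ε(0) at x leaves,
besides a nonnegative term, the pairing of χ with JR ε(0), which lives at -x. -/
theorem exists_flip (x : ℤˣ) : ∃ κ : ℝ, 0 < κ ∧ ∀ χ, A χ = ((‖A‖ : ℝ) : ℂ) • χ → S.Pos χ →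
    κ * RCLike.re ⟪χ, S.e 0 (-x)⟫_ℂ ≤ RCLike.re ⟪χ, S.e 0 x⟫_ℂ := by
  set w := S.R (c + 1) (S.e 0 x) with hw
  set G : Set K := {v | ∃ y, UnitMul f y ∧ v = S.e y x} with hG
  have hwG : w ∈ biCone G := by
    refine S.R_mem_biCone (by linarith) ?_ (subset_biCone ⟨0, unitMul_zero, rfl⟩)
    rintro t _ ⟨y, hy, rfl⟩
    rw [S.T_unit t x hy, Complex.coe_smul]
    exact smul_mem_biCone (Real.exp_pos _).le (subset_biCone ⟨_, hy.shift hω t x, rfl⟩)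
  -- Testing the cone with w itself gives ‖w‖² ≤ e^{‖f‖²/2}‖w‖⟨ε(0), w⟩, and w ≠ 0.
  have hp : 0 < RCLike.re ⟪S.e 0 x, w⟫_ℂ := by
    have hw0 : 0 < ‖w‖ := norm_pos_iff.2 fun h => S.e_ne_zero 0 x (S.R_inj _ (by linarith) _ h)
    have := hwG (reF₁ (-w + ((Real.exp (‖f‖ ^ 2 / 2) * ‖w‖ : ℝ) : ℂ) • S.e 0 x)) ?_
    · rw [reF₁_apply, inner_add_left, inner_neg_left, inner_smul_left, inner_self_eq] at this
      simp only [Complex.conj_ofReal, RCLike.re_to_complex, Complex.add_re, Complex.neg_re,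
        Complex.re_ofReal_mul, Complex.ofReal_re] at this ⊢
      by_contra h0
      push Not at h0
      have h1 : 0 < Real.exp (‖f‖ ^ 2 / 2) * ‖w‖ := by positivity
      nlinarith
    rintro _ ⟨y, hy, rfl⟩
    have h1 := (Complex.re_le_norm _).trans (norm_inner_le_norm (𝕜 := ℂ) w (S.e y x))
    rw [S.norm_e] at h1
    have h2 : Real.exp (‖y‖ ^ 2 / 2) ≤ Real.exp (‖f‖ ^ 2 / 2) := by
      have := hy.norm_le
      gcongr
    have h3 := mul_le_mul_of_nonneg_left h2 (norm_nonneg w)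
    rw [reF₁_apply, inner_add_left, inner_neg_left, inner_smul_left, S.inner_e_zero]
    simp only [Complex.conj_ofReal, RCLike.re_to_complex, Complex.add_re, Complex.neg_re,
        Complex.re_ofReal_mul, Complex.one_re]
    linarith
  refine ⟨Real.exp (-‖f‖ ^ 2) * RCLike.re ⟪S.e 0 x, w⟫_ℂ, by positivity, fun χ hχ hpos => ?_⟩
  have ha := S.norm_pos hc hA
  have h1 : 0 ≤ RCLike.re ⟪χ, w⟫_ℂ := by
    refine hwG (reF₁ χ) ?_
    rintro _ ⟨y, hy, rfl⟩
    exact hpos y x hy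
  -- On each generator ε(y) of the cone of w, the value of Jχ is at least e^{-‖f‖²} times its value
  -- at ε(0).
  have h2 : Real.exp (-‖f‖ ^ 2) * RCLike.re ⟪S.e 0 x, w⟫_ℂ * RCLike.re ⟪χ, S.e 0 (-x)⟫_ℂ ≤
      RCLike.re ⟪χ, S.J w⟫_ℂ := by
    have := hwG (reF₁ (S.J χ - ((Real.exp (-‖f‖ ^ 2) * RCLike.re ⟪χ, S.e 0 (-x)⟫_ℂ : ℝ) : ℂ) •
      S.e 0 x)) ?_
    · rw [reF₁_apply, inner_sub_left, S.J_symm, inner_smul_left] at this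
      simp only [Complex.conj_ofReal, RCLike.re_to_complex, Complex.sub_re,
        Complex.re_ofReal_mul] at this ⊢
      linarith
    rintro _ ⟨y, hy, rfl⟩
    have h3 := hpos.zero_le S hω0 hωpos hc hA hχ hy (-x)
    have h4 := mul_le_mul_of_nonneg_left h3 (Real.exp_pos (-‖f‖ ^ 2)).le
    have h5 : Real.exp (-‖f‖ ^ 2) * Real.exp (‖f‖ ^ 2) = 1 := by rw [← Real.exp_add]; simp
    rw [← mul_assoc, h5, one_mul] at h4
    rw [reF₁_apply, inner_sub_left, S.J_symm, inner_smul_left, S.J_e, S.inner_e_zero]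
    simp only [Complex.conj_ofReal, RCLike.re_to_complex, Complex.sub_re,
        Complex.re_ofReal_mul, Complex.one_re] at h4 ⊢
    linarith
  have h3 : ((‖A‖ : ℝ) : ℂ) • χ = S.R (c + 1) (χ + ((‖A‖ : ℝ) : ℂ) • S.J χ) := by
    rw [← map_smul, ← hχ]; exact hA χ
  have h4 : ‖A‖ * RCLike.re ⟪χ, S.e 0 x⟫_ℂ =
      RCLike.re ⟪χ, w⟫_ℂ + ‖A‖ * RCLike.re ⟪χ, S.J w⟫_ℂ := by
    have := congrArg (fun v => RCLike.re ⟪v, S.e 0 x⟫_ℂ) h3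
    simp only [S.R_symm, inner_add_left, inner_smul_left, S.J_symm, Complex.conj_ofReal,
      RCLike.re_to_complex, Complex.add_re, Complex.re_ofReal_mul] at this ⊢
    exact this
  refine h2.trans (le_of_mul_le_mul_left ?_ ha)
  linarith

/-- A strong maximum principle: one positive value spreads to ε(0) at the same spin, across the
flip, and then to every unit vector with a uniform constant. -/
theorem Pos.dichotomy {χ : K} (hχ : A χ = ((‖A‖ : ℝ) : ℂ) • χ) (hpos : S.Pos χ) :
    (∀ y x, UnitMul f y → RCLike.re ⟪χ, S.e y x⟫_ℂ = 0) ∨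
      ∃ ε : ℝ, 0 < ε ∧ ∀ y x, UnitMul f y → ε ≤ RCLike.re ⟪χ, S.e y x⟫_ℂ := by
  by_cases h0 : ∀ y x, UnitMul f y → RCLike.re ⟪χ, S.e y x⟫_ℂ = 0
  · exact Or.inl h0
  right
  push Not at h0
  obtain ⟨y, x, hy, hne⟩ := h0
  have hx : 0 < RCLike.re ⟪χ, S.e 0 x⟫_ℂ := by
    have h1 := hpos.le_zero S hω0 hωpos hc hA hχ hy x
    have h2 := lt_of_le_of_ne (hpos y x hy) hne.symm
    exact pos_of_mul_pos_right (h2.trans_le h1) (Real.exp_pos _).le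
  obtain ⟨κ, hκ, h3⟩ := S.exists_flip hω0 hωpos hc hA (-x)
  have h4 := h3 χ hχ hpos
  rw [neg_neg] at h4
  set m := RCLike.re ⟪χ, S.e 0 x⟫_ℂ with hm
  have hall : ∀ x', min m (κ * m) ≤ RCLike.re ⟪χ, S.e 0 x'⟫_ℂ := by
    intro x'
    by_cases h : x' = x
    · rw [h]; exact min_le_left _ _
    · rw [Int.units_ne_iff_eq_neg.1 h]; exact (min_le_right _ _).trans h4
  refine ⟨Real.exp (-‖f‖ ^ 2) * min m (κ * m), by positivity, fun z x' hz => ?_⟩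
  have h5 := (hall x').trans (hpos.zero_le S hω0 hωpos hc hA hχ hz x')
  have h6 := mul_le_mul_of_nonneg_left h5 (Real.exp_pos (-‖f‖ ^ 2)).le
  have h7 : Real.exp (-‖f‖ ^ 2) * Real.exp (‖f‖ ^ 2) = 1 := by rw [← Real.exp_add]; simp
  rwa [← mul_assoc, h7, one_mul] at h6

end Eigenvectors

theorem abs_re_inner_unit_le (χ : K) {y : OneBoson μ} (hy : UnitMul f y) (x : ℤˣ) :
    |RCLike.re ⟪χ, S.e y x⟫_ℂ| ≤ ‖χ‖ * Real.exp (‖f‖ ^ 2 / 2) := by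
  refine (RCLike.abs_re_le_norm _).trans ((norm_inner_le_norm _ _).trans ?_)
  rw [S.norm_e]
  have := hy.norm_le
  gcongr

/-! ### Comparison of eigenvectors and uniqueness. -/

section Eigenvectors

variable [CompleteSpace K] (hω0 : ∀ k, 0 ≤ ω k) (hωpos : ∀ᵐ k ∂μ, 0 < ω k)
    (hc : 1 ≤ c) (hA : IsPerturbed (S.R (c + 1)) S.J A)
include hω0 hωpos hc hA

/-- Touching argument. For the least t with χ ≤ tψ on unit vectors, the eigenvector tψ - χ is
nonnegative; were it bounded below, t could be lowered, so by the dichotomy it vanishes there. -/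
theorem exists_re_inner_eq {ψ : K} (hψ : A ψ = ((‖A‖ : ℝ) : ℂ) • ψ) {ε : ℝ} (hε : 0 < ε)
    (hψε : ∀ y x, UnitMul f y → ε ≤ RCLike.re ⟪ψ, S.e y x⟫_ℂ) {χ : K}
    (hχ : A χ = ((‖A‖ : ℝ) : ℂ) • χ) :
    ∃ t : ℝ, ∀ y x, UnitMul f y → RCLike.re ⟪χ, S.e y x⟫_ℂ = t * RCLike.re ⟪ψ, S.e y x⟫_ℂ := by
  set F := Real.exp (‖f‖ ^ 2 / 2) with hF
  have hF0 : 0 < F := Real.exp_pos _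
  let U : Set ℝ := {t | ∀ y x, UnitMul f y →
    RCLike.re ⟪χ, S.e y x⟫_ℂ ≤ t * RCLike.re ⟪ψ, S.e y x⟫_ℂ}
  have hU : U.Nonempty := by
    refine ⟨‖χ‖ * F / ε, fun y x hy => ?_⟩
    have h1 := (le_abs_self _).trans (S.abs_re_inner_unit_le χ hy x)
    refine h1.trans ?_
    rw [div_mul_eq_mul_div, le_div_iff₀ hε]
    exact mul_le_mul_of_nonneg_left (hψε y x hy) (by positivity)
  have hUb : BddBelow U := by
    refine ⟨RCLike.re ⟪χ, S.e 0 1⟫_ℂ / RCLike.re ⟪ψ, S.e 0 1⟫_ℂ, fun t ht => ?_⟩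
    rw [div_le_iff₀ (hε.trans_le (hψε 0 1 unitMul_zero))]
    exact ht 0 1 unitMul_zero
  have hUc : IsClosed U := by
    have : U = ⋂ (y : OneBoson μ) (x : ℤˣ) (_ : UnitMul f y),
        {t : ℝ | RCLike.re ⟪χ, S.e y x⟫_ℂ ≤ t * RCLike.re ⟪ψ, S.e y x⟫_ℂ} := by
      ext t; simp [U]
    rw [this]
    exact isClosed_iInter fun y => isClosed_iInter fun x => isClosed_iInter fun _ =>
      isClosed_le continuous_const (by fun_prop)
  have ht := hUc.csInf_mem hU hUb
  set t := sInf U with htdef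
  have hre : ∀ y x, RCLike.re ⟪((t : ℝ) : ℂ) • ψ - χ, S.e y x⟫_ℂ =
      t * RCLike.re ⟪ψ, S.e y x⟫_ℂ - RCLike.re ⟪χ, S.e y x⟫_ℂ := fun y x => by
    rw [inner_sub_left, inner_smul_left, Complex.conj_ofReal, map_sub]
    simp only [RCLike.re_to_complex, Complex.re_ofReal_mul]
  have hpos : S.Pos (((t : ℝ) : ℂ) • ψ - χ) := fun y x hy => by
    rw [hre]; exact sub_nonneg.2 (ht y x hy)
  have heig : A (((t : ℝ) : ℂ) • ψ - χ) = ((‖A‖ : ℝ) : ℂ) • (((t : ℝ) : ℂ) • ψ - χ) := by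
    rw [map_sub, map_smul, hψ, hχ]; module
  rcases hpos.dichotomy S hω0 hωpos hc hA heig with h | ⟨η, hη, h⟩
  · exact ⟨t, fun y x hy => by have := h y x hy; rw [hre] at this; linarith⟩
  · exfalso
    have hψ0 : 0 < ‖ψ‖ := by
      refine norm_pos_iff.2 fun h => ?_
      have := hψε 0 1 unitMul_zero
      rw [h, inner_zero_left, map_zero] at this
      linarith
    have hmem : t - η / (‖ψ‖ * F) ∈ U := fun y x hy => by
      have h1 := h y x hy
      rw [hre] at h1
      have h2 := (le_abs_self _).trans (S.abs_re_inner_unit_le ψ hy x)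
      have h3 : η / (‖ψ‖ * F) * RCLike.re ⟪ψ, S.e y x⟫_ℂ ≤ η := by
        rw [div_mul_eq_mul_div, div_le_iff₀ (by positivity)]
        exact mul_le_mul_of_nonneg_left h2 hη.le
      rw [sub_mul]
      linarith
    have h1 := csInf_le hUb hmem
    have h2 : 0 < η / (‖ψ‖ * F) := by positivity
    rw [← htdef] at h1
    linarith

/-- The Harnack inequality is applied with majorant χ₂ = 0 and with χ multiplied by z = ⟨χ, ε(g)⟩,
so that the bounded real part is |z|². Arbitrary complex g are allowed here, and these vectors are
total. -/
theorem eq_zero_of_inner_unit {χ : K} (hχ : A χ = ((‖A‖ : ℝ) : ℂ) • χ)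
    (h0 : ∀ y x, UnitMul f y → ⟪χ, S.e y x⟫_ℂ = 0) : χ = 0 := by
  refine S.total χ fun g x => ?_
  rw [← inner_conj_symm, map_eq_zero]
  set z := ⟪χ, S.e g x⟫_ℂ with hz
  have h1 := S.re_inner_le (χ := z • χ) (χ₂ := 0) (b := False) (h := g) hω0 hωpos hc hA
    (by rw [map_smul, hχ, smul_comm]) (by simp) (fun y x ζ hy _ => by
      rw [inner_smul_left, inner_smul_right, h0 y x hy]; simp) (fun y x _ => by simp)
    unitMul_zero False.elim x
  rw [add_zero, inner_smul_left, ← hz, inner_zero_left, map_zero, mul_zero, RCLike.conj_mul] at h1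
  have h2 : ‖z‖ ^ 2 ≤ 0 := by exact_mod_cast h1
  exact norm_eq_zero.1 (pow_eq_zero_iff two_ne_zero |>.1 (le_antisymm h2 (sq_nonneg _)))

theorem exists_unique_ground : ∃ ψ, A ψ = ((‖A‖ : ℝ) : ℂ) • ψ ∧
    2 * Real.exp (-‖f‖ ^ 2) ≤ ‖ψ‖ ^ 2 ∧ ⟪S.vac, ψ⟫_ℂ = ((‖ψ‖ ^ 2 : ℝ) : ℂ) ∧
    ∀ χ, A χ = ((‖A‖ : ℝ) : ℂ) • χ → ∃ z : ℂ, χ = z • ψ := by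
  obtain ⟨ψ, h1, h2, h3, h4⟩ := S.exists_ground hω0 hc hA
  refine ⟨ψ, h1, h2, h3, fun χ hχ => ?_⟩
  -- Inner products of unit exponential vectors are real and nonnegative, so the pairings of ψ,
  -- which lies in their cone, are too.
  have hreal : ∀ y x, UnitMul f y → ∀ g ∈ S.unitVecs, ∃ r : ℝ, 0 ≤ r ∧ ⟪g, S.e y x⟫_ℂ = r := by
    rintro y x hy _ ⟨z, x', hz, rfl⟩
    by_cases h : x = x'
    · rw [h, S.inner_e_same, hz.realMul.inner_eq hy.realMul]
      exact ⟨Real.exp (RCLike.re ⟪z, y⟫_ℂ), (Real.exp_pos _).le, by push_cast; rfl⟩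
    · rw [Int.units_ne_iff_eq_neg.1 h, S.inner_e_flip]
      exact ⟨0, le_rfl, by simp⟩
  have hpos : S.Pos ψ := fun y x hy => by
    have h := h4 (reF₁ (S.e y x)) fun g hg => by
      obtain ⟨r, hr, h⟩ := hreal y x hy g hg
      rw [reF₁_apply, ← inner_conj_symm, h, Complex.conj_ofReal]
      exact hr
    rwa [reF₁_apply, ← inner_conj_symm, RCLike.conj_re] at h
  -- Testing the cone with both signs of an imaginary multiple kills the imaginary part.
  have him : ∀ y x, UnitMul f y → ⟪ψ, S.e y x⟫_ℂ = ((RCLike.re ⟪ψ, S.e y x⟫_ℂ : ℝ) : ℂ) := by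
    intro y x hy
    have h (s : ℝ) : 0 ≤ -s * (⟪ψ, S.e y x⟫_ℂ).im := by
      have h := h4 (reF₁ (((s : ℂ) * Complex.I) • S.e y x)) fun g hg => by
        obtain ⟨r, hr, h⟩ := hreal y x hy g hg
        rw [reF₁_apply, inner_smul_left, ← inner_conj_symm, h, Complex.conj_ofReal]
        simp
      rw [reF₁_apply, inner_smul_left, ← inner_conj_symm] at h
      simp only [map_mul, Complex.conj_ofReal, Complex.conj_I, RCLike.re_to_complex,
        Complex.mul_re, Complex.mul_im, Complex.ofReal_re, Complex.ofReal_im, Complex.neg_re,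
        Complex.neg_im, Complex.I_re, Complex.I_im, Complex.conj_re, Complex.conj_im] at h
      linarith
    have e1 := h 1
    have e2 := h (-1)
    exact Complex.ext rfl (by rw [Complex.ofReal_im]; linarith)
  have hψ0 : 0 < ‖ψ‖ ^ 2 := (by positivity : 0 < 2 * Real.exp (-‖f‖ ^ 2)).trans_le h2
  obtain ⟨ε, hε, hψε⟩ : ∃ ε : ℝ, 0 < ε ∧ ∀ y x, UnitMul f y → ε ≤ RCLike.re ⟪ψ, S.e y x⟫_ℂ := by
    refine (hpos.dichotomy S hω0 hωpos hc hA h1).resolve_left fun h => hψ0.ne' ?_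
    have : ⟪ψ, S.vac⟫_ℂ = 0 := by
      rw [vac, inner_add_right, him 0 1 unitMul_zero, him 0 (-1) unitMul_zero,
        h 0 1 unitMul_zero, h 0 (-1) unitMul_zero]
      simp
    rw [← inner_conj_symm, this, map_zero] at h3
    exact_mod_cast h3.symm
  obtain ⟨t, ht⟩ := S.exists_re_inner_eq hω0 hωpos hc hA h1 hε hψε hχ
  -- Real parts only determine a real-linear relation; applying the comparison to iχ as well fixes
  -- the imaginary parts.
  obtain ⟨s, hs⟩ := S.exists_re_inner_eq hω0 hωpos hc hA h1 hε hψε (χ := Complex.I • χ)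
    (by rw [map_smul, hχ, smul_comm])
  refine ⟨(starRingEnd ℂ) (t + s * Complex.I), sub_eq_zero.1 ?_⟩
  refine S.eq_zero_of_inner_unit hω0 hωpos hc hA
    (by rw [map_sub, map_smul, h1, hχ, smul_sub, smul_comm]) fun y x hy => ?_
  have e1 := ht y x hy
  have e2 := hs y x hy
  rw [inner_sub_left, inner_smul_left, Complex.conj_conj, him y x hy, sub_eq_zero]
  rw [inner_smul_left] at e2
  simp only [RCLike.re_to_complex, Complex.conj_I] at e1 e2 ⊢
  refine Complex.ext ?_ ?_
  · simpa using e1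
  · simpa using e2

end Eigenvectors

end SpinSemigroup

/-! ### Operators on `L²({±1}; H)` -/

section Spin

variable {H : Type*} [NormedAddCommGroup H] [InnerProductSpace ℂ H]

/-- The Hilbert space `L²({±1}; H)`. -/
abbrev Spin (H : Type*) := PiLp 2 fun _ : ℤˣ => H

/-- The direct sum of two bounded operators. -/
def diag (B : ℤˣ → H →L[ℂ] H) : Spin H →L[ℂ] Spin H :=
  (PiLp.continuousLinearEquiv 2 ℂ fun _ : ℤˣ => H).symm.toContinuousLinearMap ∘L
    ContinuousLinearMap.pi fun x => B x ∘L PiLp.proj 2 (fun _ : ℤˣ => H) x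

/-- The spin flip `(J ψ)(x) = ψ(-x)`. -/
def flip (H : Type*) [NormedAddCommGroup H] [InnerProductSpace ℂ H] : Spin H →L[ℂ] Spin H :=
  (PiLp.continuousLinearEquiv 2 ℂ fun _ : ℤˣ => H).symm.toContinuousLinearMap ∘L
    ContinuousLinearMap.pi fun x => PiLp.proj 2 (fun _ : ℤˣ => H) (-x)

theorem diag_apply (B : ℤˣ → H →L[ℂ] H) (ψ : Spin H) (x : ℤˣ) : diag B ψ x = B x (ψ x) := rfl

theorem flip_apply (ψ : Spin H) (x : ℤˣ) : flip H ψ x = ψ (-x) := rfl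

theorem inner_diag_left {B : ℤˣ → H →L[ℂ] H} (hB : ∀ x ψ χ, ⟪B x ψ, χ⟫_ℂ = ⟪ψ, B x χ⟫_ℂ)
    (ψ χ : Spin H) : ⟪diag B ψ, χ⟫_ℂ = ⟪ψ, diag B χ⟫_ℂ := by
  rw [PiLp.inner_apply, PiLp.inner_apply]
  exact Finset.sum_congr rfl fun x _ => hB x _ _

theorem inner_flip_left (ψ χ : Spin H) : ⟪flip H ψ, χ⟫_ℂ = ⟪ψ, flip H χ⟫_ℂ := by
  rw [PiLp.inner_apply, PiLp.inner_apply, ← Equiv.sum_comp (Equiv.neg ℤˣ)]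
  refine Finset.sum_congr rfl fun x _ => ?_
  rw [Equiv.neg_apply, flip_apply, flip_apply, neg_neg]

theorem norm_diag_le {B : ℤˣ → H →L[ℂ] H} {K : ℝ} (hK : 0 ≤ K) (hB : ∀ x ψ, ‖B x ψ‖ ≤ K * ‖ψ‖)
    (ψ : Spin H) : ‖diag B ψ‖ ≤ K * ‖ψ‖ := by
  refine (pow_le_pow_iff_left₀ (norm_nonneg _) (by positivity) two_ne_zero).1 ?_
  rw [mul_pow, PiLp.norm_sq_eq_of_L2, PiLp.norm_sq_eq_of_L2, Finset.mul_sum]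
  refine Finset.sum_le_sum fun x _ => ?_
  rw [← mul_pow]
  exact pow_le_pow_left₀ (norm_nonneg _) (hB x _) 2

theorem norm_flip_le (ψ : Spin H) : ‖flip H ψ‖ ≤ ‖ψ‖ := by
  refine le_of_eq ((pow_left_inj₀ (norm_nonneg _) (norm_nonneg _) two_ne_zero).1 ?_)
  rw [PiLp.norm_sq_eq_of_L2, PiLp.norm_sq_eq_of_L2, ← Equiv.sum_comp (Equiv.neg ℤˣ)]
  refine Finset.sum_congr rfl fun x _ => ?_
  rw [Equiv.neg_apply, flip_apply, neg_neg]

theorem Spin.ext {ψ χ : Spin H} (h : ∀ x, ψ x = χ x) : ψ = χ := PiLp.ext h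

theorem mem_spinOp_graph (h : ℤˣ → H →ₗ.[ℂ] H) (p : Spin H × Spin H) :
    p ∈ (spinOp h).graph ↔ ∀ x, (p.1 x, p.2 x - p.1 x + p.1 (-x)) ∈ (h x).graph := by
  rw [LinearPMap.mem_graph_iff]
  constructor
  · rintro ⟨ψ, h1, h2⟩ x
    rw [LinearPMap.mem_graph_iff]
    refine ⟨⟨ψ.1 x, ψ.2 x⟩, by rw [← h1], ?_⟩
    have h3 : p.2 x = ψ.1 x - ψ.1 (-x) + h x ⟨ψ.1 x, ψ.2 x⟩ := by rw [← h2]; rfl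
    rw [h3, ← h1]
    abel_nf
  · intro hp
    have hd : ∀ x, p.1 x ∈ (h x).domain := fun x => LinearPMap.mem_domain_of_mem_graph (hp x)
    refine ⟨⟨p.1, hd⟩, rfl, Spin.ext fun x => ?_⟩
    have h3 : h x ⟨p.1 x, hd x⟩ = p.2 x - p.1 x + p.1 (-x) := (h x).mem_graph_snd_inj' ((h x).mem_graph ⟨p.1 x, hd x⟩) (hp x) rfl
    change p.1 x - p.1 (-x) + h x ⟨p.1 x, hd x⟩ = p.2 x
    rw [h3]
    abel

/-- (H + c)ψ = φ reads (h + c + 1)ψ = φ + Jψ, which is the fixed point equation ψ = R(φ + Jψ). -/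
theorem hasRes_spinOp {h : ℤˣ → H →ₗ.[ℂ] H} {c : ℝ} (hc : 0 < c) {B : ℤˣ → H →L[ℂ] H}
    (hB : ∀ x, HasRes (h x) (c + 1) (B x)) (hn : ∀ ψ, ‖diag B ψ‖ ≤ (c + 1)⁻¹ * ‖ψ‖)
    {A : Spin H →L[ℂ] Spin H} (hA : IsPerturbed (diag B) (flip H) A) : HasRes (spinOp h) c A := by
  refine ⟨hA.symm (inner_diag_left fun x => (hB x).1) inner_flip_left, fun p => ?_⟩
  have h1 : p ∈ (spinOp h).graph ↔ diag B (p.2 + (c : ℂ) • p.1 + flip H p.1) = p.1 := by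
    rw [mem_spinOp_graph]
    constructor
    · intro h1
      refine Spin.ext fun x => ?_
      refine Eq.trans ?_ (((hB x).2 _).1 (h1 x))
      rw [diag_apply]
      congr 1
      change p.2 x + (c : ℂ) • p.1 x + p.1 (-x) = p.2 x - p.1 x + p.1 (-x) + ((c + 1 : ℝ) : ℂ) • p.1 x
      push_cast
      rw [add_smul, one_smul]
      abel
    · intro h1 x
      rw [(hB x).2]
      have h2 : B x (p.2 x + (c : ℂ) • p.1 x + p.1 (-x)) = p.1 x := congrArg (fun ψ : Spin H => ψ x) h1
      refine Eq.trans ?_ h2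
      congr 1
      push_cast
      rw [add_smul, one_smul]
      abel
  rw [h1]
  exact ⟨fun h2 => hA.unique hc hn norm_flip_le h2.symm, fun h2 => by
    have := hA (p.2 + (c : ℂ) • p.1)
    rw [h2] at this
    exact this.symm⟩

theorem inner_single (x : ℤˣ) (v : H) (ψ : Spin H) :
    ⟪(PiLp.single 2 x v : Spin H), ψ⟫_ℂ = ⟪v, ψ x⟫_ℂ := by
  rw [PiLp.inner_apply, Finset.sum_eq_single x]
  · rw [PiLp.single_apply, if_pos rfl]
  · intro y _ hy
    rw [PiLp.single_apply, if_neg hy, inner_zero_left]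
  · exact fun h => absurd (Finset.mem_univ x) h

theorem flip_single (x : ℤˣ) (v : H) :
    flip H (PiLp.single 2 x v) = PiLp.single 2 (-x) v := by
  refine Spin.ext fun y => ?_
  rw [flip_apply, PiLp.single_apply, PiLp.single_apply]
  simp only [neg_eq_iff_eq_neg]

theorem diag_single (B : ℤˣ → H →L[ℂ] H) (x : ℤˣ) (v : H) :
    diag B (PiLp.single 2 x v) = PiLp.single 2 x (B x v) := by
  refine Spin.ext fun y => ?_
  rw [diag_apply, PiLp.single_apply, PiLp.single_apply]
  split_ifs with h
  · rw [h]
  · rw [map_zero]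

theorem single_smul (x : ℤˣ) (a : ℂ) (v : H) :
    (PiLp.single 2 x (a • v) : Spin H) = a • PiLp.single 2 x v := by
  refine Spin.ext fun y => ?_
  rw [PiLp.smul_apply, PiLp.single_apply, PiLp.single_apply, smul_ite, smul_zero]

theorem tendsto_diag {B : ℕ → ℕ → ℤˣ → H →L[ℂ] H} {B' : ℤˣ → H →L[ℂ] H} {a : ℕ → ℕ → ℂ}
    (h : ∀ x ψ, Tendsto (fun n => ∑ j ∈ Finset.range (n ^ 2), a n j • B n j x ψ) atTop
      (𝓝 (B' x ψ))) (ψ : Spin H) :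
    Tendsto (fun n => ∑ j ∈ Finset.range (n ^ 2), a n j • diag (B n j) ψ) atTop
      (𝓝 (diag B' ψ)) := by
  have h1 := tendsto_pi_nhds.2 fun x => h x (ψ x)
  have h2 := ((PiLp.continuousLinearEquiv 2 ℂ fun _ : ℤˣ => H).symm.continuous.tendsto _).comp h1
  refine h2.congr fun n => Spin.ext fun x => ?_
  rw [WithLp.ofLp_sum, Finset.sum_apply]
  rfl

/-- Conjugation of a bounded operator. -/
def conjOp (V U : H →ₗᵢ[ℂ] H) (B : H →L[ℂ] H) : H →L[ℂ] H :=
  V.toContinuousLinearMap ∘L B ∘L U.toContinuousLinearMap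

theorem conjOp_apply (V U : H →ₗᵢ[ℂ] H) (B : H →L[ℂ] H) (ψ : H) :
    conjOp V U B ψ = V (B (U ψ)) := rfl

theorem norm_conjOp_le {V U : H →ₗᵢ[ℂ] H} {B : H →L[ℂ] H} {K : ℝ} (h : ∀ ψ, ‖B ψ‖ ≤ K * ‖ψ‖)
    (ψ : H) : ‖conjOp V U B ψ‖ ≤ K * ‖ψ‖ := by
  rw [conjOp_apply, V.norm_map]
  exact (h _).trans_eq (by rw [U.norm_map])

theorem tendsto_conjOp (V U : H →ₗᵢ[ℂ] H) {B : ℕ → ℕ → H →L[ℂ] H} {B' : H →L[ℂ] H}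
    {a : ℕ → ℕ → ℂ}
    (h : ∀ ψ, Tendsto (fun n => ∑ j ∈ Finset.range (n ^ 2), a n j • B n j ψ) atTop (𝓝 (B' ψ)))
    (ψ : H) :
    Tendsto (fun n => ∑ j ∈ Finset.range (n ^ 2), a n j • conjOp V U (B n j) ψ) atTop
      (𝓝 (conjOp V U B' ψ)) := by
  refine ((V.continuous.tendsto _).comp (h (U ψ))).congr fun n => ?_
  simp only [Function.comp_apply, map_sum, map_smul, conjOp_apply]

theorem inner_conjOp_left {V U : H →ₗᵢ[ℂ] H} (hVU : ∀ ψ, V (U ψ) = ψ) (hUV : ∀ ψ, U (V ψ) = ψ)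
    {B : H →L[ℂ] H} (hB : ∀ ψ χ, ⟪B ψ, χ⟫_ℂ = ⟪ψ, B χ⟫_ℂ) (ψ χ : H) :
    ⟪conjOp V U B ψ, χ⟫_ℂ = ⟪ψ, conjOp V U B χ⟫_ℂ := by
  rw [conjOp_apply, conjOp_apply, ← U.inner_map_map, hUV, hB, ← V.inner_map_map (U ψ), hVU]

theorem HasRes.shift {T : H →ₗ.[ℂ] H} {c c' : ℝ} {A A' : H →L[ℂ] H} (h : HasRes T c A)
    (h' : HasRes T c' A') (φ : H) : A (φ - ((c' - c : ℝ) : ℂ) • A' φ) = A' φ := by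
  refine Eq.trans ?_ ((h.2 _).1 (h'.graph φ))
  congr 1
  push_cast
  rw [sub_smul]
  abel

theorem conjOp_shift {V U : H →ₗᵢ[ℂ] H} (hUV : ∀ ψ, U (V ψ) = ψ) {B B' : H →L[ℂ] H} {a : ℂ}
    (h : ∀ φ, B (φ - a • B' φ) = B' φ) (φ : H) :
    conjOp V U B (φ - a • conjOp V U B' φ) = conjOp V U B' φ := by
  rw [conjOp_apply, conjOp_apply, map_sub U, map_smul U, hUV, h]

end Spin

/-! ### The spin boson semigroup on Fock space -/

section Fock

variable {M : Type*} [MeasurableSpace M] {μ : Measure M} [SigmaFinite μ] {ω : M → ℝ}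

/-- Conjugation by Weyl operators. -/
def weylConj (f : OneBoson μ) (x : ℤˣ) (B : Fock μ →L[ℂ] Fock μ) : Fock μ →L[ℂ] Fock μ :=
  conjOp (weylU (-(((x : ℤ) : ℂ) • f))) (weylU (((x : ℤ) : ℂ) • f)) B

theorem hasRes_vanHove (hω : Measurable ω) (hω0 : ∀ k, 0 ≤ ω k) (hωpos : ∀ᵐ k ∂μ, 0 < ω k)
    {v : M → ℂ} (d : Decomposition μ ω v) {f : OneBoson μ}
    (hf : f =ᵐ[μ] fun k => v k / (ω k : ℂ)) {c : ℝ} (hc : 1 ≤ c) (x : ℤˣ) :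
    HasRes (vanHove d x) c (weylConj f x (res hω c)) :=
  (hasRes_dGamma hω hω0 hc).conj (weylU_neg_weylU _) (weylU_weylU_neg _)
    (mem_vanHove_graph_iff hω hω0 hωpos d hf x)

/-- W(xf) translates z to z + xf, the semigroup contracts, and W(-xf) translates back. Since x² = 1,
the scalar is linear in x apart from the vacuum term. -/
theorem weylConj_semi_expVec (hω : Measurable ω) (hω0 : ∀ k, 0 ≤ ω k) (f : OneBoson μ) (t : ℝ)
    (z : OneBoson μ) (x : ℤˣ) : weylConj f x (semi hω t) (expVec z) =
      Complex.exp (-⟪f, f - decay hω t f⟫_ℂ - ((x : ℤ) : ℂ) * ⟪f, z - decay hω t z⟫_ℂ) •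
        expVec (shift hω f t x z) := by
  set y := ((x : ℤ) : ℂ) • f with hy
  have h1 : weylConj f x (semi hω t) (expVec z) = weylU (-y) (semi hω t (weylU y (expVec z))) := rfl
  rw [h1, weylU_expVec y z]
  refine (congrArg (weylU (-y)) ((semi hω t).map_smul _ _)).trans ?_
  refine ((weylU (-y)).map_smul _ _).trans ?_
  rw [semi_expVec hω hω0, weylU_expVec, smul_smul, ← Complex.exp_add]
  have h2 : -y + decay hω t (y + z) = shift hω f t x z := by
    rw [shift, smul_sub, ← hy, map_add, hy, map_smul]; abel
  rw [h2]
  congr 2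
  have h3 : ⟪f, f⟫_ℂ = ((‖y‖ ^ 2 : ℝ) : ℂ) := by
    rw [inner_self_eq, hy, norm_smul, SpinSemigroup.norm_intUnit_cast, one_mul]
  have h4 := intUnit_cast_mul_self x
  rw [norm_neg, inner_neg_left, map_add, inner_add_right, inner_sub_right, inner_sub_right, h3, hy,
    map_smul]
  simp only [inner_smul_left, inner_smul_right, conj_intCast]
  push_cast
  linear_combination ⟪f, decay hω t f⟫_ℂ * h4

/-- The spin boson semigroup. -/
def spinSemigroup (hω : Measurable ω) (hω0 : ∀ k, 0 ≤ ω k) (f : OneBoson μ) :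
    SpinSemigroup hω f (SpinFock μ) where
  e g x := PiLp.single 2 x (expVec g)
  inner_e_same g h x := by
    rw [inner_single, PiLp.single_apply, if_pos rfl, inner_expVec]
  inner_e_flip g h x := by
    rw [inner_single, PiLp.single_apply, if_neg (by revert x; decide), inner_zero_right]
  total χ h := Spin.ext fun x => eq_zero_of_inner_expVec _ fun g => by
    rw [← inner_single]; exact h g x
  lip B g h x hg hh := by
    rw [← dist_eq_norm, PiLp.dist_single_same, dist_eq_norm]
    exact norm_expVec_sub_le hg hh
  J := flip (Fock μ)
  J_e g x := flip_single x _
  J_symm := inner_flip_left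
  norm_J := norm_flip_le
  T t := diag fun x => weylConj f x (semi hω t)
  T_e t z x := by
    refine (diag_single _ x _).trans ?_
    rw [weylConj_semi_expVec hω hω0, single_smul]
  R c := diag fun x => weylConj f x (res hω c)
  R_lim c hc := tendsto_diag fun x => tendsto_conjOp _ _ (tendsto_riemann_res hω hω0 hc)
  R_symm c := inner_diag_left fun x =>
    inner_conjOp_left (weylU_neg_weylU _) (weylU_weylU_neg _) (inner_res_left hω c)
  norm_R c hc := norm_diag_le (by positivity) fun x => norm_conjOp_le (norm_res_le hω hω0 hc)
  R_inj c hc ψ h := Spin.ext fun x => by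
    have h1 : weylU (-(((x : ℤ) : ℂ) • f)) (res hω c (weylU (((x : ℤ) : ℂ) • f) (ψ x))) = 0 :=
      congrArg (fun χ : SpinFock μ => χ x) h
    have h2 := (hasRes_dGamma hω hω0 hc).injective
      ((weylU _).injective (h1.trans (map_zero (weylU _)).symm))
    exact (weylU _).injective (h2.trans (map_zero (weylU _)).symm)
  R_shift c c' hc hc' φ := Spin.ext fun x =>
    conjOp_shift (weylU_weylU_neg _) ((hasRes_dGamma hω hω0 hc).shift (hasRes_dGamma hω hω0 hc')) _

end Fock

/-! ### The ground state and the spectrum -/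

section Spectrum

variable {H : Type*} [NormedAddCommGroup H] [InnerProductSpace ℂ H] {T : H →ₗ.[ℂ] H} {c : ℝ}
  {A : H →L[ℂ] H}

theorem mem_eigenspace_iff {z : ℂ} {ψ : H} : ψ ∈ eigenspace T z ↔ (ψ, z • ψ) ∈ T.graph := by
  rw [eigenspace, Submodule.mem_map, LinearPMap.mem_graph_iff]
  constructor
  · rintro ⟨x, hx, rfl⟩
    exact ⟨x, rfl, sub_eq_zero.1 hx⟩
  · rintro ⟨x, h1, h2⟩
    refine ⟨x, ?_, h1⟩
    rw [LinearMap.mem_ker, LinearMap.sub_apply, sub_eq_zero]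
    change T x = z • (x : H)
    rw [h2, h1]

theorem HasRes.mem_eigenspace_iff (h : HasRes T c A) {a : ℝ} (ha : a ≠ 0) {ψ : H} :
    ψ ∈ eigenspace T ((a⁻¹ - c : ℝ) : ℂ) ↔ A ψ = ((a : ℝ) : ℂ) • ψ := by
  have ha' : (a : ℂ) ≠ 0 := by exact_mod_cast ha
  rw [SpinBoson.mem_eigenspace_iff, h.2]
  have h1 : ((a⁻¹ - c : ℝ) : ℂ) • ψ + (c : ℂ) • ψ = (a : ℂ)⁻¹ • ψ := by
    push_cast
    rw [sub_smul, sub_add_cancel]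
  simp only [h1, map_smul]
  rw [inv_smul_eq_iff₀ ha']

theorem mem_opSpectrum_of_mem_eigenspace {z : ℂ} {ψ : H} (hψ : ψ ∈ eigenspace T z) (h0 : ψ ≠ 0) :
    z ∈ opSpectrum T := by
  rintro ⟨R, -, h⟩
  obtain ⟨x, hx, rfl⟩ := hψ
  refine h0 ?_
  have h1 : T x - z • (x : H) = 0 := hx
  have h2 := h x
  rw [h1, map_zero] at h2
  exact h2.symm

/-- T - t = (T + c) - (t + c), so its inverse is A(1 - (t + c)A)⁻¹, a Neumann series. -/
theorem HasRes.isResolventPoint [CompleteSpace H] (h : HasRes T c A) {t : ℝ} (h0 : 0 ≤ t + c)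
    (h1 : (t + c) * ‖A‖ < 1) : IsResolventPoint T t := by
  set s : ℂ := ((t + c : ℝ) : ℂ) with hs
  have hn : ‖s • A‖ < 1 := by
    rwa [norm_smul, hs, Complex.norm_real, Real.norm_of_nonneg h0]
  have hu := isUnit_one_sub_of_norm_lt_one hn
  set B := Ring.inverse (1 - s • A) with hB
  have hB1 (φ : H) : B φ - s • A (B φ) = φ := DFunLike.congr_fun (Ring.mul_inverse_cancel _ hu) φ
  have hB2 (φ : H) : B (φ - s • A φ) = φ := DFunLike.congr_fun (Ring.inverse_mul_cancel _ hu) φ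
  refine ⟨A ∘L B, fun φ => ?_, fun ψ => ?_⟩
  · have hg := h.graph (B φ)
    have hd : A (B φ) ∈ T.domain := LinearPMap.mem_domain_of_mem_graph hg
    refine ⟨hd, ?_⟩
    have h2 : T ⟨A (B φ), hd⟩ = B φ - (c : ℂ) • A (B φ) :=
      T.mem_graph_snd_inj' (T.mem_graph _) hg rfl
    change T ⟨A (B φ), hd⟩ - (t : ℂ) • A (B φ) = φ
    rw [h2]
    refine Eq.trans ?_ (hB1 φ)
    rw [hs]
    push_cast
    rw [add_smul]
    abel
  · have h2 : A (T ψ + (c : ℂ) • (ψ : H)) = ψ := (h.2 _).1 (T.mem_graph ψ)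
    change A (B (T ψ - (t : ℂ) • (ψ : H))) = ψ
    have h3 := hB2 (T ψ + (c : ℂ) • (ψ : H))
    rw [h2] at h3
    have h4 : T ψ + (c : ℂ) • (ψ : H) - s • (ψ : H) = T ψ - (t : ℂ) • (ψ : H) := by
      rw [hs]
      push_cast
      rw [add_smul]
      abel
    rw [h4] at h3
    rw [h3, h2]

theorem norm_inner_le_norm_pointProjection [CompleteSpace H] {z : ℂ} {ψ : H}
    (hψ : ψ ∈ eigenspace T z) (φ : H) : ‖⟪φ, ψ⟫_ℂ‖ ≤ ‖pointProjection T z φ‖ * ‖ψ‖ := by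
  have h1 : pointProjection T z ψ = ψ :=
    Submodule.starProjection_eq_self_iff.2 (Submodule.le_topologicalClosure _ hψ)
  have h2 : ⟪φ, ψ⟫_ℂ = ⟪pointProjection T z φ, ψ⟫_ℂ := by
    conv_lhs => rw [← h1]
    exact (Submodule.inner_starProjection_left_eq_right _ φ ψ).symm
  rw [h2]
  exact norm_inner_le_norm _ _

end Spectrum

/-! ### The bottom of the spectrum and the overlap in the abstract setting. -/

namespace SpinSemigroup

variable {M : Type*} [MeasurableSpace M] {μ : Measure M} {ω : M → ℝ}
  {hω : Measurable ω} {f : OneBoson μ} {K : Type*} [NormedAddCommGroup K]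
  [InnerProductSpace ℂ K] [CompleteSpace K] (S : SpinSemigroup hω f K)

/-- The construction is carried out at c = 1, with E = ‖A‖⁻¹ - 1. Other values of c serve only to
exclude spectrum far below. -/
theorem ground_state (hω0 : ∀ k, 0 ≤ ω k) (hωpos : ∀ᵐ k ∂μ, 0 < ω k) {T : K →ₗ.[ℂ] K}
    (hT : ∀ c, 1 ≤ c → ∀ A, IsPerturbed (S.R (c + 1)) S.J A → HasRes T c A) :
    IsSelfAdjoint T ∧ ∃ E : ℝ, IsGLB {t : ℝ | (t : ℂ) ∈ opSpectrum T} E ∧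
      Module.finrank ℂ (eigenspace T (E : ℂ)) = 1 ∧
      Real.exp (-‖f‖ ^ 2) ≤
        ‖pointProjection T (E : ℂ) (((1 / Real.sqrt 2 : ℝ) : ℂ) • S.vac)‖ ^ 2 := by
  have hex : ∀ c, 1 ≤ c → ∃ A, IsPerturbed (S.R (c + 1)) S.J A := fun c hc =>
    exists_isPerturbed (by linarith) (S.norm_R _ (by linarith)) S.norm_J
  obtain ⟨A, hA⟩ := hex 1 le_rfl
  have hres := hT 1 le_rfl A hA
  obtain ⟨ψ, h1, h2, h3, h4⟩ := S.exists_unique_ground hω0 hωpos le_rfl hA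
  have ha := S.norm_pos le_rfl hA
  have hψE : ψ ∈ eigenspace T ((‖A‖⁻¹ - 1 : ℝ) : ℂ) := (hres.mem_eigenspace_iff ha.ne').2 h1
  have hψ2 : 0 < ‖ψ‖ ^ 2 := (by positivity : 0 < 2 * Real.exp (-‖f‖ ^ 2)).trans_le h2
  have hψ0 : ψ ≠ 0 := by
    rintro rfl
    simp at hψ2
  refine ⟨hres.isSelfAdjoint, ‖A‖⁻¹ - 1, ⟨fun t ht => ?_, fun b hb =>
    hb (mem_opSpectrum_of_mem_eigenspace hψE hψ0)⟩, ?_, ?_⟩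
  · by_contra hlt
    push Not at hlt
    refine ht ?_
    -- Between -1 and E the Neumann series around the point -1 converges; below -1 the point t = -c
    -- is itself inverted by the operator for that c.
    rcases le_total (-1) t with h5 | h5
    · refine hres.isResolventPoint (by linarith) ?_
      have h6 : t + 1 < ‖A‖⁻¹ := by linarith
      rwa [← one_div, lt_div_iff₀ ha] at h6
    · obtain ⟨A', hA'⟩ := hex (-t) (by linarith)
      refine (hT (-t) (by linarith) A' hA').isResolventPoint (by linarith) ?_
      rw [add_neg_cancel, zero_mul]
      exact one_pos
  · refine (finrank_eq_one_iff_of_nonzero' (⟨ψ, hψE⟩ : eigenspace T ((‖A‖⁻¹ - 1 : ℝ) : ℂ))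
      fun h => hψ0 (congrArg Subtype.val h)).2 fun w => ?_
    obtain ⟨z, hz⟩ := h4 w ((hres.mem_eigenspace_iff ha.ne').1 w.2)
    exact ⟨z, Subtype.ext hz.symm⟩
  -- ⟨Ω, ψ⟩ = ‖ψ‖² bounds the norm of the projected normalized vacuum below by ‖ψ‖/√2. Its square is
  -- at least ½ · 2e^{-‖f‖²}.
  · have h5 := norm_inner_le_norm_pointProjection hψE (((1 / Real.sqrt 2 : ℝ) : ℂ) • S.vac)
    rw [inner_smul_left, Complex.conj_ofReal, h3, norm_mul, Complex.norm_real, Complex.norm_real,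
      Real.norm_of_nonneg (by positivity), Real.norm_of_nonneg (by positivity), sq, ← mul_assoc] at h5
    have h6 := le_of_mul_le_mul_right h5 (norm_pos_iff.2 hψ0)
    have h7 := pow_le_pow_left₀ (by positivity) h6 2
    refine le_trans ?_ h7
    rw [mul_pow, div_pow, Real.sq_sqrt zero_le_two]
    linarith

end SpinSemigroup

/-! ### Application to the renormalized Hamiltonian. -/

section Fock

variable {M : Type*} [MeasurableSpace M] {μ : Measure M} [SigmaFinite μ] {ω : M → ℝ}

theorem vacuumDown_eq (hω : Measurable ω) (hω0 : ∀ k, 0 ≤ ω k) (f : OneBoson μ) :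
    vacuumDown μ = ((1 / Real.sqrt 2 : ℝ) : ℂ) • (spinSemigroup hω hω0 f).vac := by
  refine Spin.ext fun x => ?_
  change _ = ((1 / Real.sqrt 2 : ℝ) : ℂ) • ((PiLp.single 2 1 (expVec 0) : SpinFock μ) x +
    (PiLp.single 2 (-1) (expVec 0) : SpinFock μ) x)
  rw [PiLp.single_apply, PiLp.single_apply]
  rcases Int.units_eq_one_or x with rfl | rfl
  · rw [if_pos rfl, if_neg (by decide), add_zero]; rfl
  · rw [if_neg (by decide), if_pos rfl, zero_add]; rfl

theorem hasRes_Hren (hω : Measurable ω) (hω0 : ∀ k, 0 ≤ ω k) (hωpos : ∀ᵐ k ∂μ, 0 < ω k)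
    {v : M → ℂ} (d : Decomposition μ ω v) {f : OneBoson μ}
    (hf : f =ᵐ[μ] fun k => v k / (ω k : ℂ)) {c : ℝ} (hc : 1 ≤ c) (A : SpinFock μ →L[ℂ] SpinFock μ)
    (hA : IsPerturbed ((spinSemigroup hω hω0 f).R (c + 1)) (spinSemigroup hω hω0 f).J A) :
    HasRes (Hren d) c A :=
  hasRes_spinOp (by linarith) (fun x => hasRes_vanHove hω hω0 hωpos d hf (by linarith) x)
    ((spinSemigroup hω hω0 f).norm_R (c + 1) (by linarith)) hA

end Fock

end SpinBoson

end

theorem theorem2p4 {M : Type*} [MeasurableSpace M] (μ : MeasureTheory.Measure M)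
    [MeasureTheory.SigmaFinite μ] (ω : M → ℝ) (hω : Measurable ω) (hω_nonneg : ∀ k, 0 ≤ ω k)
    (hω_pos : ∀ᵐ k ∂μ, 0 < ω k) (v : M → ℂ) (hv : v ∈ SpinBoson.Vuv μ ω)
    (d : SpinBoson.Decomposition μ ω v) :
    IsSelfAdjoint (SpinBoson.Hren d) ∧
    ∃ E : ℝ,
      IsGLB {t : ℝ | (t : ℂ) ∈ SpinBoson.opSpectrum (SpinBoson.Hren d)} E ∧
      Module.finrank ℂ (SpinBoson.eigenspace (SpinBoson.Hren d) (E : ℂ)) = 1 ∧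
      Real.exp (-∫ k, ‖v k / (ω k : ℂ)‖ ^ 2 ∂μ) ≤
        ‖SpinBoson.pointProjection (SpinBoson.Hren d) (E : ℂ) (SpinBoson.vacuumDown μ)‖ ^ 2 := by
  have hf := hv.2.coeFn_toLp
  -- The class of v/ω in L²; beyond it, the spin boson semigroup does not see the chosen
  -- decomposition.
  set f := hv.2.toLp _
  have hnorm : ∫ k, ‖v k / (ω k : ℂ)‖ ^ 2 ∂μ = ‖f‖ ^ 2 := by
    rw [SpinBoson.norm_sq_eq_integral]
    refine integral_congr_ae ?_
    filter_upwards [hf] with k hk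
    rw [hk]
  rw [hnorm, SpinBoson.vacuumDown_eq hω hω_nonneg f]
  exact (SpinBoson.spinSemigroup hω hω_nonneg f).ground_state hω_nonneg hω_pos
    fun c hc A hA => SpinBoson.hasRes_Hren hω hω_nonneg hω_pos d hf hc A hA
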